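/- **Setting.** Let $\mathcal X$ be a separable topological space with its Borel $\sigma$-algebra and $k$ a continuous kernel on $\mathcal X$ with $k(u,u)\le B_k$ and RKHS $H$. For a Borel probability measure $x$ on $\mathcal X$ let $\mu_x=\int k(\cdot,u)\,dx(u)\in H$, and let $X\subset H$ be the set of all $\mu_x$. Let $K$ be a kernel on $X$ with RKHS $\mathcal H$, $K(\mu,\mu)\le B_K$ and $\|K(\cdot,\mu)-K(\cdot,\mu')\|_{\mathcal H}\le L\|\mu-\mu'\|_H^{h}$, where $0<h\le 1$. Pairs $(x_i,y_i)$, $i=1,\dots,l$, are drawn i.i.d. from a law on (probability measures on $\mathcal X$) $\times\,\mathbb R$ with $|y|\le C$ a.s.; given these, for every $i$ one observes $y_i$ and i.i.d. points $x_{i,1},\dots,x_{i,N}\sim x_i$, with empirical distribution $\hat x_i$. Let $\rho$ be the law of $(\mu_x,y)$, $\rho_X$ its first marginal, $\mathcal E[f]=\int (f(\mu)-y)^2\,d\rho$, and $$f^\lambda_{\hat z}=\arg\min_{f\in\mathcal H}\ \frac1l\sum_{i=1}^l (f(\mu_{\hat x_i})-y_i)^2+\lambda\|f\|_{\mathcal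 H}^2 .$$ Fix $M,\Sigma,R,\alpha,\beta>0$, $b>1$, $c\in[1,2]$. The class $\mathcal P(b,c)$ consists of those $\rho$ for which there is a minimizer $f_{\mathcal H}$ of $\mathcal E$ over $\mathcal H$ such that (i) $\int \big(e^{|y-f_{\mathcal H}(\mu)|/M}-|y-f_{\mathcal H}(\mu)|/M-1\big)d\rho(y|\mu)\le \Sigma^2/(2M^2)$ for $\rho_X$-a.e. $\mu$; (ii) $f_{\mathcal H}=T^{(c-1)/2}g$ for some $g\in\mathcal H$ with $\|g\|^2_{\mathcal H}\le R$, where $T=\int \langle\cdot,K(\cdot,\mu)\rangle K(\cdot,\mu)\,d\rho_X(\mu)$; (iii) $T=\sum_{n\ge1}t_n\langle\cdot,e_n\rangle e_n$ with $(e_n)_{n\ge 1}$ an infinite orthonormal basis of $(\ker T)^\perp$ and $\alpha\le n^bt_n\le\beta$ for all $n\geq 1$. Put $$r(l,N,\lambda)=\frac{\log^h l}{N^h\lambda^3}+\lambda^c+\frac1{l^2\lambda}+\frac1{l\lambda^{1/b}} .$$ **Statement.** Let $a>0$, and let $l=l(N)\in\mathbb N$ be $N^a$ up to constant factors, $l=\Theta(N^a)$.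 Any two terms of $r$ can be made equal by a choice of $\lambda=\lambda(N)>0$ for all large $N$. For each pair of terms, let $\lambda=\lambda(N)>0$ be any choice for which these two terms are of the same order ($\Theta$). Say that the pair *converges* if $r(l,N,\lambda)\to0$ as $N\to\infty$ and, for every $\kappa>0$, $l\ge\kappa\lambda^{-1/b-1}$ for all large $N$; say that it *dominates* if the other two terms are $O$ of the matched ones. Then: | matched terms | converges iff | converges and dominates iff | rate | |---|---|---|---| | 1, 2 | $\max\big(\frac{h}{(c+3)\min(2,b)},\frac{h(b+1)}{(c+3)b}\big)\le a$ | $\max\big(\frac{h(1/b+c)}{c+3},\frac{h(b+1)}{(c+3)b}\big)\le a$ | $\big[\frac{\log N}{N}\big]^{\frac{hc}{c+3}}$ | | 1, 3 | $\max\big(\frac h6,\frac h{2(b+1)},\frac{h(b+1)}{2(2b+1)}\big)\le a<\frac h2$ | $\max\big(\frac h6,\frac{h(b+1)}{2(2b+1)}\big)\le a<\min\big(\frac h2-\frac h{c+3},\frac{\frac h2(\frac1b-1)}{\frac1b-2}\big)$ | $\frac1{N^{3a-h/2}\log^{h/2}N}$ | | 1, 4 | $\max\big(\frac{hb}{7b-2},\frac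 h{3b},\frac{h(b+1)}{4b}\big)\le a<h$ | $\max\big(\frac{h(b-1)}{4b-2},\frac h{3b},\frac{h(b+1)}{4b}\big)\le a<\frac{h(bc+1)}{3b+bc}$ | $\frac1{N^{a+\frac{a-h}{3b-1}}\log^{\frac h{3b-1}}N}$ | | 2, 3 | $a<\frac{h(c+1)}6$ and $1>\frac{2(b+1)}{(c+1)b}$ | never (the pair never dominates) | none | | 2, 4 | $a<\frac{h(bc+1)}{3b}$ and $1>\frac{b+1}{bc+1}$ | $a<\frac{h(bc+1)}{3b+bc}$ and $1>\frac{b+1}{bc+1}$ | $\frac1{N^{abc/(bc+1)}}$ | | 3, 4 | never | never | none | Whenever the pair converges, for all $\eta\in(0,1)$ and $\delta>0$ there are constants $A>0$, $N_0$ such that for all $N\ge N_0$, with probability at least $1-\eta-e^{-\delta}$, $$\mathcal E[f^\lambda_{\hat z}]-\mathcal E[f_{\mathcal H}]\le A\,r(l,N,\lambda),$$ and $\mathcal E[f^\lambda_{\hat z}]-\mathcal E[f_{\mathcal H}]\to0$ in probability. If moreover the pair dominates, the same holds (with suitable $A,N_0$) with $r(l,N,\lambda)$ replaced by the rate in the last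 column. The constants $A,N_0$ depend only on $h,L,B_k,B_K,C,M,\Sigma,R,\alpha,\beta,b,c,\eta,\delta$, and the sequences $l,\lambda$; the bounds and the convergence in probability are uniform over all settings as above with these constants and with $\rho\in\mathcal P(b,c)$. -/

import Mathlib

open MeasureTheory ProbabilityTheory Filter Asymptotics Topology Set
open scoped ENNReal NNReal

namespace DistReg

noncomputable section

/-! ### Kernels, mean embeddings and two-stage samples -/

section Embedding

variable {E X : Type*} [NormedAddCommGroup E] [InnerProductSpace ℝ E] [CompleteSpace E]
  [RKHS ℝ E X ℝ]

variable (E) in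
/-- The canonical feature `k(·, u)` of the point `u` in a reproducing kernel Hilbert space `E` of
real functions on `X`. -/
def feature (u : X) : E := RKHS.kerFun E u (1 : ℝ)

variable (E) in
/-- The (scalar) reproducing kernel `k(u, v)` of `E`. -/
def kernelFun (u v : X) : ℝ := RKHS.kernel E u v (1 : ℝ)

variable [MeasurableSpace X]

variable (E) in
/-- The mean embedding `μ_x = ∫ k(·, u) dx(u)` of a probability distribution `x`. -/
def meanEmbedding (x : ProbabilityMeasure X) : E := ∫ u, feature E u ∂(x : Measure X)

variable (E) in
/-- The set of all mean embeddings of probability distributions, as a subset of `E`. -/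
abbrev Embedded : Set E := Set.range (meanEmbedding E : ProbabilityMeasure X → E)

variable (E) in
/-- The mean embedding with values in the set of mean embeddings. -/
def embed (x : ProbabilityMeasure X) : Embedded E := ⟨meanEmbedding E x, Set.mem_range_self x⟩

end Embedding

section Sampling

variable {X : Type*} [MeasurableSpace X]

/-- The empirical distribution of the bag `u 0, …, u (N - 1)`. -/
def empirical {N : ℕ} [NeZero N] (u : Fin N → X) : ProbabilityMeasure X :=
  ⟨(N : ℝ≥0∞)⁻¹ • ∑ n, Measure.dirac (u n), ⟨by
    have h0 : (N : ℝ≥0∞) ≠ 0 := by exact_mod_cast NeZero.ne N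
    simp [ENNReal.inv_mul_cancel h0 (ENNReal.natCast_ne_top N)]⟩⟩

/-- The `N`-fold product `x ⊗ ⋯ ⊗ x` depends measurably on the distribution `x`. -/
theorem measurable_iid (N : ℕ) :
    Measurable fun p : ProbabilityMeasure X × ℝ =>
      Measure.pi fun _ : Fin N => (p.1 : Measure X) := by
  refine Measurable.measure_of_isPiSystem_of_isProbabilityMeasure
    (generateFrom_pi (α := fun _ : Fin N => X)).symm isPiSystem_pi ?_
  rintro _ ⟨s, hs, rfl⟩
  simp only [Measure.pi_pi]
  refine Finset.measurable_prod _ fun i _ => ?_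
  exact (Measure.measurable_coe (hs i (Set.mem_univ i))).comp
    (measurable_subtype_coe.comp measurable_fst)

/-- The second sampling stage: given `(x, y)`, a bag of `N` independent draws from `x`. -/
def bagKernel (N : ℕ) : Kernel (ProbabilityMeasure X × ℝ) (Fin N → X) where
  toFun p := Measure.pi fun _ : Fin N => (p.1 : Measure X)
  measurable' := measurable_iid N

instance (N : ℕ) : IsMarkovKernel (bagKernel (X := X) N) :=
  ⟨fun p => inferInstanceAs
    (IsProbabilityMeasure (Measure.pi fun _ : Fin N => (p.1 : Measure X)))⟩

/-- The law of the two-stage sample: `l` independent pairs `(x_i, y_i)` from the meta distribution,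
and for each `i` a bag of `N` independent draws from `x_i`. -/
def sampleLaw (Q : Measure (ProbabilityMeasure X × ℝ)) (l N : ℕ) :
    Measure (Fin l → (ProbabilityMeasure X × ℝ) × (Fin N → X)) :=
  Measure.pi fun _ : Fin l => Q ⊗ₘ bagKernel N

end Sampling

/-! ### Ridge regression in the hypothesis space, risk, covariance operator -/

section Regression

variable {S F : Type*} [NormedAddCommGroup F] [InnerProductSpace ℝ F] [CompleteSpace F]
  [RKHS ℝ F S ℝ]

/-- The regularized empirical risk `(1/l) ∑ |f(s_i) - y_i|² + λ ‖f‖²`. -/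
def ridgeObjective {l : ℕ} (lam : ℝ) (s : Fin l → S) (y : Fin l → ℝ) (f : F) : ℝ :=
  (l : ℝ)⁻¹ * ∑ i, (f (s i) - y i) ^ 2 + lam * ‖f‖ ^ 2

/-- For `λ > 0` the regularized empirical risk has exactly one minimizer. -/
theorem existsUnique_ridge {l : ℕ} {lam : ℝ} (hlam : 0 < lam) (s : Fin l → S) (y : Fin l → ℝ) :
    ∃! f : F, IsMinOn (ridgeObjective lam s y) Set.univ f := by
  have hev : ∀ (x : S) (f : F), inner ℝ (feature F x) f = f x := fun x f => by
    simp [feature]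
  -- the normal operator and its bilinear form
  let A : F →L[ℝ] F := lam • ContinuousLinearMap.id ℝ F +
    (l : ℝ)⁻¹ • ∑ i, InnerProductSpace.rankOne ℝ (feature F (s i)) (feature F (s i))
  let B : F →L[ℝ] F →L[ℝ] ℝ := (innerSL ℝ).comp A
  have hB : ∀ v w : F, B v w = lam * inner ℝ v w + (l : ℝ)⁻¹ * ∑ i, v (s i) * w (s i) := by
    intro v w
    change inner ℝ (A v) w = _
    simp [A, inner_add_left, inner_smul_left, sum_inner, hev]
  have hl : (0 : ℝ) ≤ (l : ℝ)⁻¹ := by positivity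
  have hco : IsCoercive B := by
    refine ⟨lam, hlam, fun v => ?_⟩
    rw [hB, real_inner_self_eq_norm_sq]
    have : 0 ≤ ∑ i, v (s i) * v (s i) := Finset.sum_nonneg fun i _ => mul_self_nonneg _
    nlinarith [mul_nonneg hl this]
  let f₀ : F := hco.continuousLinearEquivOfBilin.symm ((l : ℝ)⁻¹ • ∑ i, y i • feature F (s i))
  have hf₀ : ∀ w : F, lam * inner ℝ f₀ w + (l : ℝ)⁻¹ * ∑ i, f₀ (s i) * w (s i) =
      (l : ℝ)⁻¹ * ∑ i, y i * w (s i) := by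
    intro w
    rw [← hB, ← hco.continuousLinearEquivOfBilin_apply]
    simp [f₀, inner_smul_left, sum_inner, hev]
  have key : ∀ d : F, ridgeObjective lam s y (f₀ + d) = ridgeObjective lam s y f₀ +
      ((l : ℝ)⁻¹ * ∑ i, d (s i) ^ 2 + lam * ‖d‖ ^ 2) := by
    intro d
    have h1 : ∑ i, ((f₀ + d) (s i) - y i) ^ 2 = ∑ i, (f₀ (s i) - y i) ^ 2 +
        2 * (∑ i, f₀ (s i) * d (s i) - ∑ i, y i * d (s i)) + ∑ i, d (s i) ^ 2 := by
      rw [← Finset.sum_sub_distrib, Finset.mul_sum, ← Finset.sum_add_distrib,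
        ← Finset.sum_add_distrib]
      refine Finset.sum_congr rfl fun i _ => ?_
      rw [RKHS.coe_add, Pi.add_apply]
      ring
    simp only [ridgeObjective]
    rw [h1, norm_add_sq_real]
    linear_combination 2 * hf₀ d
  have hq : ∀ d : F, 0 ≤ (l : ℝ)⁻¹ * ∑ i, d (s i) ^ 2 := fun d =>
    mul_nonneg hl (Finset.sum_nonneg fun i _ => sq_nonneg _)
  refine ⟨f₀, fun f _ => ?_, fun f hf => ?_⟩
  · have := key (f - f₀)
    rw [add_sub_cancel] at this
    rw [Set.mem_ofPred_eq, this]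
    nlinarith [hq (f - f₀), mul_nonneg hlam.le (sq_nonneg ‖f - f₀‖)]
  · have h1 := key (f - f₀)
    rw [add_sub_cancel] at h1
    have h2 : ridgeObjective lam s y f ≤ ridgeObjective lam s y f₀ := hf (Set.mem_univ f₀)
    have h3 : lam * ‖f - f₀‖ ^ 2 ≤ 0 := by linarith [hq (f - f₀)]
    have h4 : ‖f - f₀‖ ^ 2 ≤ 0 := by
      by_contra hh
      exact absurd h3 (not_le.2 (mul_pos hlam (not_le.1 hh)))
    have h5 : ‖f - f₀‖ = 0 := by
      have := sq_nonneg ‖f - f₀‖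
      exact pow_eq_zero_iff (two_ne_zero) |>.1 (le_antisymm h4 this)
    exact sub_eq_zero.1 (norm_eq_zero.1 h5)

variable (F) in
/-- The ridge regression estimator: the minimizer over `F` of the regularized empirical risk. -/
def ridgeEstimator {l : ℕ} (lam : ℝ) (s : Fin l → S) (y : Fin l → ℝ) : F :=
  Classical.epsilon fun f : F => IsMinOn (ridgeObjective lam s y) Set.univ f

variable [MeasurableSpace S]

/-- The expected squared risk of `f` under the joint law `ρ` of (embedded) input and label. -/
def risk (ρ : Measure (S × ℝ)) (f : F) : ℝ := ∫ p, (f p.1 - p.2) ^ 2 ∂ρ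

variable (F) in
/-- The covariance operator `T = ∫ ⟨K(·, s), ·⟩ K(·, s) dρ_X(s)`. -/
def covOp (ρ : Measure (S × ℝ)) : F →L[ℝ] F :=
  ∫ s, InnerProductSpace.rankOne ℝ (feature F s) (feature F s) ∂ρ.fst

end Regression

section Estimator

variable {X : Type*} [MeasurableSpace X]
  {H : Type*} [NormedAddCommGroup H] [InnerProductSpace ℝ H] [CompleteSpace H] [RKHS ℝ H X ℝ]

/-- The mean embedding based ridge regression estimator. It sees the labels `y_i` and the bags,
through the mean embeddings of their empirical distributions, but not the distributions `x_i`. -/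
def merr (F : Type*) [NormedAddCommGroup F] [InnerProductSpace ℝ F] [CompleteSpace F]
    [RKHS ℝ F (Embedded H) ℝ] {l N : ℕ} [NeZero N] (lam : ℝ)
    (z : Fin l → (ProbabilityMeasure X × ℝ) × (Fin N → X)) : F :=
  ridgeEstimator F lam (fun i => embed H (empirical (z i).2)) (fun i => (z i).1.2)

/-- The joint law of `(μ_x, y)` when `(x, y)` follows the meta distribution. -/
def embeddedLaw (H : Type*) [NormedAddCommGroup H] [InnerProductSpace ℝ H] [CompleteSpace H]
    [RKHS ℝ H X ℝ] [MeasurableSpace H] (Q : Measure (ProbabilityMeasure X × ℝ)) :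
    Measure (Embedded H × ℝ) :=
  Q.map fun p => (embed H p.1, p.2)

end Estimator

/-! ### Model assumptions and the prior class -/

/-- The numerical constants of the model: Hölder exponent `h` and constant `L`, bounds `Bk`, `BK`
of the two kernels, bound `C` of the labels, noise constants `M`, `Sig`, source radius `R`,
eigenvalue constants `α`, `β`, and the parameters `b`, `c` of the prior class. -/
structure Params where
  (h L Bk BK C M Sig R α β b c : ℝ)

/-- The admissible ranges of the constants. -/
structure Params.Admissible (P : Params) : Prop where
  h_pos : 0 < P.h
  h_le : P.h ≤ 1
  L_pos : 0 < P.L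
  Bk_pos : 0 < P.Bk
  BK_pos : 0 < P.BK
  C_pos : 0 < P.C
  M_pos : 0 < P.M
  Sig_pos : 0 < P.Sig
  R_pos : 0 < P.R
  α_pos : 0 < P.α
  β_pos : 0 < P.β
  one_lt_b : 1 < P.b
  one_le_c : 1 ≤ P.c
  c_le_two : P.c ≤ 2

section Class

variable {S F : Type*} [NormedAddCommGroup F] [InnerProductSpace ℝ F] [CompleteSpace F]
  [RKHS ℝ F S ℝ] [MeasurableSpace S]

/-- `(e, t)` is a spectral decomposition `T = ∑ t_n ⟨·, e_n⟩ e_n`, with `(e_n)` an (infinite)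
orthonormal basis of `(ker T)ᗮ`. -/
structure IsSpectralDecomp (T : F →L[ℝ] F) (e : ℕ → F) (t : ℕ → ℝ) : Prop where
  orthonormal : Orthonormal ℝ e
  basis : (Submodule.span ℝ (Set.range e)).topologicalClosure = T.kerᗮ
  hasSum : ∀ f : F, HasSum (fun n => (t n * inner ℝ (e n) f) • e n) (T f)

/-- `f = T ^ s g` for `s ≥ 0`, by functional calculus along the spectral decomposition `(e, t)`:
`f = ∑ t_n ^ s ⟨e_n, g⟩ e_n + 0 ^ s P g`, where `P` is the orthogonal projection onto `ker T` and
`0 ^ 0 = 1` (so that `T ^ 0 = 1`). -/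
def IsPowApply (T : F →L[ℝ] F) (e : ℕ → F) (t : ℕ → ℝ) (s : ℝ) (g f : F) : Prop :=
  HasSum (fun n => (t n ^ s * inner ℝ (e n) g) • e n) (f - (0 : ℝ) ^ s • T.ker.starProjection g)

/-- `ρ` belongs to the prior class with parameters `b`, `c`, and `fH` is the target function.
The eigenvalues are indexed from `0`, whence `n + 1` in the decay condition. -/
structure PriorClass (P : Params) (ρ : Measure (S × ℝ)) [IsFiniteMeasure ρ] (fH : F) : Prop where
  /-- `fH` minimizes the expected risk over the hypothesis space. -/
  isMin : IsMinOn (risk ρ) Set.univ fH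
  /-- The noise condition, for almost every input and the conditional law of the label. -/
  noise : ∀ᵐ s ∂ρ.fst,
    ∫⁻ y, ENNReal.ofReal
      (Real.exp (|y - fH s| / P.M) - |y - fH s| / P.M - 1) ∂(ρ.condKernel s)
      ≤ ENNReal.ofReal (P.Sig ^ 2 / (2 * P.M ^ 2))
  /-- Smoothness of `fH` and polynomial decay of the eigenvalues of the covariance operator. -/
  source : ∃ (e : ℕ → F) (t : ℕ → ℝ) (g : F),
    IsSpectralDecomp (covOp F ρ) e t ∧
    (∀ n : ℕ, P.α ≤ ((n : ℝ) + 1) ^ P.b * t n ∧ ((n : ℝ) + 1) ^ P.b * t n ≤ P.β) ∧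
    ‖g‖ ^ 2 ≤ P.R ∧ IsPowApply (covOp F ρ) e t ((P.c - 1) / 2) g fH

end Class

instance {X : Type*} [MeasurableSpace X]
    (H : Type*) [NormedAddCommGroup H] [InnerProductSpace ℝ H] [CompleteSpace H]
    [RKHS ℝ H X ℝ] [MeasurableSpace H] (Q : Measure (ProbabilityMeasure X × ℝ))
    [IsFiniteMeasure Q] : IsFiniteMeasure (embeddedLaw H Q) := by
  unfold embeddedLaw; infer_instance

/-- The standing assumptions: the kernel `k` of `H` is continuous and bounded; the kernel `K` of `F`
is bounded with Hölder continuous canonical feature map; the labels are bounded; and the law of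
`(μ_x, y)` belongs to the prior class, with target function `fH`. -/
structure Model (P : Params) {X : Type*} [TopologicalSpace X] [MeasurableSpace X]
    {H : Type*} [NormedAddCommGroup H] [InnerProductSpace ℝ H] [CompleteSpace H]
    [RKHS ℝ H X ℝ] [MeasurableSpace H]
    {F : Type*} [NormedAddCommGroup F] [InnerProductSpace ℝ F] [CompleteSpace F]
    [RKHS ℝ F (Embedded H) ℝ]
    (Q : Measure (ProbabilityMeasure X × ℝ)) [IsFiniteMeasure Q] (fH : F) : Prop where
  k_cont : Continuous fun p : X × X => kernelFun H p.1 p.2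
  k_bdd : ∀ u : X, kernelFun H u u ≤ P.Bk
  K_bdd : ∀ m : Embedded H, kernelFun F m m ≤ P.BK
  K_holder : ∀ m m' : Embedded H,
    ‖feature F m - feature F m'‖ ≤ P.L * ‖(m : H) - (m' : H)‖ ^ P.h
  label_bdd : ∀ᵐ p ∂Q, |p.2| ≤ P.C
  prior : PriorClass P (embeddedLaw H Q) fH

/-! ### Uniform tail bounds for the excess risk -/

/-- Uniformly over all models with the constants `P`: for the sample sizes `l`, `N` and the
regularization `lam`, the excess risk `ℰ[f] - ℰ[fH]` of the estimator is at most `ε`, except with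
probability at most `p`. -/
def TailBound.{u, v, w} (P : Params) (l N : ℕ) [NeZero N] (lam ε p : ℝ) : Prop :=
  ∀ (X : Type u) [TopologicalSpace X] [TopologicalSpace.SeparableSpace X]
    [MeasurableSpace X] [BorelSpace X]
    (H : Type v) [NormedAddCommGroup H] [InnerProductSpace ℝ H] [CompleteSpace H]
    [RKHS ℝ H X ℝ] [MeasurableSpace H] [BorelSpace H]
    (F : Type w) [NormedAddCommGroup F] [InnerProductSpace ℝ F] [CompleteSpace F]
    [RKHS ℝ F (Embedded H) ℝ]
    (Q : Measure (ProbabilityMeasure X × ℝ)) [IsProbabilityMeasure Q] (fH : F),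
    Model P Q fH →
    sampleLaw Q l N {z | ε < risk (embeddedLaw H Q) (merr F lam z) -
      risk (embeddedLaw H Q) fH} ≤ ENNReal.ofReal p

/-- With probability at least `1 - η - exp (-δ)` the excess risk is at most a constant times
`B N`, for all large `N`. The constant may depend on everything but `N` and the model; in
particular, it is uniform over the prior class. -/
def HasRate.{u, v, w} (P : Params) (l : ℕ → ℕ) (lam B : ℕ → ℝ) : Prop :=
  ∀ η δ : ℝ, 0 < η → η < 1 → 0 < δ → ∃ A : ℝ, 0 < A ∧ ∃ N₀ : ℕ, ∀ (N : ℕ) [NeZero N], N₀ ≤ N →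
    TailBound.{u, v, w} P (l N) N (lam N) (A * B N) (η + Real.exp (-δ))

/-- Consistency: the excess risk tends to `0` in probability, uniformly over the prior class. -/
def Consistent.{u, v, w} (P : Params) (l : ℕ → ℕ) (lam : ℕ → ℝ) : Prop :=
  ∀ ε p : ℝ, 0 < ε → 0 < p → ∃ N₀ : ℕ, ∀ (N : ℕ) [NeZero N], N₀ ≤ N →
    TailBound.{u, v, w} P (l N) N (lam N) ε p

/-! ### The bounding function and the matching of its terms -/

/-- The four terms of `r(l, N, λ)`, numbered from `0`:
`log(l)^h / (N^h λ^3)`, `λ^c`, `1 / (l^2 λ)`, `1 / (l λ^(1/b))`. -/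
def rTerm (P : Params) (l N lam : ℝ) : Fin 4 → ℝ :=
  ![Real.log l ^ P.h / (N ^ P.h * lam ^ 3), lam ^ P.c, 1 / (l ^ 2 * lam),
    1 / (l * lam ^ (1 / P.b))]

/-- The bounding function `r(l, N, λ)`. -/
def r (P : Params) (l N lam : ℝ) : ℝ := ∑ i, rTerm P l N lam i

/-- `λ` is chosen by matching the terms `i` and `j` of `r`, up to constant factors. -/
def Matched (P : Params) (l : ℕ → ℕ) (lam : ℕ → ℝ) (i j : Fin 4) : Prop :=
  (∀ᶠ N in atTop, 0 < lam N) ∧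
  (fun N : ℕ => rTerm P (l N) N (lam N) i) =Θ[atTop] (fun N : ℕ => rTerm P (l N) N (lam N) j)

/-- `r(l, N, λ) → 0`, subject to the constraint `l ≥ λ^(-1/b-1)`. A constant factor is suppressed
in that constraint, and it is required for each value of this factor, however large. -/
def Converges (P : Params) (l : ℕ → ℕ) (lam : ℕ → ℝ) : Prop :=
  Tendsto (fun N : ℕ => r P (l N) N (lam N)) atTop (𝓝 0) ∧
  (∀ κ : ℝ, 0 < κ → ∀ᶠ N in atTop, κ * lam N ^ (-(1 / P.b) - 1) ≤ (l N : ℝ))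

/-- The term `i` dominates `r`, up to constant factors. -/
def Dominates (P : Params) (l : ℕ → ℕ) (lam : ℕ → ℝ) (i : Fin 4) : Prop :=
  ∀ m : Fin 4,
    (fun N : ℕ => rTerm P (l N) N (lam N) m) =O[atTop] (fun N : ℕ => rTerm P (l N) N (lam N) i)

end

end DistReg

open DistReg

universe u v w

namespace DistReg

/-! Let f be the estimator and d = f - f_H. Because f_H minimizes the risk, the excess risk is
exactly ⟨T d, d⟩ (`risk_sub_risk_eq`), so it suffices to bound the energy q = ⟨T d, d⟩ + λ‖d‖².
Comparing the ridge objective at f and at f_H (`basic_inequality`) bounds the empirical counterpart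
of q by an average of residuals times d and by the bias λ⟨f_H, d⟩. `energy_le` is the deterministic
core: if each of these is at most ε√q, if the empirical and true quadratic forms differ by at most
q/4, and if replacing the distributions by their bags moves the features little compared with λ,
then q is bounded by the squares of the separate errors.

All random quantities are controlled by second moments and Markov's inequality, which is enough
because the constants may depend on the confidence level. In the eigenbasis e_n of T, with weights
1/(t_n + λ), the noise is a weighted ℓ² sum of centred averages (`measure_noise_le`). The deviation
of the empirical covariance is a weighted ℓ² sum over pairs, that is, a squared Hilbert–Schmidt norm
(`measure_covariance_le`). Both are governed by the effective dimension ∑ t_n/(t_n + λ) =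
O(λ^(-1/b)) (`tsum_div_add_le`), the second with an additional factor 1/λ; this is where l ≥ κ
λ^(-1/b-1) is needed. A bag has mean squared embedding error at most B_k/N, so by Hölder continuity
the features move by O(N^(-h/2)) on average (`Model.measure_bags_le`). The source condition gives a
bias of order λ^(c/2)√q (`IsPowApply.mul_abs_inner_le`).

Together these give a bound of order 1/(N^h λ) + λ^c + 1/(l λ^(1/b)) (`exists_tailBound`). When λ ≤
1 and log l ≥ 1, this is at most r, and r → 0 forces the remaining smallness conditions
(`Converges.hasRate`).

The table is then arithmetic of exponents. For l = Θ(N^a), a matched λ and all terms of r have an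
order N^p (log N)^q (`Matched.hasOrder`, `hasOrder_rTerm`). Limits and comparisons are decided by
the lexicographic sign of (p, q) (`OrderNeg`): at p = 0 the logarithm decides, which is the source
of the mixture of ≤ and < in the conditions on a. What remains is to see which of these inequalities
imply the others. -/

/-! ### Second moments of sample averages -/

section Averages

variable {Z : Type*} [MeasurableSpace Z] {ν : Measure Z} [IsProbabilityMeasure ν]

/-- The mean squared deviation of a sample average from the expectation. -/
theorem lintegral_sq_average_sub_le {f : Z → ℝ} (hf : MemLp f 2 ν) {l : ℕ} (hl : 0 < l) :
    ∫⁻ z, ENNReal.ofReal (((l : ℝ)⁻¹ * ∑ i, f (z i) - ∫ x, f x ∂ν) ^ 2)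
      ∂(Measure.pi fun _ : Fin l => ν) ≤
    ENNReal.ofReal ((l : ℝ)⁻¹) * ∫⁻ x, ENNReal.ofReal (f x ^ 2) ∂ν := by
  set π := Measure.pi fun _ : Fin l => ν
  have hl' : (l : ℝ) ≠ 0 := by exact_mod_cast hl.ne'
  have hmem : ∀ i : Fin l, MemLp (fun z : Fin l → Z => f (z i)) 2 π := fun i =>
    hf.comp_measurePreserving (measurePreserving_eval _ i)
  have hsum : MemLp (∑ i, fun z : Fin l → Z => f (z i)) 2 π := memLp_finsetSum' _ fun i _ => hmem i
  have hmean : ∫ z, (l : ℝ)⁻¹ * (∑ i, fun z : Fin l → Z => f (z i)) z ∂π = ∫ x, f x ∂ν := by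
    rw [integral_const_mul]
    simp only [Finset.sum_apply]
    rw [integral_finsetSum _ fun i _ => (hmem i).integrable one_le_two]
    have : ∀ i : Fin l, ∫ z, f (z i) ∂π = ∫ x, f x ∂ν := fun i =>
      integral_comp_eval (μ := fun _ : Fin l => ν) hf.aestronglyMeasurable
    simp [this, hl']
  have hvar := variance_sum_pi (μ := fun _ : Fin l => ν) (X := fun _ => f) fun _ => hf
  have h1 : ∫⁻ z, ENNReal.ofReal (((l : ℝ)⁻¹ * ∑ i, f (z i) - ∫ x, f x ∂ν) ^ 2) ∂π =
      evariance (fun z => (l : ℝ)⁻¹ * (∑ i, fun z : Fin l → Z => f (z i)) z) π := by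
    rw [evariance_eq_lintegral_ofReal, hmean]
    simp [Finset.sum_apply]
  have h2 : Integrable (fun x => f x ^ 2) ν := hf.integrable_sq
  rw [h1, ← (hsum.const_mul _).ofReal_variance_eq, variance_const_mul, hvar,
    ← ofReal_integral_eq_lintegral_ofReal h2 (ae_of_all _ fun x => sq_nonneg _),
    ← ENNReal.ofReal_mul (by positivity)]
  refine ENNReal.ofReal_le_ofReal ?_
  have h3 : Var[f; ν] ≤ ∫ x, f x ^ 2 ∂ν := by
    simpa using variance_le_expectation_sq hf.aestronglyMeasurable
  simp only [Finset.sum_const, Finset.card_univ, Fintype.card_fin, nsmul_eq_mul]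
  calc ((l : ℝ)⁻¹) ^ 2 * (l * Var[f; ν]) = (l : ℝ)⁻¹ * Var[f; ν] := by field_simp
    _ ≤ _ := by gcongr

/-- Markov's inequality in the form used throughout. -/
theorem measure_lt_le_of_lintegral_le {Ω : Type*} [MeasurableSpace Ω] {μ : Measure Ω}
    {g : Ω → ℝ≥0∞} (hg : AEMeasurable g μ) {V p : ℝ} (hV : 0 < V) (hp : 0 < p)
    (h : ∫⁻ ω, g ω ∂μ ≤ ENNReal.ofReal V) :
    μ {ω | ENNReal.ofReal (V / p) < g ω} ≤ ENNReal.ofReal p := by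
  have h0 : ENNReal.ofReal (V / p) ≠ 0 := by
    simpa using div_pos hV hp
  calc μ {ω | ENNReal.ofReal (V / p) < g ω} ≤ μ {ω | ENNReal.ofReal (V / p) ≤ g ω} :=
        measure_mono fun ω hω => le_of_lt (Set.mem_ofPred_eq.symm ▸ hω :)
    _ ≤ (∫⁻ ω, g ω ∂μ) / ENNReal.ofReal (V / p) :=
        meas_ge_le_lintegral_div hg h0 ENNReal.ofReal_ne_top
    _ ≤ ENNReal.ofReal V / ENNReal.ofReal (V / p) := by gcongr
    _ = ENNReal.ofReal p := by
        rw [← ENNReal.ofReal_div_of_pos (div_pos hV hp)]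
        congr 1
        field_simp

/-- Weighted sums of squared deviations of sample averages, in expectation. -/
theorem lintegral_tsum_sq_average_sub_le {ι : Type*} [Countable ι] {f : ι → Z → ℝ}
    (hf : ∀ k, MemLp (f k) 2 ν) {w : ι → ℝ} (hw : ∀ k, 0 ≤ w k) {l : ℕ} (hl : 0 < l) :
    ∫⁻ z, ∑' k, ENNReal.ofReal (w k * ((l : ℝ)⁻¹ * ∑ i, f k (z i) - ∫ x, f k x ∂ν) ^ 2)
      ∂(Measure.pi fun _ : Fin l => ν) ≤
    ENNReal.ofReal ((l : ℝ)⁻¹) * ∫⁻ x, ∑' k, ENNReal.ofReal (w k * f k x ^ 2) ∂ν := by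
  have hmem : ∀ k, ∀ i : Fin l, AEMeasurable (fun z : Fin l → Z => f k (z i))
      (Measure.pi fun _ : Fin l => ν) := fun k i =>
    ((hf k).comp_measurePreserving (measurePreserving_eval _ i)).aestronglyMeasurable.aemeasurable
  have hf' := fun k => (hf k).aestronglyMeasurable.aemeasurable
  rw [lintegral_tsum fun k => ((((Finset.aemeasurable_fun_sum _ fun i _ => hmem k i).const_mul
      _).sub_const _).pow_const _ |>.const_mul _).ennreal_ofReal, lintegral_tsum fun k => by fun_prop,
    ← ENNReal.tsum_mul_left]
  refine ENNReal.tsum_le_tsum fun k => ?_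
  simp_rw [ENNReal.ofReal_mul (hw k)]
  rw [lintegral_const_mul' _ _ ENNReal.ofReal_ne_top, lintegral_const_mul' _ _ ENNReal.ofReal_ne_top,
    mul_left_comm]
  gcongr
  exact lintegral_sq_average_sub_le (hf k) hl

/-- Weighted sums of squared deviations of sample averages, in probability. -/
theorem measure_tsum_sq_average_sub_le {ι : Type*} [Countable ι] {f : ι → Z → ℝ}
    (hf : ∀ k, MemLp (f k) 2 ν) {w : ι → ℝ} (hw : ∀ k, 0 ≤ w k) {l : ℕ} (hl : 0 < l) {V p : ℝ}
    (hV : 0 < V) (hp : 0 < p)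
    (h : ∫⁻ x, ∑' k, ENNReal.ofReal (w k * f k x ^ 2) ∂ν ≤ ENNReal.ofReal V) :
    (Measure.pi fun _ : Fin l => ν) {z | ¬ ∀ s : Finset ι,
      ∑ k ∈ s, w k * ((l : ℝ)⁻¹ * ∑ i, f k (z i) - ∫ x, f k x ∂ν) ^ 2 ≤ V / (l * p)} ≤
    ENNReal.ofReal p := by
  have hmem : ∀ k, ∀ i : Fin l, AEMeasurable (fun z : Fin l → Z => f k (z i))
      (Measure.pi fun _ : Fin l => ν) := fun k i =>
    ((hf k).comp_measurePreserving (measurePreserving_eval _ i)).aestronglyMeasurable.aemeasurable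
  have hl' : (0 : ℝ) < l := by exact_mod_cast hl
  have hle := (lintegral_tsum_sq_average_sub_le hf hw hl).trans (mul_le_mul_right h _)
  rw [← ENNReal.ofReal_mul (by positivity)] at hle
  refine le_trans (measure_mono ?_)
    (measure_lt_le_of_lintegral_le (AEMeasurable.tsum fun k => ((((Finset.aemeasurable_fun_sum _
        fun i _ => hmem k i).const_mul _).sub_const _).pow_const _ |>.const_mul _).ennreal_ofReal)
      (mul_pos (inv_pos.2 hl') hV) hp hle)
  -- A finite partial sum is at most the extended-valued series, so the bad event lies in the one of
  -- Markov's inequality. Stating the event through finite sums avoids any summability question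
  -- later.
  intro z hz
  simp only [Set.mem_ofPred_eq, not_forall, not_le] at hz ⊢
  obtain ⟨s, hs⟩ := hz
  have hnn : ∀ k ∈ s, 0 ≤ w k * ((l : ℝ)⁻¹ * ∑ i, f k (z i) - ∫ x, f k x ∂ν) ^ 2 :=
    fun k _ => mul_nonneg (hw k) (sq_nonneg _)
  refine lt_of_lt_of_le ?_ (ENNReal.sum_le_tsum s)
  rw [← ENNReal.ofReal_sum_of_nonneg hnn]
  refine (ENNReal.ofReal_lt_ofReal_iff_of_nonneg (by positivity)).2 ?_
  rwa [inv_mul_eq_div, div_div]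

/-- The average of a nonnegative function over an independent sample, in probability. -/
theorem measure_average_le {g : Z → ℝ} (hg : Measurable g) (hg0 : ∀ x, 0 ≤ g x) {l : ℕ}
    (hl : 0 < l) {V p : ℝ} (hV : 0 < V) (hp : 0 < p)
    (h : ∫⁻ x, ENNReal.ofReal (g x) ∂ν ≤ ENNReal.ofReal V) :
    (Measure.pi fun _ : Fin l => ν) {z | ¬ (l : ℝ)⁻¹ * ∑ i, g (z i) ≤ V / p} ≤
    ENNReal.ofReal p := by
  have hl' : (0 : ℝ) < l := by exact_mod_cast hl
  have hint : ∫⁻ z, ENNReal.ofReal ((l : ℝ)⁻¹ * ∑ i, g (z i)) ∂(Measure.pi fun _ : Fin l => ν) ≤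
      ENNReal.ofReal V := by
    simp_rw [ENNReal.ofReal_mul (inv_nonneg.2 hl'.le),
      ENNReal.ofReal_sum_of_nonneg fun i _ => hg0 _]
    rw [lintegral_const_mul' _ _ ENNReal.ofReal_ne_top, lintegral_finsetSum _ fun i _ => by fun_prop]
    have : ∀ i : Fin l, ∫⁻ z, ENNReal.ofReal (g (z i)) ∂(Measure.pi fun _ : Fin l => ν) =
        ∫⁻ x, ENNReal.ofReal (g x) ∂ν := fun i =>
      (measurePreserving_eval (fun _ : Fin l => ν) i).lintegral_comp hg.ennreal_ofReal
    simp only [this, Finset.sum_const, Finset.card_univ, Fintype.card_fin, nsmul_eq_mul]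
    rw [← mul_assoc, ENNReal.ofReal_inv_of_pos hl', ENNReal.ofReal_natCast,
      ENNReal.inv_mul_cancel (by exact_mod_cast hl.ne') (ENNReal.natCast_ne_top l), one_mul]
    exact h
  refine le_trans (measure_mono ?_) (measure_lt_le_of_lintegral_le
    ((Finset.measurable_fun_sum _ fun i _ => hg.comp (measurable_pi_apply i)).const_mul
      _).ennreal_ofReal.aemeasurable hV hp hint)
  intro z hz
  simp only [Set.mem_ofPred_eq, not_le] at hz ⊢
  exact (ENNReal.ofReal_lt_ofReal_iff_of_nonneg (by positivity)).2 hz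

end Averages

/-- An orthonormal family in a separable inner product space is countable. -/
theorem countable_of_orthonormal {E ι : Type*} [NormedAddCommGroup E] [InnerProductSpace ℝ E]
    [TopologicalSpace.SeparableSpace E] {v : ι → E} (hv : Orthonormal ℝ v) : Countable ι := by
  refine Pairwise.countable_of_isOpen_disjoint (s := fun i => Metric.ball (v i) (1 / 2))
    (fun i j hij => ?_) (fun i => Metric.isOpen_ball)
    (fun i => ⟨v i, Metric.mem_ball_self (by norm_num)⟩)
  -- Distinct orthonormal vectors are at distance √2 > 1, so the balls of radius 1/2 are disjoint.
  refine Metric.ball_disjoint_ball ?_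
  rw [dist_eq_norm]
  have h : ‖v i - v j‖ ^ 2 = 2 := by
    rw [norm_sub_sq_real, hv.1 i, hv.1 j, hv.2 hij]
    norm_num
  nlinarith [norm_nonneg (v i - v j)]

/-- The mean squared deviation of a sample average in a Hilbert space. -/
theorem lintegral_norm_sq_average_sub_le {Z : Type*} [MeasurableSpace Z] {ν : Measure Z}
    [IsProbabilityMeasure ν] {E : Type*} [NormedAddCommGroup E] [InnerProductSpace ℝ E]
    [CompleteSpace E] [TopologicalSpace.SeparableSpace E] {φ : Z → E}
    (hφ : AEStronglyMeasurable φ ν) {B : ℝ} (hB : ∀ x, ‖φ x‖ ^ 2 ≤ B) {N : ℕ} (hN : 0 < N) :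
    ∫⁻ z, ENNReal.ofReal (‖(N : ℝ)⁻¹ • ∑ i, φ (z i) - ∫ x, φ x ∂ν‖ ^ 2)
      ∂(Measure.pi fun _ : Fin N => ν) ≤ ENNReal.ofReal (B / N) := by
  -- Parseval reduces the claim to the scalar case, coordinate by coordinate. Separability makes the
  -- basis countable, so the sum and the integral can be interchanged.
  obtain ⟨s, b, hb⟩ := exists_hilbertBasis ℝ E
  have : Countable s := countable_of_orthonormal b.orthonormal
  have parseval : ∀ v : E, ENNReal.ofReal (‖v‖ ^ 2) =
      ∑' k, ENNReal.ofReal (1 * (inner ℝ (b k) v) ^ 2) := fun v => by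
    have h := b.hasSum_inner_mul_inner v v
    have h' : HasSum (fun k => (1 : ℝ) * (inner ℝ (b k) v) ^ 2) (‖v‖ ^ 2) := by
      rw [← real_inner_self_eq_norm_sq]
      simpa only [one_mul, sq, real_inner_comm v] using h
    rw [← h'.tsum_eq, ENNReal.ofReal_tsum_of_nonneg (fun k => by positivity) h'.summable]
  have hint : Integrable φ ν := by
    refine Integrable.of_bound hφ (√B) (ae_of_all _ fun x => Real.le_sqrt_of_sq_le (hB x))
  have hmem : ∀ k, MemLp (fun x => (inner ℝ (b k) (φ x) : ℝ)) 2 ν := fun k => by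
    refine MemLp.of_bound (by fun_prop) (‖b k‖ * √B) (ae_of_all _ fun x => ?_)
    exact (norm_inner_le_norm _ _).trans
      (mul_le_mul_of_nonneg_left (Real.le_sqrt_of_sq_le (hB x)) (norm_nonneg _))
  have key := lintegral_tsum_sq_average_sub_le hmem (w := fun _ => 1) (fun _ => zero_le_one) hN
  simp_rw [← parseval] at key
  calc _ = _ := by
        refine lintegral_congr fun z => ?_
        rw [parseval]
        refine tsum_congr fun k => ?_
        rw [inner_sub_right, real_inner_smul_right, inner_sum, ← integral_inner hint]
    _ ≤ _ := key
    _ ≤ ENNReal.ofReal ((N : ℝ)⁻¹) * ∫⁻ _, ENNReal.ofReal B ∂ν := by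
        gcongr with x
        exact hB x
    _ = _ := by
        rw [lintegral_const, measure_univ, mul_one, ← ENNReal.ofReal_mul (by positivity)]
        congr 1
        ring

/-! ### Features and mean embeddings -/

section Evaluation

variable {S F : Type*} [NormedAddCommGroup F] [InnerProductSpace ℝ F] [RKHS ℝ F S ℝ]

theorem apply_sub (f g : F) (s : S) : (f - g) s = f s - g s := by
  rw [RKHS.coe_sub, Pi.sub_apply]

theorem apply_add (f g : F) (s : S) : (f + g) s = f s + g s := by
  rw [RKHS.coe_add, Pi.add_apply]

theorem apply_smul (a : ℝ) (f : F) (s : S) : (a • f) s = a * f s := by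
  rw [RKHS.coe_smul, Pi.smul_apply, smul_eq_mul]

end Evaluation

section Features

variable {S F : Type*} [NormedAddCommGroup F] [InnerProductSpace ℝ F] [CompleteSpace F]
  [RKHS ℝ F S ℝ]

theorem inner_feature (s : S) (f : F) : inner ℝ (feature F s) f = f s := by
  simp [feature]

theorem inner_feature_feature (s s' : S) :
    inner ℝ (feature F s) (feature F s') = kernelFun F s s' := by
  rw [inner_feature]
  simp [feature, kernelFun, RKHS.kerFun_apply]

theorem norm_feature_sq (s : S) : ‖feature F s‖ ^ 2 = kernelFun F s s := by
  rw [← real_inner_self_eq_norm_sq, inner_feature_feature]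

theorem abs_apply_le {B : ℝ} {s : S} (hB : kernelFun F s s ≤ B) (f : F) : |f s| ≤ √B * ‖f‖ := by
  rw [← inner_feature]
  refine (abs_real_inner_le_norm _ _).trans (mul_le_mul_of_nonneg_right ?_ (norm_nonneg _))
  exact Real.le_sqrt_of_sq_le ((norm_feature_sq s).trans_le hB)

theorem abs_apply_sub_apply_le (f : F) (s s' : S) :
    |f s - f s'| ≤ ‖feature F s - feature F s'‖ * ‖f‖ := by
  rw [← inner_feature, ← inner_feature, ← inner_sub_left]
  exact abs_real_inner_le_norm _ _

theorem continuous_apply_of_feature [TopologicalSpace S] (hF : Continuous (feature F : S → F))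
    (f : F) : Continuous f := by
  have : (f : S → ℝ) = fun s => inner ℝ (feature F s) f := funext fun s => (inner_feature s f).symm
  rw [this]
  fun_prop

/-- ‖k(·,v) - k(·,u)‖² = k(v,v) - 2k(v,u) + k(u,u) is continuous in v and vanishes at v = u. -/
theorem continuous_feature_of_kernelFun [TopologicalSpace S]
    (hk : Continuous fun p : S × S => kernelFun F p.1 p.2) : Continuous (feature F : S → F) := by
  refine continuous_iff_continuousAt.2 fun u => ?_
  rw [ContinuousAt, tendsto_iff_norm_sub_tendsto_zero]
  have hsq : ∀ v : S, ‖feature F v - feature F u‖ =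
      √(kernelFun F v v - 2 * kernelFun F v u + kernelFun F u u) := fun v => by
    rw [← norm_feature_sq, ← norm_feature_sq, ← inner_feature_feature, ← norm_sub_sq_real,
      Real.sqrt_sq (norm_nonneg _)]
  simp_rw [hsq]
  have h1 : Continuous fun v : S => kernelFun F v v := by
    simpa only [Function.comp_def] using hk.comp (f := fun v : S => (v, v)) (by fun_prop)
  have h2 : Continuous fun v : S => kernelFun F v u := by
    simpa only [Function.comp_def] using hk.comp (f := fun v : S => (v, u)) (by fun_prop)
  have h3 : Continuous fun v : S => √(kernelFun F v v - 2 * kernelFun F v u + kernelFun F u u) := by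
    fun_prop
  have := h3.tendsto u
  rwa [show kernelFun F u u - 2 * kernelFun F u u + kernelFun F u u = 0 by ring,
    Real.sqrt_zero] at this

/-- The features span a dense subspace, and their set is a continuous image of a separable space. -/
theorem separableSpace_of_continuous_feature [TopologicalSpace S] [TopologicalSpace.SeparableSpace S]
    (hF : Continuous (feature F : S → F)) : TopologicalSpace.SeparableSpace F := by
  have h1 : TopologicalSpace.IsSeparable (Set.range (feature F : S → F)) :=
    TopologicalSpace.isSeparable_range hF
  have h2 := (h1.span (R := ℝ)).closure
  have h3 : ({RKHS.kerFun F x v | (x : S) (v : ℝ)} : Set F) ⊆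
      (Submodule.span ℝ (Set.range (feature F : S → F)) : Set F) := by
    rintro _ ⟨x, v, rfl⟩
    have : RKHS.kerFun F x v = v • feature F x := by
      rw [feature, ← map_smul, smul_eq_mul, mul_one]
    rw [this]
    exact Submodule.smul_mem _ _ (Submodule.subset_span ⟨x, rfl⟩)
  have h4 := RKHS.kerFun_dense (𝕜 := ℝ) (X := S) (V := ℝ) F
  have h5 : (Submodule.span ℝ (Set.range (feature F : S → F))).topologicalClosure = ⊤ :=
    top_le_iff.1 (h4 ▸ Submodule.topologicalClosure_mono (Submodule.span_le.2 h3))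
  rw [← Submodule.topologicalClosure_coe, h5] at h2
  exact TopologicalSpace.isSeparable_univ_iff.1 h2

end Features

section MeanEmbedding

variable {X : Type*} [TopologicalSpace X] [MeasurableSpace X] [BorelSpace X]
  {H : Type*} [NormedAddCommGroup H] [InnerProductSpace ℝ H] [CompleteSpace H] [RKHS ℝ H X ℝ]
  [TopologicalSpace.SeparableSpace H] [MeasurableSpace H] [BorelSpace H]

theorem stronglyMeasurable_feature (hF : Continuous (feature H : X → H)) :
    StronglyMeasurable (feature H : X → H) := by
  have : SecondCountableTopology H := UniformSpace.secondCountable_of_separable H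
  exact hF.measurable.stronglyMeasurable

/-- The inclusion x ↦ x of probability measures into measures is a Markov kernel, and integrals
against a kernel are measurable in its parameter. -/
theorem measurable_meanEmbedding (hF : Continuous (feature H : X → H)) :
    Measurable (meanEmbedding H : ProbabilityMeasure X → H) := by
  have : SecondCountableTopology H := UniformSpace.secondCountable_of_separable H
  let κ : Kernel (ProbabilityMeasure X) X := ⟨fun x => (x : Measure X), measurable_subtype_coe⟩
  have : IsMarkovKernel κ := ⟨fun x => x.2⟩
  have h : StronglyMeasurable fun x : ProbabilityMeasure X => ∫ u, feature H u ∂κ x :=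
    StronglyMeasurable.integral_kernel_prod_right (κ := κ) (f := fun _ u => feature H u)
      ((stronglyMeasurable_feature hF).comp_measurable measurable_snd)
  exact h.measurable

theorem measurable_embed (hF : Continuous (feature H : X → H)) :
    Measurable (embed H : ProbabilityMeasure X → Embedded H) :=
  (measurable_meanEmbedding hF).subtype_mk

theorem meanEmbedding_empirical (hF : Continuous (feature H : X → H)) {N : ℕ} [NeZero N]
    (u : Fin N → X) :
    meanEmbedding H (empirical u) = (N : ℝ)⁻¹ • ∑ n, feature H (u n) := by
  have hs := stronglyMeasurable_feature hF
  have hi : ∀ n ∈ Finset.univ, Integrable (feature H) (Measure.dirac (u n)) := fun n _ =>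
    integrable_dirac' hs (by simp)
  change ∫ v, feature H v ∂((N : ℝ≥0∞)⁻¹ • ∑ n, Measure.dirac (u n)) = _
  rw [integral_smul_measure, integral_finsetSum_measure hi]
  simp [integral_dirac' _ _ hs]

theorem measurable_embed_empirical (hF : Continuous (feature H : X → H)) {N : ℕ} [NeZero N] :
    Measurable fun u : Fin N → X => embed H (empirical u) := by
  have : SecondCountableTopology H := UniformSpace.secondCountable_of_separable H
  refine Measurable.subtype_mk (f := fun u : Fin N → X => meanEmbedding H (empirical u)) ?_
  simp_rw [meanEmbedding_empirical hF]
  exact (Finset.measurable_fun_sum _ fun n _ =>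
    hF.measurable.comp (measurable_pi_apply n)).const_smul _

/-- The mean squared error of the mean embedding of a bag. -/
theorem lintegral_norm_sq_embed_sub_le (hF : Continuous (feature H : X → H)) {B : ℝ}
    (hB : ∀ u : X, kernelFun H u u ≤ B) (Q : Measure (ProbabilityMeasure X × ℝ))
    [IsProbabilityMeasure Q] {N : ℕ} [NeZero N] :
    ∫⁻ z, ENNReal.ofReal (‖(embed H (empirical z.2) : H) - embed H z.1.1‖ ^ 2) ∂(Q ⊗ₘ bagKernel N)
      ≤ ENNReal.ofReal (B / N) := by
  have : SecondCountableTopology H := UniformSpace.secondCountable_of_separable H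
  have hm1 := measurable_subtype_coe.comp (measurable_embed_empirical hF (N := N))
  have hm2 := measurable_subtype_coe.comp (measurable_embed hF)
  have hmeas : Measurable fun z : (ProbabilityMeasure X × ℝ) × (Fin N → X) =>
      ENNReal.ofReal (‖(embed H (empirical z.2) : H) - embed H z.1.1‖ ^ 2) :=
    ((((hm1.comp measurable_snd).sub (hm2.comp (measurable_fst.comp measurable_fst))).norm).pow_const
      2).ennreal_ofReal
  rw [Measure.lintegral_compProd hmeas]
  calc _ ≤ ∫⁻ _, ENNReal.ofReal (B / N) ∂Q := by
        refine lintegral_mono fun p => ?_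
        -- Conditionally on (x, y) the bag is an i.i.d. sample from x, so the embedding error is the
        -- deviation of a sample average in H.
        have h := lintegral_norm_sq_average_sub_le (ν := (p.1 : Measure X))
          (stronglyMeasurable_feature hF).aestronglyMeasurable
          (fun u => (norm_feature_sq u).trans_le (hB u)) (NeZero.pos N)
        refine le_of_eq_of_le (lintegral_congr fun u => ?_) h
        change ENNReal.ofReal (‖meanEmbedding H (empirical u) - meanEmbedding H p.1‖ ^ 2) = _
        rw [meanEmbedding_empirical hF]
        rfl
    _ = _ := by simp

end MeanEmbedding

/-! ### Risk and covariance operator -/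

section Covariance

variable {S F : Type*} [NormedAddCommGroup F] [InnerProductSpace ℝ F] [CompleteSpace F]
  [RKHS ℝ F S ℝ] [TopologicalSpace S] [SecondCountableTopology S] [MeasurableSpace S]
  [OpensMeasurableSpace S]

theorem integrable_rankOne_feature (hF : Continuous (feature F : S → F)) {B : ℝ}
    (hB : ∀ s : S, kernelFun F s s ≤ B) (ν : Measure S) [IsFiniteMeasure ν] :
    Integrable (fun s => InnerProductSpace.rankOne ℝ (feature F s) (feature F s)) ν := by
  have hc : Continuous fun s => InnerProductSpace.rankOne ℝ (feature F s) (feature F s) := by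
    have h1 := (InnerProductSpace.rankOne (E := F) (F := F) ℝ).continuous.comp hF
    exact h1.clm_apply hF
  refine Integrable.of_bound hc.aestronglyMeasurable B (ae_of_all _ fun s => ?_)
  rw [InnerProductSpace.norm_rankOne, ← sq, norm_feature_sq]
  exact hB s

theorem inner_covOp (hF : Continuous (feature F : S → F)) {B : ℝ}
    (hB : ∀ s : S, kernelFun F s s ≤ B) (ρ : Measure (S × ℝ)) [IsFiniteMeasure ρ] (f g : F) :
    inner ℝ (covOp F ρ f) g = ∫ s, f s * g s ∂ρ.fst := by
  have hi := integrable_rankOne_feature hF hB ρ.fst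
  have h1 : covOp F ρ f = ∫ s, (f s) • feature F s ∂ρ.fst := by
    rw [covOp, ContinuousLinearMap.integral_apply hi]
    refine integral_congr_ae (ae_of_all _ fun s => ?_)
    simp [inner_feature]
  have h2 : Integrable (fun s => (f s) • feature F s) ρ.fst := by
    have := hi.apply_continuousLinearMap f
    refine this.congr (ae_of_all _ fun s => ?_)
    simp [inner_feature]
  rw [h1, real_inner_comm, ← integral_inner h2]
  refine integral_congr_ae (ae_of_all _ fun s => ?_)
  simp only [real_inner_smul_right]
  rw [real_inner_comm, inner_feature]

end Covariance

/-! ### Excess risk -/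

theorem integrable_mul_of_bounds {Ω : Type*} [MeasurableSpace Ω] {ρ : Measure Ω} [IsFiniteMeasure ρ]
    {u v : Ω → ℝ}
    (hu : Measurable u) (hv : Measurable v) {a b : ℝ} (ha : ∀ᵐ p ∂ρ, |u p| ≤ a)
    (hb : ∀ᵐ p ∂ρ, |v p| ≤ b) : Integrable (fun p => u p * v p) ρ := by
  refine Integrable.of_bound (hu.mul hv).aestronglyMeasurable (a * b) ?_
  filter_upwards [ha, hb] with p h1 h2
  rw [Real.norm_eq_abs, abs_mul]
  exact mul_le_mul h1 h2 (abs_nonneg _) ((abs_nonneg _).trans h1)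

theorem ae_abs_sub_label_le {S F : Type*} [NormedAddCommGroup F] [InnerProductSpace ℝ F]
    [CompleteSpace F] [RKHS ℝ F S ℝ] [MeasurableSpace S] {ρ : Measure (S × ℝ)} {B C : ℝ}
    (hB : ∀ s : S, kernelFun F s s ≤ B) (hC : ∀ᵐ p ∂ρ, |p.2| ≤ C) 
    (f : F) :
    ∀ᵐ p ∂ρ, |f p.1 - p.2| ≤ √B * ‖f‖ + C := by
  filter_upwards [hC] with p hp
  exact (abs_sub _ _).trans (add_le_add (abs_apply_le (hB _) f) hp)

theorem integral_fst_eq {S : Type*} [TopologicalSpace S] [MeasurableSpace S]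
    [OpensMeasurableSpace S] {ρ : Measure (S × ℝ)} [SecondCountableTopology S] {u : S → ℝ} (hu : Continuous u) :
    ∫ p, u p.1 ∂ρ = ∫ s, u s ∂ρ.fst :=
  (integral_map measurable_fst.aemeasurable hu.aestronglyMeasurable).symm

section ExcessRisk

variable {S F : Type*} [NormedAddCommGroup F] [InnerProductSpace ℝ F] [CompleteSpace F]
  [RKHS ℝ F S ℝ] [TopologicalSpace S] [MeasurableSpace S] [OpensMeasurableSpace S]

variable {ρ : Measure (S × ℝ)} [IsFiniteMeasure ρ] {B C : ℝ}

theorem risk_add (hF : Continuous (feature F : S → F)) (hB : ∀ s : S, kernelFun F s s ≤ B)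
    (hC : ∀ᵐ p ∂ρ, |p.2| ≤ C) (f g : F) :
    risk ρ (f + g) = risk ρ f + 2 * ∫ p, (f p.1 - p.2) * g p.1 ∂ρ + ∫ p, g p.1 ^ 2 ∂ρ := by
  have hf : Measurable fun p : S × ℝ => f p.1 - p.2 :=
    ((continuous_apply_of_feature hF f).measurable.comp measurable_fst).sub measurable_snd
  have hg : Measurable fun p : S × ℝ => g p.1 :=
    (continuous_apply_of_feature hF g).measurable.comp measurable_fst
  have hfb := ae_abs_sub_label_le hB hC f
  have hgb : ∀ᵐ p ∂ρ, |g p.1| ≤ √B * ‖g‖ := ae_of_all _ fun p => abs_apply_le (hB _) g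
  have h1 := integrable_mul_of_bounds hf hf hfb hfb
  have h2 := integrable_mul_of_bounds hf hg hfb hgb
  have h3 := integrable_mul_of_bounds hg hg hgb hgb
  simp only [risk, sq]
  rw [← integral_const_mul, ← integral_add h1 (h2.const_mul 2),
    ← integral_add (by exact h1.add (h2.const_mul 2)) h3]
  refine integral_congr_ae (ae_of_all _ fun p => ?_)
  simp only [apply_add]
  ring

/-- First-order condition at the minimizer: along the line f_H + r g the risk is a quadratic
polynomial in r with its minimum at 0, so the linear coefficient vanishes. -/
theorem integral_residual_mul_eq_zero (hF : Continuous (feature F : S → F))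
    (hB : ∀ s : S, kernelFun F s s ≤ B) (hC : ∀ᵐ p ∂ρ, |p.2| ≤ C) {fH : F}
    (hmin : IsMinOn (risk ρ) Set.univ fH) (g : F) :
    ∫ p, (fH p.1 - p.2) * g p.1 ∂ρ = 0 := by
  set a := ∫ p, (fH p.1 - p.2) * g p.1 ∂ρ
  set c := ∫ p, g p.1 ^ 2 ∂ρ
  have hc : 0 ≤ c := integral_nonneg fun p => sq_nonneg _
  have key : ∀ r : ℝ, 0 ≤ 2 * (r * a) + r ^ 2 * c := fun r => by
    have h1 : risk ρ fH ≤ risk ρ (fH + r • g) := hmin (Set.mem_univ _)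
    rw [risk_add hF hB hC] at h1
    have h2 : ∫ p, (fH p.1 - p.2) * (r • g) p.1 ∂ρ = r * a := by
      rw [← integral_const_mul]
      refine integral_congr_ae (ae_of_all _ fun p => ?_)
      simp only [apply_smul]
      ring
    have h3 : ∫ p, (r • g) p.1 ^ 2 ∂ρ = r ^ 2 * c := by
      rw [← integral_const_mul]
      refine integral_congr_ae (ae_of_all _ fun p => ?_)
      simp only [apply_smul]
      ring
    rw [h2, h3] at h1
    linarith
  -- The optimal step would be -a/c; the denominator c + 1 also covers c = 0 and still makes the
  -- polynomial negative unless a = 0.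
  have h := key (-a / (c + 1))
  have hc1 : 0 < c + 1 := by linarith
  have h' : 2 * (-a / (c + 1) * a) + (-a / (c + 1)) ^ 2 * c =
      -(a ^ 2 * (c + 2)) / (c + 1) ^ 2 := by
    field_simp
    ring
  rw [h', neg_div, Left.nonneg_neg_iff] at h
  have h4 : a ^ 2 * (c + 2) ≤ 0 := by
    by_contra hcon
    exact absurd h (not_le.2 (div_pos (not_le.1 hcon) (by positivity)))
  have : a ^ 2 = 0 := by nlinarith [sq_nonneg a]
  exact pow_eq_zero_iff two_ne_zero |>.1 this

/-- In `risk_add` the cross term vanishes at a minimizer, which leaves ∫ (f - f_H)² = ⟨T(f - f_H), f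
- f_H⟩. -/
theorem risk_sub_risk_eq [SecondCountableTopology S] (hF : Continuous (feature F : S → F))
    (hB : ∀ s : S, kernelFun F s s ≤ B) (hC : ∀ᵐ p ∂ρ, |p.2| ≤ C) {fH : F}
    (hmin : IsMinOn (risk ρ) Set.univ fH) (f : F) :
    risk ρ f - risk ρ fH = inner ℝ (covOp F ρ (f - fH)) (f - fH) := by
  have h := risk_add hF hB hC fH (f - fH)
  rw [add_sub_cancel, integral_residual_mul_eq_zero hF hB hC hmin] at h
  rw [h, inner_covOp hF hB, ← integral_fst_eq]
  · simp [sq]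
  · have := continuous_apply_of_feature hF (f - fH)
    fun_prop

end ExcessRisk

/-! ### Spectral coordinates -/

theorem sum_sq_inner_le {F : Type*} [NormedAddCommGroup F] [InnerProductSpace ℝ F] {e : ℕ → F} (he : Orthonormal ℝ e) (s : Finset ℕ)
    (d : F) :
    ∑ n ∈ s, inner ℝ (e n) d ^ 2 ≤ ‖d‖ ^ 2 := by
  simpa using he.sum_inner_products_le d (s := s)

section Spectral

variable {F : Type*} [NormedAddCommGroup F] [InnerProductSpace ℝ F]
  {T : F →L[ℝ] F} {e : ℕ → F} {t : ℕ → ℝ}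

theorem IsSpectralDecomp.apply_eq (hT : IsSpectralDecomp T e t) (n : ℕ) : T (e n) = t n • e n := by
  refine (hT.hasSum (e n)).unique ?_
  have hn := orthonormal_iff_ite.1 hT.orthonormal
  have h := hasSum_single (f := fun m => (t m * inner ℝ (e m) (e n)) • e m) n fun m hm => by
    simp [hn, hm]
  simpa [hn, hT.orthonormal.1 n] using h

theorem IsSpectralDecomp.inner_eq (hT : IsSpectralDecomp T e t) (n m : ℕ) :
    inner ℝ (T (e n)) (e m) = if n = m then t n else 0 := by
  rw [hT.apply_eq, real_inner_smul_left, orthonormal_iff_ite.1 hT.orthonormal]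
  simp

theorem IsSpectralDecomp.hasSum_inner (hT : IsSpectralDecomp T e t) (d : F) :
    HasSum (fun n => t n * inner ℝ (e n) d ^ 2) (inner ℝ (T d) d) := by
  have h := (hT.hasSum d).mapL (innerSL ℝ d)
  simp only [innerSL_apply_apply, real_inner_smul_right] at h
  rw [real_inner_comm]
  have heq : (fun n => t n * inner ℝ (e n) d ^ 2) =
      fun n => t n * inner ℝ (e n) d * inner ℝ d (e n) := funext fun n => by
    rw [real_inner_comm d]
    ring
  rw [heq]
  exact h

/-- The energy `⟨T d, d⟩ + λ ‖d‖²` dominates its restriction to finitely many coordinates. -/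
theorem IsSpectralDecomp.sum_energy_le (hT : IsSpectralDecomp T e t) (ht : ∀ n, 0 ≤ t n) {lam : ℝ}
    (hlam : 0 ≤ lam) (s : Finset ℕ) (d : F) :
    ∑ n ∈ s, (t n + lam) * inner ℝ (e n) d ^ 2 ≤ inner ℝ (T d) d + lam * ‖d‖ ^ 2 := by
  simp_rw [add_mul, Finset.sum_add_distrib, ← Finset.mul_sum]
  gcongr
  · exact sum_le_hasSum s (fun n _ => mul_nonneg (ht n) (sq_nonneg _)) (hT.hasSum_inner d)
  · exact sum_sq_inner_le hT.orthonormal s d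

variable [CompleteSpace F]

theorem summable_inner_smul {e : ℕ → F} (he : Orthonormal ℝ e) (d : F) :
    Summable fun n => (inner ℝ (e n) d : ℝ) • e n := by
  have h := he.orthogonalFamily.summable_iff_norm_sq_summable fun n => (inner ℝ (e n) d : ℝ)
  simp only [LinearIsometry.toSpanSingleton_apply] at h
  exact h.2 (he.inner_products_summable d)

/-- The remainder is orthogonal to every e_m, and the closed subspace ker T is the orthogonal
complement of their span. -/
theorem IsSpectralDecomp.sub_tsum_mem_ker (hT : IsSpectralDecomp T e t) (d : F) :
    d - ∑' n, (inner ℝ (e n) d : ℝ) • e n ∈ T.ker := by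
  have hcl : IsClosed (T.ker : Set F) := T.isClosed_ker
  have : CompleteSpace T.ker := hcl.completeSpace_coe
  rw [← Submodule.orthogonal_orthogonal T.ker, ← hT.basis, Submodule.orthogonal_closure,
    Submodule.mem_orthogonal]
  intro u hu
  induction hu using Submodule.span_induction with
  | mem x hx =>
    obtain ⟨m, rfl⟩ := hx
    have h := ((summable_inner_smul hT.orthonormal d).hasSum).mapL (innerSL ℝ (e m))
    have h' : HasSum (fun n => innerSL ℝ (e m) ((inner ℝ (e n) d : ℝ) • e n)) (inner ℝ (e m) d) := by
      have hn := orthonormal_iff_ite.1 hT.orthonormal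
      have h := hasSum_single (f := fun n => innerSL ℝ (e m) ((inner ℝ (e n) d : ℝ) • e n)) m
        fun n hm => by simp [hn, hm.symm]
      simpa [inner_smul_right, hn, hT.orthonormal.1 m] using h
    have h2 := h.unique h'
    rw [innerSL_apply_apply] at h2
    rw [inner_sub_right, h2, sub_self]
  | zero => simp
  | add x y _ _ hx hy => rw [inner_add_left, hx, hy, add_zero]
  | smul a x _ hx => rw [inner_smul_left, hx, mul_zero]

end Spectral

/-! ### Coordinate expansions of sample quantities -/

theorem abs_sum_mul_le {ι : Type*} (s : Finset ι) (a b : ι → ℝ) {A B : ℝ}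
    (ha : ∑ k ∈ s, a k ^ 2 ≤ A) (hb : ∑ k ∈ s, b k ^ 2 ≤ B) :
    |∑ k ∈ s, a k * b k| ≤ √A * √B := by
  have hA : 0 ≤ A := (Finset.sum_nonneg fun k _ => sq_nonneg _).trans ha
  rw [← Real.sqrt_mul hA, ← Real.sqrt_sq_eq_abs]
  refine Real.sqrt_le_sqrt ((Finset.sum_mul_sq_le_sq_mul_sq s a b).trans ?_)
  exact mul_le_mul ha hb (Finset.sum_nonneg fun k _ => sq_nonneg _) hA

/-- Cauchy–Schwarz with weights `v`. -/
theorem abs_sum_mul_le_of_weights {ι : Type*} (s : Finset ι) (a b v : ι → ℝ) (hv : ∀ k, 0 < v k)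
    {A B : ℝ} (ha : ∑ k ∈ s, (v k)⁻¹ * a k ^ 2 ≤ A) (hb : ∑ k ∈ s, v k * b k ^ 2 ≤ B) :
    |∑ k ∈ s, a k * b k| ≤ √A * √B := by
  have h := abs_sum_mul_le s (fun k => a k / √(v k)) (fun k => √(v k) * b k) (A := A) (B := B)
    (by simpa [mul_pow, Real.sq_sqrt (hv _).le, div_eq_inv_mul] using ha)
    (by simpa [mul_pow, Real.sq_sqrt (hv _).le] using hb)
  convert h using 3 with k
  have := (Real.sqrt_pos.2 (hv k)).ne'
  field_simp

theorem abs_le_of_hasSum_of_forall_finset {ι : Type*} {f : ι → ℝ} {a A : ℝ} (h : HasSum f a)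
    (hA : ∀ s : Finset ι, |∑ k ∈ s, f k| ≤ A) : |a| ≤ A :=
  le_of_tendsto (show Tendsto (fun s : Finset ι => |∑ k ∈ s, f k|) atTop (𝓝 |a|) from h.abs)
    (Eventually.of_forall hA)

section Expansion

variable {S F : Type*} [NormedAddCommGroup F] [InnerProductSpace ℝ F] [RKHS ℝ F S ℝ]

/-- At the point `s`, every function is the sum of its expansion along `e`. -/
def ExpandsAt (e : ℕ → F) (s : S) : Prop :=
  ∀ f : F, HasSum (fun n => inner ℝ (e n) f * e n s) (f s)

/-- The expansion of f along (e_n) misses only a component in ker T, and such a component vanishes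
almost everywhere since ∫ f² = ⟨T f, f⟩ = 0. Hence ker T is invisible at almost every sample point,
and the coordinates e_n suffice for all sample averages. -/
theorem ae_expandsAt [CompleteSpace F] [TopologicalSpace S] [SecondCountableTopology S]
    [MeasurableSpace S] [OpensMeasurableSpace S] [TopologicalSpace.SeparableSpace F]
    (hF : Continuous (feature F : S → F)) {B : ℝ} (hB : ∀ s : S, kernelFun F s s ≤ B)
    {ρ : Measure (S × ℝ)} [IsFiniteMeasure ρ] {e : ℕ → F} {t : ℕ → ℝ}
    (hT : IsSpectralDecomp (covOp F ρ) e t) : ∀ᵐ s ∂ρ.fst, ExpandsAt e s := by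
  set T := covOp F ρ
  have hcl : IsClosed (T.ker : Set F) := T.isClosed_ker
  have : CompleteSpace T.ker := hcl.completeSpace_coe
  have hker : ∀ f ∈ T.ker, ∀ᵐ s ∂ρ.fst, f s = 0 := fun f hf => by
    have h := inner_covOp hF hB ρ f f
    rw [show covOp F ρ f = 0 from hf, inner_zero_left] at h
    have hc := continuous_apply_of_feature hF f
    have hi : Integrable (fun s => f s * f s) ρ.fst := by
      refine Integrable.of_bound (hc.mul hc).aestronglyMeasurable
        ((√B * ‖f‖) * (√B * ‖f‖)) (ae_of_all _ fun s => ?_)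
      rw [Real.norm_eq_abs, abs_mul]
      exact mul_self_le_mul_self (abs_nonneg _) (abs_apply_le (hB s) f)
    have h0 := (integral_eq_zero_iff_of_nonneg (fun s => mul_self_nonneg (f s)) hi).1 h.symm
    filter_upwards [h0] with s hs
    exact mul_self_eq_zero.1 hs
  -- The exceptional set must not depend on f: take it for a dense sequence, then extend by
  -- continuity of the projection and of evaluation at s.
  have hall : ∀ᵐ s ∂ρ.fst, ∀ k : ℕ,
      (T.ker.starProjection (TopologicalSpace.denseSeq F k)) s = 0 :=
    ae_all_iff.2 fun k => hker _ (Submodule.starProjection_apply_mem _ _)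
  filter_upwards [hall] with s hs f
  have hzero : ∀ f : F, (T.ker.starProjection f) s = 0 := fun f => by
    have hc : Continuous fun f : F => (T.ker.starProjection f) s :=
      (RKHS.continuous_eval s).comp T.ker.starProjection.continuous
    have h1 : (fun f : F => (T.ker.starProjection f) s) = fun _ => 0 :=
      hc.ext_on (TopologicalSpace.denseRange_denseSeq F) continuous_const
        (by rintro _ ⟨k, rfl⟩; exact hs k)
    exact congrFun h1 f
  have h2 := hT.sub_tsum_mem_ker f
  have h3 := hzero (f - ∑' n, (inner ℝ (e n) f : ℝ) • e n)
  rw [Submodule.starProjection_eq_self_iff.2 h2, apply_sub, sub_eq_zero] at h3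
  have h4 := ((summable_inner_smul hT.orthonormal f).hasSum).mapL (innerSL ℝ (feature F s))
  simpa [inner_smul_right, inner_feature, ← h3] using h4

variable {T : F →L[ℝ] F} {e : ℕ → F} {t : ℕ → ℝ} {lam : ℝ} {l : ℕ}

/-- The noise term of the sample, tested against `d`. -/
theorem abs_average_mul_apply_le (hT : IsSpectralDecomp T e t) (ht : ∀ n, 0 ≤ t n)
    (hlam : 0 < lam) {s : Fin l → S} (hs : ∀ i, ExpandsAt e (s i)) (r : Fin l → ℝ) {A : ℝ}
    (hA : ∀ u : Finset ℕ,
      ∑ n ∈ u, (t n + lam)⁻¹ * ((l : ℝ)⁻¹ * ∑ i, r i * e n (s i)) ^ 2 ≤ A) (d : F) :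
    |(l : ℝ)⁻¹ * ∑ i, r i * d (s i)| ≤ √A * √(inner ℝ (T d) d + lam * ‖d‖ ^ 2) := by
  have h : HasSum (fun n => ((l : ℝ)⁻¹ * ∑ i, r i * e n (s i)) * inner ℝ (e n) d)
      ((l : ℝ)⁻¹ * ∑ i, r i * d (s i)) := by
    have h1 := (hasSum_sum (s := Finset.univ) fun i _ => (hs i d).mul_left (r i)).mul_left (l : ℝ)⁻¹
    have heq : (fun n => ((l : ℝ)⁻¹ * ∑ i, r i * e n (s i)) * inner ℝ (e n) d) =
        fun n => (l : ℝ)⁻¹ * ∑ i, r i * (inner ℝ (e n) d * e n (s i)) := funext fun n => by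
      rw [mul_assoc, Finset.sum_mul]
      congr 1
      exact Finset.sum_congr rfl fun i _ => by ring
    rw [heq]
    exact h1
  -- Cauchy–Schwarz with weights t_n + λ on each finite partial sum: one factor is the noise
  -- statistic, the other the energy of d.
  refine abs_le_of_hasSum_of_forall_finset h fun u => ?_
  exact abs_sum_mul_le_of_weights u _ _ (fun n => t n + lam)
    (fun n => add_pos_of_nonneg_of_pos (ht n) hlam) (hA u) (hT.sum_energy_le ht hlam.le u d)

/-- The deviation of the empirical covariance, tested against `d`. -/
theorem abs_average_sq_apply_sub_le (hT : IsSpectralDecomp T e t) (ht : ∀ n, 0 ≤ t n)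
    (hlam : 0 < lam) {s : Fin l → S} (hs : ∀ i, ExpandsAt e (s i)) {A : ℝ}
    (hA : ∀ u : Finset (ℕ × ℕ), ∑ k ∈ u, ((t k.1 + lam)⁻¹ * (t k.2 + lam)⁻¹) *
      ((l : ℝ)⁻¹ * ∑ i, e k.1 (s i) * e k.2 (s i) - inner ℝ (T (e k.1)) (e k.2)) ^ 2 ≤ A) (d : F) :
    |(l : ℝ)⁻¹ * ∑ i, d (s i) ^ 2 - inner ℝ (T d) d| ≤
      √A * (inner ℝ (T d) d + lam * ‖d‖ ^ 2) := by
  set q := inner ℝ (T d) d + lam * ‖d‖ ^ 2 with hq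
  have hv : ∀ n, 0 < t n + lam := fun n => add_pos_of_nonneg_of_pos (ht n) hlam
  have hen := hT.sum_energy_le ht hlam.le (d := d)
  have hq0 : 0 ≤ q := by simpa using hen ∅
  set c : ℕ → ℝ := fun n => inner ℝ (e n) d
  -- It suffices to treat the truncations of d to finitely many coordinates, where squares become
  -- finite double sums over pairs of indices.
  have hlim : Tendsto (fun u : Finset ℕ => |(l : ℝ)⁻¹ * ∑ i, (∑ n ∈ u, c n * e n (s i)) ^ 2 -
      ∑ n ∈ u, t n * c n ^ 2|) atTop (𝓝 |(l : ℝ)⁻¹ * ∑ i, d (s i) ^ 2 - inner ℝ (T d) d|) := by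
    refine (Tendsto.sub ?_ (hT.hasSum_inner d)).abs
    exact (tendsto_finsetSum _ fun i _ => (hs i d).pow 2).const_mul _
  refine le_of_tendsto hlim (Eventually.of_forall fun u => ?_)
  have hexp : (l : ℝ)⁻¹ * ∑ i, (∑ n ∈ u, c n * e n (s i)) ^ 2 - ∑ n ∈ u, t n * c n ^ 2 =
      ∑ k ∈ u ×ˢ u, ((l : ℝ)⁻¹ * ∑ i, e k.1 (s i) * e k.2 (s i) -
        inner ℝ (T (e k.1)) (e k.2)) * (c k.1 * c k.2) := by
    simp_rw [sub_mul, Finset.sum_sub_distrib]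
    congr 1
    · have hi : ∀ i, (∑ n ∈ u, c n * e n (s i)) ^ 2 =
          ∑ k ∈ u ×ˢ u, e k.1 (s i) * e k.2 (s i) * (c k.1 * c k.2) := fun i => by
        rw [sq, Finset.sum_mul_sum, ← Finset.sum_product']
        exact Finset.sum_congr rfl fun k _ => by ring
      simp_rw [hi]
      rw [Finset.sum_comm, Finset.mul_sum]
      exact Finset.sum_congr rfl fun k _ => by rw [mul_assoc, Finset.sum_mul]
    · simp_rw [hT.inner_eq]
      rw [Finset.sum_product]
      refine Finset.sum_congr rfl fun n hn => ?_
      simp [hn, sq]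
  rw [hexp]
  -- With product weights the double sum factors as the square of the truncated energy.
  have hb : ∑ k ∈ u ×ˢ u, ((t k.1 + lam) * (t k.2 + lam)) * (c k.1 * c k.2) ^ 2 ≤ q ^ 2 := by
    have : ∑ k ∈ u ×ˢ u, ((t k.1 + lam) * (t k.2 + lam)) * (c k.1 * c k.2) ^ 2 =
        (∑ n ∈ u, (t n + lam) * c n ^ 2) ^ 2 := by
      rw [sq (∑ n ∈ u, _), Finset.sum_mul_sum, ← Finset.sum_product']
      exact Finset.sum_congr rfl fun k _ => by ring
    rw [this]
    exact pow_le_pow_left₀ (Finset.sum_nonneg fun n _ => mul_nonneg (hv n).le (sq_nonneg _)) (hen u) 2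
  have h := abs_sum_mul_le_of_weights (u ×ˢ u) _ _ (fun k : ℕ × ℕ => (t k.1 + lam) * (t k.2 + lam))
    (fun k => mul_pos (hv _) (hv _)) (by simpa only [mul_inv] using hA (u ×ˢ u)) hb
  rwa [Real.sqrt_sq hq0] at h

end Expansion

/-! ### The source condition -/

section Source

variable {F : Type*} [NormedAddCommGroup F] [InnerProductSpace ℝ F] [CompleteSpace F]
  {T : F →L[ℝ] F} {e : ℕ → F} {t : ℕ → ℝ} {σ : ℝ} {g f : F}

/-- Cauchy–Schwarz in coordinates, with t_n^σ moved from g onto d. The last term accounts for the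
part of g in ker T, which is present only for σ = 0. -/
theorem IsPowApply.abs_inner_le (h : IsPowApply T e t σ g f) (he : Orthonormal ℝ e) (d : F)
    {A : ℝ} (hA : ∀ u : Finset ℕ, ∑ n ∈ u, (t n ^ σ * inner ℝ (e n) d) ^ 2 ≤ A) :
    |inner ℝ f d| ≤ √A * ‖g‖ + 0 ^ σ * (‖g‖ * ‖d‖) := by
  have hcl : IsClosed (T.ker : Set F) := T.isClosed_ker
  have : CompleteSpace T.ker := hcl.completeSpace_coe
  have h1 := h.mapL (innerSL ℝ d)
  simp only [innerSL_apply_apply, inner_smul_right] at h1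
  have h2 : |inner ℝ d (f - (0 : ℝ) ^ σ • T.ker.starProjection g)| ≤ √A * ‖g‖ := by
    refine abs_le_of_hasSum_of_forall_finset h1 fun u => ?_
    have h3 := abs_sum_mul_le u (fun n => t n ^ σ * inner ℝ (e n) d) (fun n => inner ℝ (e n) g)
      (hA u) (sum_sq_inner_le he u g)
    rw [Real.sqrt_sq (norm_nonneg g)] at h3
    convert h3 using 3 with n
    rw [real_inner_comm d]
    ring
  have h4 : |inner ℝ d ((0 : ℝ) ^ σ • T.ker.starProjection g)| ≤ 0 ^ σ * (‖g‖ * ‖d‖) := by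
    have h0 : (0 : ℝ) ≤ 0 ^ σ := Real.rpow_nonneg le_rfl _
    rw [inner_smul_right, abs_mul, abs_of_nonneg h0]
    refine mul_le_mul_of_nonneg_left ((abs_real_inner_le_norm _ _).trans ?_) h0
    rw [mul_comm]
    exact mul_le_mul_of_nonneg_right (Submodule.norm_starProjection_apply_le _ _) (norm_nonneg _)
  rw [inner_sub_right] at h2
  rw [real_inner_comm]
  calc |inner ℝ d f| = |(inner ℝ d f - inner ℝ d ((0 : ℝ) ^ σ • T.ker.starProjection g)) +
        inner ℝ d ((0 : ℝ) ^ σ • T.ker.starProjection g)| := by rw [sub_add_cancel]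
    _ ≤ _ := (abs_add_le _ _).trans (add_le_add h2 h4)

/-- Testing against d = f and cancelling one factor ‖f‖; the spectral factors t_n^σ are at most max
1 β because 0 ≤ σ ≤ 1. -/
theorem IsPowApply.norm_le (h : IsPowApply T e t σ g f) (he : Orthonormal ℝ e)
    (ht : ∀ n, 0 ≤ t n) {β : ℝ} (hβ : ∀ n, t n ≤ β) (hσ0 : 0 ≤ σ) (hσ1 : σ ≤ 1) :
    ‖f‖ ≤ (max 1 β + 1) * ‖g‖ := by
  have hm1 : 1 ≤ max 1 β := le_max_left _ _
  have htσ : ∀ n, t n ^ σ ≤ max 1 β := fun n =>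
    calc t n ^ σ ≤ (max 1 β) ^ σ :=
          Real.rpow_le_rpow (ht n) ((hβ n).trans (le_max_right _ _)) hσ0
      _ ≤ (max 1 β) ^ (1 : ℝ) := Real.rpow_le_rpow_of_exponent_le hm1 hσ1
      _ = _ := Real.rpow_one _
  have h1 := h.abs_inner_le he f (A := (max 1 β * ‖f‖) ^ 2) fun u => by
    simp_rw [mul_pow]
    calc ∑ n ∈ u, (t n ^ σ) ^ 2 * inner ℝ (e n) f ^ 2
        ≤ ∑ n ∈ u, (max 1 β) ^ 2 * inner ℝ (e n) f ^ 2 :=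
          Finset.sum_le_sum fun n _ => mul_le_mul_of_nonneg_right
            (pow_le_pow_left₀ (Real.rpow_nonneg (ht n) _) (htσ n) 2) (sq_nonneg _)
      _ ≤ _ := by
          rw [← Finset.mul_sum]
          exact mul_le_mul_of_nonneg_left (sum_sq_inner_le he u f) (sq_nonneg _)
  rw [Real.sqrt_sq (by positivity), real_inner_self_eq_norm_sq, abs_of_nonneg (sq_nonneg _)] at h1
  have h0 : (0 : ℝ) ^ σ ≤ 1 := Real.rpow_le_one le_rfl zero_le_one hσ0
  have h2 : (0 : ℝ) ^ σ * (‖g‖ * ‖f‖) ≤ 1 * (‖g‖ * ‖f‖) :=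
    mul_le_mul_of_nonneg_right h0 (by positivity)
  rcases (norm_nonneg f).eq_or_lt with h3 | h3
  · rw [← h3]
    positivity
  · refine le_of_mul_le_mul_right ?_ h3
    nlinarith

/-- The regularization bias, tested against `d`. -/
theorem IsPowApply.mul_abs_inner_le {c lam : ℝ} (hT : IsSpectralDecomp T e t)
    (h : IsPowApply T e t ((c - 1) / 2) g f) (ht : ∀ n, 0 ≤ t n) (hc1 : 1 ≤ c) (hc2 : c ≤ 2)
    (hlam : 0 < lam) (d : F) :
    lam * |inner ℝ f d| ≤ 2 * (lam ^ (c / 2) * ‖g‖ * √(inner ℝ (T d) d + lam * ‖d‖ ^ 2)) := by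
  set q := inner ℝ (T d) d + lam * ‖d‖ ^ 2 with hq
  have hen := hT.sum_energy_le ht hlam.le (d := d)
  have hTd : 0 ≤ inner ℝ (T d) d :=
    (hT.hasSum_inner d).nonneg fun n => mul_nonneg (ht n) (sq_nonneg _)
  have hq0 : 0 ≤ q := by positivity
  -- Split λ² = λ^c λ^(2-c); then λ^(2-c) t^(c-1) ≤ t + λ, as both exponents are nonnegative (1 ≤ c
  -- ≤ 2) and add up to 1.
  have hle : ∀ n, (lam * t n ^ ((c - 1) / 2)) ^ 2 ≤ lam ^ c * (t n + lam) := fun n => by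
    have hpos : 0 < t n + lam := add_pos_of_nonneg_of_pos (ht n) hlam
    have e1 : (t n ^ ((c - 1) / 2)) ^ 2 = t n ^ (c - 1) := by
      rw [← Real.rpow_natCast, ← Real.rpow_mul (ht n)]
      congr 1
      push_cast
      ring
    have e2 : lam ^ 2 = lam ^ c * lam ^ (2 - c) := by
      rw [← Real.rpow_add hlam, ← Real.rpow_natCast]
      congr 1
      push_cast
      ring
    rw [mul_pow, e1, e2, mul_assoc]
    refine mul_le_mul_of_nonneg_left ?_ (Real.rpow_nonneg hlam.le _)
    calc lam ^ (2 - c) * t n ^ (c - 1) ≤ (t n + lam) ^ (2 - c) * (t n + lam) ^ (c - 1) := by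
          refine mul_le_mul ?_ ?_ (Real.rpow_nonneg (ht n) _) (Real.rpow_nonneg hpos.le _)
          · exact Real.rpow_le_rpow hlam.le (by linarith [ht n]) (by linarith)
          · exact Real.rpow_le_rpow (ht n) (by linarith) (by linarith)
      _ = t n + lam := by
          rw [← Real.rpow_add hpos]
          convert Real.rpow_one _ using 2
          ring
  have hA : ∀ u : Finset ℕ, ∑ n ∈ u, (t n ^ ((c - 1) / 2) * inner ℝ (e n) d) ^ 2 ≤
      (lam ^ (c / 2) * √q / lam) ^ 2 := fun u => by
    have h1 : lam ^ 2 * ∑ n ∈ u, (t n ^ ((c - 1) / 2) * inner ℝ (e n) d) ^ 2 ≤ lam ^ c * q := by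
      calc lam ^ 2 * ∑ n ∈ u, (t n ^ ((c - 1) / 2) * inner ℝ (e n) d) ^ 2
          = ∑ n ∈ u, (lam * t n ^ ((c - 1) / 2)) ^ 2 * inner ℝ (e n) d ^ 2 := by
            rw [Finset.mul_sum]
            exact Finset.sum_congr rfl fun n _ => by ring
        _ ≤ ∑ n ∈ u, lam ^ c * ((t n + lam) * inner ℝ (e n) d ^ 2) :=
            Finset.sum_le_sum fun n _ => by
              rw [← mul_assoc]
              exact mul_le_mul_of_nonneg_right (hle n) (sq_nonneg _)
        _ ≤ _ := by
            rw [← Finset.mul_sum]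
            exact mul_le_mul_of_nonneg_left (hen u) (Real.rpow_nonneg hlam.le _)
    have e3 : (lam ^ (c / 2)) ^ 2 = lam ^ c := by
      rw [← Real.rpow_natCast, ← Real.rpow_mul hlam.le]
      congr 1
      push_cast
      ring
    rw [div_pow, mul_pow, Real.sq_sqrt hq0, e3, le_div_iff₀ (by positivity)]
    linarith
  have h1 := h.abs_inner_le hT.orthonormal d hA
  have hl0 : 0 ≤ lam ^ (c / 2) := Real.rpow_nonneg hlam.le _
  rw [Real.sqrt_sq (by positivity)] at h1
  -- The kernel part survives only for c = 1; there √λ ‖d‖ ≤ √q gives the same order λ^(c/2) = √λ.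
  have h2 : lam * (0 ^ ((c - 1) / 2) * (‖g‖ * ‖d‖)) ≤ lam ^ (c / 2) * ‖g‖ * √q := by
    rcases hc1.eq_or_lt with rfl | hc
    · have h3 : √lam * ‖d‖ ≤ √q := by
        rw [← Real.sqrt_sq (norm_nonneg d), ← Real.sqrt_mul hlam.le]
        exact Real.sqrt_le_sqrt (by linarith)
      rw [sub_self, zero_div, Real.rpow_zero, one_mul, ← Real.sqrt_eq_rpow]
      calc lam * (‖g‖ * ‖d‖) = √lam * ‖g‖ * (√lam * ‖d‖) := by
            nth_rewrite 1 [← Real.mul_self_sqrt hlam.le]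
            ring
        _ ≤ _ := mul_le_mul_of_nonneg_left h3 (by positivity)
    · rw [Real.zero_rpow (by linarith), zero_mul, mul_zero]
      positivity
  calc lam * |inner ℝ f d| ≤ lam * (lam ^ (c / 2) * √q / lam * ‖g‖ +
        0 ^ ((c - 1) / 2) * (‖g‖ * ‖d‖)) := mul_le_mul_of_nonneg_left h1 hlam.le
    _ = lam ^ (c / 2) * ‖g‖ * √q + lam * (0 ^ ((c - 1) / 2) * (‖g‖ * ‖d‖)) := by
        field_simp
    _ ≤ _ := by linarith

end Source

/-! ### Effective dimension -/

/-- Comparison of a decreasing power with its integral over [x, x + 1]. The proof avoids integrals: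
log((x+1)/x) ≥ 1/(x+1), then exp y ≥ 1 + y. -/
theorem rpow_neg_le_sub {b : ℝ} (hb : 1 < b) {x : ℝ} (hx : 0 < x) :
    (b - 1) * (x + 1) ^ (-b) ≤ x ^ (1 - b) - (x + 1) ^ (1 - b) := by
  have hx1 : 0 < x + 1 := by linarith
  have h1 : 1 / (x + 1) ≤ Real.log ((x + 1) / x) := by
    refine le_of_eq_of_le ?_ (Real.one_sub_inv_le_log_of_pos (div_pos hx1 hx))
    field_simp
    ring
  have h2 : 1 + (b - 1) * (1 / (x + 1)) ≤ ((x + 1) / x) ^ (b - 1) := by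
    rw [Real.rpow_def_of_pos (div_pos hx1 hx)]
    refine le_trans ?_ (Real.add_one_le_exp _)
    nlinarith
  have h3 : ((x + 1) / x) ^ (b - 1) = x ^ (1 - b) / (x + 1) ^ (1 - b) := by
    rw [Real.div_rpow hx1.le hx.le, show 1 - b = -(b - 1) by ring, Real.rpow_neg hx.le,
      Real.rpow_neg hx1.le]
    field_simp
  have h4 : (x + 1) ^ (-b) = (x + 1) ^ (1 - b) * (1 / (x + 1)) := by
    rw [show -b = (1 - b) - 1 by ring, Real.rpow_sub_one hx1.ne']
    ring
  rw [h3, le_div_iff₀ (Real.rpow_pos_of_pos hx1 _)] at h2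
  rw [h4]
  linarith

/-- Each of the first m terms is at most 1; the later ones are at most (β/λ) n^(-b) and telescope by
`rpow_neg_le_sub`. -/
theorem sum_range_div_add_le {b β lam : ℝ} (hb : 1 < b) (hlam : 0 < lam) {t : ℕ → ℝ}
    (ht : ∀ n, 0 ≤ t n) (htβ : ∀ n : ℕ, ((n : ℝ) + 1) ^ b * t n ≤ β) {m : ℕ} (hm : 0 < m) (K : ℕ) :
    ∑ n ∈ Finset.range K, t n / (t n + lam) ≤ m + β / (lam * (b - 1)) * (m : ℝ) ^ (1 - b) := by
  have hb1 : 0 < b - 1 := by linarith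
  have hβ : 0 ≤ β := (mul_nonneg (by positivity) (ht 0)).trans (htβ 0)
  have hone : ∀ n, t n / (t n + lam) ≤ 1 := fun n =>
    div_le_one_of_le₀ (by linarith) (by linarith [ht n])
  have hle : ∀ n : ℕ, t n / (t n + lam) ≤ β / lam * ((n : ℝ) + 1) ^ (-b) := fun n => by
    have hn : (0 : ℝ) < (n : ℝ) + 1 := by positivity
    rw [Real.rpow_neg hn.le, ← div_eq_mul_inv, div_right_comm]
    refine (div_le_div_of_nonneg_left (ht n) hlam (by linarith [ht n])).trans ?_
    refine div_le_div_of_nonneg_right ?_ hlam.le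
    rw [le_div_iff₀ (Real.rpow_pos_of_pos hn _), mul_comm]
    exact htβ n
  have hsmall : ∀ k : ℕ, ∑ n ∈ Finset.range k, t n / (t n + lam) ≤ k := fun k =>
    (Finset.sum_le_sum fun n _ => hone n).trans (by simp)
  have hc : 0 ≤ β / (lam * (b - 1)) := by positivity
  rcases le_total K m with h | h
  · refine (hsmall K).trans ?_
    have : (K : ℝ) ≤ m := by exact_mod_cast h
    have : 0 ≤ β / (lam * (b - 1)) * (m : ℝ) ^ (1 - b) := by positivity
    linarith
  -- The subtracted K^(1-b) makes the claim inductive.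
  · suffices hs : ∑ n ∈ Finset.range K, t n / (t n + lam) ≤
        m + β / (lam * (b - 1)) * ((m : ℝ) ^ (1 - b) - (K : ℝ) ^ (1 - b)) by
      refine hs.trans ?_
      gcongr
      linarith [Real.rpow_nonneg (Nat.cast_nonneg K : (0 : ℝ) ≤ K) (1 - b)]
    induction K, h using Nat.le_induction with
    | base => simpa using hsmall m
    | succ k hk ih =>
      rw [Finset.sum_range_succ]
      have hk0 : (0 : ℝ) < k := by exact_mod_cast hm.trans_le hk
      have h1 := rpow_neg_le_sub hb hk0
      have h2 : β / lam * ((k : ℝ) + 1) ^ (-b) ≤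
          β / (lam * (b - 1)) * ((k : ℝ) ^ (1 - b) - ((k : ℝ) + 1) ^ (1 - b)) := by
        refine le_trans (le_of_eq ?_) (mul_le_mul_of_nonneg_left h1 hc)
        field_simp
      push_cast
      have := hle k
      nlinarith

/-- The constant in the bound of the effective dimension. -/
noncomputable def effDimConst (b β : ℝ) : ℝ := 2 + β / (b - 1)

/-- The effective dimension of an operator with eigenvalues of order `n ^ (-b)`. -/
theorem tsum_div_add_le {b β lam : ℝ} (hb : 1 < b) (hlam : 0 < lam) (hlam1 : lam ≤ 1) {t : ℕ → ℝ}
    (ht : ∀ n, 0 ≤ t n) (htβ : ∀ n : ℕ, ((n : ℝ) + 1) ^ b * t n ≤ β) :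
    ∑' n, ENNReal.ofReal (t n / (t n + lam)) ≤
      ENNReal.ofReal (effDimConst b β * lam ^ (-(1 / b))) := by
  have hb0 : 0 < b := by linarith
  have hb1 : 0 < b - 1 := by linarith
  have hβ : 0 ≤ β := (mul_nonneg (by positivity) (ht 0)).trans (htβ 0)
  set x := lam ^ (-(1 / b)) with hx
  have hx1 : 1 ≤ x := Real.one_le_rpow_of_pos_of_le_one_of_nonpos hlam hlam1 (by simp [hb0.le])
  have hx0 : 0 < x := by linarith
  -- The cut m ≈ λ^(-1/b) balances m against m^(1-b)/λ; λ ≤ 1 gives x ≥ 1 and so ⌈x⌉ ≤ 2x.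
  have hm : 0 < ⌈x⌉₊ := Nat.ceil_pos.2 hx0
  refine ENNReal.tsum_le_of_sum_range_le fun K => ?_
  rw [← ENNReal.ofReal_sum_of_nonneg fun n _ => div_nonneg (ht n) (by linarith [ht n])]
  refine ENNReal.ofReal_le_ofReal ((sum_range_div_add_le hb hlam ht htβ hm K).trans ?_)
  have h1 : (⌈x⌉₊ : ℝ) ≤ 2 * x := by linarith [Nat.ceil_lt_add_one hx0.le]
  have h2 : (⌈x⌉₊ : ℝ) ^ (1 - b) ≤ lam * x := by
    calc (⌈x⌉₊ : ℝ) ^ (1 - b) ≤ x ^ (1 - b) :=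
          Real.rpow_le_rpow_of_nonpos hx0 (Nat.le_ceil x) (by linarith)
      _ = lam * x := by
          rw [hx, ← Real.rpow_mul hlam.le, mul_comm lam, ← Real.rpow_add_one hlam.ne']
          congr 1
          field_simp
          ring
  calc (⌈x⌉₊ : ℝ) + β / (lam * (b - 1)) * (⌈x⌉₊ : ℝ) ^ (1 - b)
      ≤ 2 * x + β / (lam * (b - 1)) * (lam * x) := by gcongr
    _ = effDimConst b β * x := by
        rw [effDimConst]
        field_simp

/-! ### Energy of the estimation error -/

/-- The basic inequality of ridge regression, for `d = f - f₀`. -/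
theorem basic_inequality {S F : Type*} [NormedAddCommGroup F] [InnerProductSpace ℝ F]
    [RKHS ℝ F S ℝ] {l : ℕ} {lam : ℝ} {s : Fin l → S} {y : Fin l → ℝ} {f f₀ : F}
    (hf : IsMinOn (ridgeObjective lam s y) Set.univ f) :
    (l : ℝ)⁻¹ * ∑ i, (f - f₀) (s i) ^ 2 + lam * ‖f - f₀‖ ^ 2 ≤
      -(2 * ((l : ℝ)⁻¹ * ∑ i, (f₀ (s i) - y i) * (f - f₀) (s i))) -
        2 * (lam * inner ℝ f₀ (f - f₀)) := by
  have h : ridgeObjective lam s y f ≤ ridgeObjective lam s y f₀ := hf (Set.mem_univ f₀)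
  set d := f - f₀ with hd
  have hfd : f = f₀ + d := by rw [hd, add_sub_cancel]
  rw [hfd] at h
  simp only [ridgeObjective] at h
  have h1 : ∑ i, ((f₀ + d) (s i) - y i) ^ 2 = ∑ i, (f₀ (s i) - y i) ^ 2 +
      2 * ∑ i, (f₀ (s i) - y i) * d (s i) + ∑ i, d (s i) ^ 2 := by
    rw [Finset.mul_sum, ← Finset.sum_add_distrib, ← Finset.sum_add_distrib]
    refine Finset.sum_congr rfl fun i _ => ?_
    rw [apply_add]
    ring
  rw [h1, norm_add_sq_real] at h
  linarith

theorem abs_average_le {l : ℕ} (u v : Fin l → ℝ) (a : ℝ) (h : ∀ i, |u i| ≤ a * v i) :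
    |(l : ℝ)⁻¹ * ∑ i, u i| ≤ a * ((l : ℝ)⁻¹ * ∑ i, v i) := by
  rw [abs_mul, abs_of_nonneg (by positivity : (0 : ℝ) ≤ (l : ℝ)⁻¹), mul_left_comm]
  refine mul_le_mul_of_nonneg_left ?_ (by positivity)
  rw [Finset.mul_sum]
  exact (Finset.abs_sum_le_sum_abs _ _).trans (Finset.sum_le_sum fun i _ => h i)

section Energy

variable {S F : Type*} [NormedAddCommGroup F] [InnerProductSpace ℝ F] [CompleteSpace F]
  [RKHS ℝ F S ℝ]

theorem isMinOn_ridgeEstimator {l : ℕ} {lam : ℝ} (hlam : 0 < lam) (s : Fin l → S)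
    (y : Fin l → ℝ) : IsMinOn (ridgeObjective lam s y) Set.univ (ridgeEstimator F lam s y) :=
  Classical.epsilon_spec (p := fun f : F => IsMinOn (ridgeObjective lam s y) Set.univ f)
    (existsUnique_ridge hlam s y).exists

/-- The energy of the estimation error when the inputs `s` are observed as `s'`. -/
theorem energy_le {l : ℕ} {lam B C D ε₁ ε₂ q τ : ℝ} (hlam : 0 < lam)
    (hC : 0 ≤ C) (hB : ∀ s : S, kernelFun F s s ≤ B) {s s' : Fin l → S} {y : Fin l → ℝ}
    (hy : ∀ i, |y i| ≤ C) {f f₀ : F} (hf : IsMinOn (ridgeObjective lam s' y) Set.univ f)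
    (hD : (l : ℝ)⁻¹ * ∑ i, ‖feature F (s' i) - feature F (s i)‖ ≤ D)
    (hτ : 0 ≤ τ) (hq : q = τ + lam * ‖f - f₀‖ ^ 2)
    (h₁ : |(l : ℝ)⁻¹ * ∑ i, (f₀ (s i) - y i) * (f - f₀) (s i)| ≤ ε₁ * √q)
    (h₂ : |(l : ℝ)⁻¹ * ∑ i, (f - f₀) (s i) ^ 2 - τ| ≤ 1 / 4 * q)
    (h₃ : 8 * √B * D ≤ lam)
    (h₄ : lam * |inner ℝ f₀ (f - f₀)| ≤ ε₂ * √q) :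
    q ≤ 16 * (ε₁ + (C + 2 * √B * ‖f₀‖) * D / √lam + ε₂) ^ 2 := by
  have hbasic := basic_inequality (f₀ := f₀) hf
  set d := f - f₀
  set δ : Fin l → ℝ := fun i => ‖feature F (s' i) - feature F (s i)‖
  have hδ : ∀ i, 0 ≤ δ i := fun i => norm_nonneg _
  have hsB := Real.sqrt_nonneg B
  have hl : (0 : ℝ) ≤ (l : ℝ)⁻¹ := by positivity
  have hD0 : 0 ≤ D := (mul_nonneg hl (Finset.sum_nonneg fun i _ => hδ i)).trans hD
  -- The basic inequality holds at the observed inputs s', the probabilistic bounds at the true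
  -- inputs s. The passage from one to the other costs the averaged feature displacement D, here and
  -- for the squares in `hsq`.
  have hcross : |(l : ℝ)⁻¹ * ∑ i, ((f₀ (s' i) - y i) * d (s' i) - (f₀ (s i) - y i) * d (s i))| ≤
      ((C + 2 * √B * ‖f₀‖) * ‖d‖) * D := by
    refine (abs_average_le _ δ ((C + 2 * √B * ‖f₀‖) * ‖d‖) fun i => ?_).trans
      (mul_le_mul_of_nonneg_left hD (by positivity))
    have e : (f₀ (s' i) - y i) * d (s' i) - (f₀ (s i) - y i) * d (s i) =
        (f₀ (s' i) - y i) * (d (s' i) - d (s i)) + (f₀ (s' i) - f₀ (s i)) * d (s i) := by ring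
    rw [e]
    refine (abs_add_le _ _).trans ?_
    rw [abs_mul, abs_mul]
    have a1 : |f₀ (s' i) - y i| ≤ √B * ‖f₀‖ + C :=
      (abs_sub _ _).trans (add_le_add (abs_apply_le (hB _) _) (hy i))
    have a2 := abs_apply_sub_apply_le d (s' i) (s i)
    have a3 := abs_apply_sub_apply_le f₀ (s' i) (s i)
    have a4 := abs_apply_le (hB (s i)) d
    calc _ ≤ (√B * ‖f₀‖ + C) * (δ i * ‖d‖) + (δ i * ‖f₀‖) * (√B * ‖d‖) :=
          add_le_add (mul_le_mul a1 a2 (abs_nonneg _) (by positivity))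
            (mul_le_mul a3 a4 (abs_nonneg _) (by have := hδ i; positivity))
      _ = _ := by ring
  have hsq : |(l : ℝ)⁻¹ * ∑ i, (d (s' i) ^ 2 - d (s i) ^ 2)| ≤ (2 * √B * ‖d‖ ^ 2) * D := by
    refine (abs_average_le _ δ (2 * √B * ‖d‖ ^ 2) fun i => ?_).trans
      (mul_le_mul_of_nonneg_left hD (by positivity))
    have e : d (s' i) ^ 2 - d (s i) ^ 2 = (d (s' i) - d (s i)) * (d (s' i) + d (s i)) := by ring
    rw [e, abs_mul]
    have a2 := abs_apply_sub_apply_le d (s' i) (s i)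
    have a4 : |d (s' i) + d (s i)| ≤ √B * ‖d‖ + √B * ‖d‖ :=
      (abs_add_le _ _).trans (add_le_add (abs_apply_le (hB _) d) (abs_apply_le (hB _) d))
    calc _ ≤ (δ i * ‖d‖) * (√B * ‖d‖ + √B * ‖d‖) :=
          mul_le_mul a2 a4 (abs_nonneg _) (by have := hδ i; positivity)
      _ = _ := by ring
  rw [Finset.sum_sub_distrib, mul_sub] at hcross hsq
  have hq0 : 0 ≤ q := by rw [hq]; positivity
  set Q := √q
  have hQ : Q ^ 2 = q := Real.sq_sqrt hq0
  have hQ0 : 0 ≤ Q := Real.sqrt_nonneg _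
  have hdQ : ‖d‖ ≤ Q / √lam := by
    rw [le_div_iff₀ (Real.sqrt_pos.2 hlam)]
    refine Real.le_sqrt_of_sq_le ?_
    rw [mul_pow, Real.sq_sqrt hlam.le, hq]
    linarith
  have hcross' : ((C + 2 * √B * ‖f₀‖) * ‖d‖) * D ≤ (C + 2 * √B * ‖f₀‖) * D / √lam * Q := by
    calc _ = (C + 2 * √B * ‖f₀‖) * D * ‖d‖ := by ring
      _ ≤ (C + 2 * √B * ‖f₀‖) * D * (Q / √lam) := by gcongr
      _ = _ := by ring
  have hsq' : (2 * √B * ‖d‖ ^ 2) * D ≤ 1 / 4 * (lam * ‖d‖ ^ 2) := by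
    nlinarith [sq_nonneg ‖d‖]
  have hlow : lam * ‖d‖ ^ 2 ≤ q := by rw [hq]; linarith
  have h4' : -(lam * inner ℝ f₀ d) ≤ ε₂ * Q := by
    refine le_trans ?_ h₄
    rw [← mul_neg]
    exact mul_le_mul_of_nonneg_left (neg_le_abs _) hlam.le
  have b1 := abs_le.1 h₁
  have b2 := abs_le.1 h₂
  have b3 := abs_le.1 hcross
  have b4 := abs_le.1 hsq
  set W := ε₁ + (C + 2 * √B * ‖f₀‖) * D / √lam + ε₂ with hW
  -- The covariance deviation and the displacement of the squares each cost at most q/4; absorbing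
  -- them leaves q/2 ≤ 2 W √q.
  have hmain : q ≤ 4 * (W * Q) := by
    have : W * Q = ε₁ * Q + (C + 2 * √B * ‖f₀‖) * D / √lam * Q + ε₂ * Q := by rw [hW]; ring
    rw [this]
    linarith [b1.1, b1.2, b2.1, b2.2, b3.1, b3.2, b4.1, b4.2]
  nlinarith [sq_nonneg (Q - 4 * W)]

end Energy

/-! ### Weighted second moments of the noise and of the empirical covariance -/

theorem integral_comp_of_measurePreserving {Ω Ω' : Type*} [MeasurableSpace Ω] [MeasurableSpace Ω']
    {μ : Measure Ω} {μ' : Measure Ω'} {Φ : Ω → Ω'} (hΦ : MeasurePreserving Φ μ μ') {f : Ω' → ℝ}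
    (hf : AEStronglyMeasurable f μ') : ∫ x, f (Φ x) ∂μ = ∫ x, f x ∂μ' := by
  rw [← hΦ.map_eq] at hf ⊢
  exact (integral_map hΦ.measurable.aemeasurable hf).symm

section Moments

variable {S F : Type*} [NormedAddCommGroup F] [InnerProductSpace ℝ F] [CompleteSpace F]
  [RKHS ℝ F S ℝ] [TopologicalSpace S] [SecondCountableTopology S] [MeasurableSpace S]
  [OpensMeasurableSpace S] {ρ : Measure (S × ℝ)} [IsProbabilityMeasure ρ] {B : ℝ}
  {e : ℕ → F} {t : ℕ → ℝ} {b β lam : ℝ}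

/-- Since ∫ e_n² = ⟨T e_n, e_n⟩ = t_n, integrating termwise produces the effective dimension. -/
theorem lintegral_tsum_sq_le (hF : Continuous (feature F : S → F))
    (hB : ∀ s : S, kernelFun F s s ≤ B) (hT : IsSpectralDecomp (covOp F ρ) e t) (hb : 1 < b)
    (ht : ∀ n, 0 ≤ t n) (htβ : ∀ n : ℕ, ((n : ℝ) + 1) ^ b * t n ≤ β) (hlam : 0 < lam)
    (hlam1 : lam ≤ 1) :
    ∫⁻ p, ∑' n, ENNReal.ofReal ((t n + lam)⁻¹ * e n p.1 ^ 2) ∂ρ ≤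
      ENNReal.ofReal (effDimConst b β * lam ^ (-(1 / b))) := by
  have hm : ∀ n, Measurable fun p : S × ℝ => e n p.1 := fun n =>
    (continuous_apply_of_feature hF (e n)).measurable.comp measurable_fst
  rw [lintegral_tsum fun n => (((hm n).pow_const 2).const_mul _).ennreal_ofReal.aemeasurable]
  refine le_trans (ENNReal.tsum_le_tsum fun n => ?_) (tsum_div_add_le hb hlam hlam1 ht htβ)
  have hpos : 0 ≤ (t n + lam)⁻¹ := inv_nonneg.2 (by linarith [ht n])
  have hbd : ∀ p : S × ℝ, |e n p.1| ≤ √B * ‖e n‖ := fun p => abs_apply_le (hB p.1) (e n)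
  have hi : Integrable (fun p : S × ℝ => e n p.1 * e n p.1) ρ :=
    integrable_mul_of_bounds (hm n) (hm n) (ae_of_all _ hbd) (ae_of_all _ hbd)
  have hval : ∫ p, e n p.1 * e n p.1 ∂ρ = t n := by
    have hc := continuous_apply_of_feature hF (e n)
    rw [integral_fst_eq (u := fun s => e n s * e n s) (by fun_prop), ← inner_covOp hF hB, hT.inner_eq,
      if_pos rfl]
  simp_rw [sq]
  rw [← ofReal_integral_eq_lintegral_ofReal (hi.const_mul _)
    (ae_of_all _ fun p => mul_nonneg hpos (mul_self_nonneg _)), integral_const_mul, hval,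
    inv_mul_eq_div]

theorem lintegral_tsum_mul_sq_le (hF : Continuous (feature F : S → F))
    (hB : ∀ s : S, kernelFun F s s ≤ B) (hT : IsSpectralDecomp (covOp F ρ) e t) (hb : 1 < b)
    (ht : ∀ n, 0 ≤ t n) (htβ : ∀ n : ℕ, ((n : ℝ) + 1) ^ b * t n ≤ β) (hlam : 0 < lam)
    (hlam1 : lam ≤ 1) {u : S × ℝ → ℝ} {a : ℝ} (hu : ∀ᵐ p ∂ρ, |u p| ≤ a) :
    ∫⁻ p, ∑' n, ENNReal.ofReal ((t n + lam)⁻¹ * (u p * e n p.1) ^ 2) ∂ρ ≤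
      ENNReal.ofReal (a ^ 2 * (effDimConst b β * lam ^ (-(1 / b)))) := by
  rw [ENNReal.ofReal_mul (sq_nonneg a)]
  refine le_trans ?_ (mul_le_mul_right (lintegral_tsum_sq_le hF hB hT hb ht htβ hlam hlam1) _)
  rw [← lintegral_const_mul' _ _ ENNReal.ofReal_ne_top]
  refine lintegral_mono_ae ?_
  filter_upwards [hu] with p hp
  rw [← ENNReal.tsum_mul_left]
  refine ENNReal.tsum_le_tsum fun n => ?_
  rw [← ENNReal.ofReal_mul (sq_nonneg a)]
  refine ENNReal.ofReal_le_ofReal ?_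
  have hpos : 0 ≤ (t n + lam)⁻¹ := inv_nonneg.2 (by linarith [ht n])
  have : u p ^ 2 ≤ a ^ 2 := sq_le_sq' (abs_le.1 hp).1 (abs_le.1 hp).2
  calc (t n + lam)⁻¹ * (u p * e n p.1) ^ 2 = u p ^ 2 * ((t n + lam)⁻¹ * e n p.1 ^ 2) := by ring
    _ ≤ _ := mul_le_mul_of_nonneg_right this (mul_nonneg hpos (sq_nonneg _))

/-- Pointwise the double series is the square of ∑ e_n(s)²/(t_n + λ). One factor is at most B/λ by
Bessel's inequality for the feature at s; the other is integrated to the effective dimension. -/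
theorem lintegral_tsum_prod_sq_le (hF : Continuous (feature F : S → F))
    (hB : ∀ s : S, kernelFun F s s ≤ B) (hB0 : 0 ≤ B) (hT : IsSpectralDecomp (covOp F ρ) e t)
    (hb : 1 < b) (ht : ∀ n, 0 ≤ t n) (htβ : ∀ n : ℕ, ((n : ℝ) + 1) ^ b * t n ≤ β) (hlam : 0 < lam)
    (hlam1 : lam ≤ 1) :
    ∫⁻ p, ∑' k : ℕ × ℕ, ENNReal.ofReal (((t k.1 + lam)⁻¹ * (t k.2 + lam)⁻¹) *
      (e k.1 p.1 * e k.2 p.1) ^ 2) ∂ρ ≤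
      ENNReal.ofReal (B / lam * (effDimConst b β * lam ^ (-(1 / b)))) := by
  have hpos : ∀ n, 0 ≤ (t n + lam)⁻¹ := fun n => inv_nonneg.2 (by linarith [ht n])
  rw [ENNReal.ofReal_mul (by positivity)]
  refine le_trans ?_ (mul_le_mul_right (lintegral_tsum_sq_le hF hB hT hb ht htβ hlam hlam1) _)
  rw [← lintegral_const_mul' _ _ ENNReal.ofReal_ne_top]
  refine lintegral_mono fun p => ?_
  have h1 : ∑' n, ENNReal.ofReal ((t n + lam)⁻¹ * e n p.1 ^ 2) ≤ ENNReal.ofReal (B / lam) := by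
    refine ENNReal.tsum_le_of_sum_range_le fun K => ?_
    rw [← ENNReal.ofReal_sum_of_nonneg fun n _ => mul_nonneg (hpos n) (sq_nonneg _)]
    refine ENNReal.ofReal_le_ofReal ?_
    calc ∑ n ∈ Finset.range K, (t n + lam)⁻¹ * e n p.1 ^ 2
        ≤ ∑ n ∈ Finset.range K, lam⁻¹ * e n p.1 ^ 2 := by
          refine Finset.sum_le_sum fun n _ => mul_le_mul_of_nonneg_right ?_ (sq_nonneg _)
          exact inv_anti₀ hlam (by linarith [ht n])
      _ = lam⁻¹ * ∑ n ∈ Finset.range K, inner ℝ (e n) (feature F p.1) ^ 2 := by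
          rw [Finset.mul_sum]
          refine Finset.sum_congr rfl fun n _ => ?_
          rw [real_inner_comm, inner_feature]
      _ ≤ lam⁻¹ * B := by
          refine mul_le_mul_of_nonneg_left ?_ (by positivity)
          exact (sum_sq_inner_le hT.orthonormal _ _).trans ((norm_feature_sq p.1).trans_le (hB p.1))
      _ = B / lam := inv_mul_eq_div _ _
  refine le_of_eq_of_le ?_ (mul_le_mul_left h1 _)
  rw [ENNReal.tsum_prod', ← ENNReal.tsum_mul_right]
  refine tsum_congr fun n => ?_
  rw [← ENNReal.tsum_mul_left]
  refine tsum_congr fun m => ?_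
  rw [← ENNReal.ofReal_mul (mul_nonneg (hpos n) (sq_nonneg _))]
  congr 1
  ring

variable {Z : Type*} [MeasurableSpace Z] {ν : Measure Z} [IsProbabilityMeasure ν] {Φ : Z → S × ℝ}

/-- The averages are centred by `hmean`, so `measure_tsum_sq_average_sub_le` applies. The map Φ lets
the sample carry more data, namely the bags, than the pair (μ_x, y) that enters here. -/
theorem measure_noise_le (hF : Continuous (feature F : S → F))
    (hB : ∀ s : S, kernelFun F s s ≤ B) (hT : IsSpectralDecomp (covOp F ρ) e t) (hb : 1 < b)
    (ht : ∀ n, 0 ≤ t n) (htβ : ∀ n : ℕ, ((n : ℝ) + 1) ^ b * t n ≤ β) (hlam : 0 < lam)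
    (hlam1 : lam ≤ 1) (hΦ : MeasurePreserving Φ ν ρ) {u : S × ℝ → ℝ} (hum : Measurable u) {a : ℝ}
    (ha : 0 < a) (hβ : 0 ≤ β) (hu : ∀ᵐ p ∂ρ, |u p| ≤ a)
    (hmean : ∀ n, ∫ p, u p * e n p.1 ∂ρ = 0) {l : ℕ} (hl : 0 < l) {p : ℝ} (hp : 0 < p) :
    (Measure.pi fun _ : Fin l => ν) {z | ¬ ∀ s : Finset ℕ, ∑ n ∈ s, (t n + lam)⁻¹ *
      ((l : ℝ)⁻¹ * ∑ i, u (Φ (z i)) * e n (Φ (z i)).1) ^ 2 ≤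
        a ^ 2 * (effDimConst b β * lam ^ (-(1 / b))) / (l * p)} ≤ ENNReal.ofReal p := by
  have hpos : ∀ n, 0 ≤ (t n + lam)⁻¹ := fun n => inv_nonneg.2 (by linarith [ht n])
  have hm : ∀ n, Measurable fun p : S × ℝ => e n p.1 := fun n =>
    (continuous_apply_of_feature hF (e n)).measurable.comp measurable_fst
  have hD : 0 < effDimConst b β := by
    rw [effDimConst]
    have : 0 < b - 1 := by linarith
    positivity
  have hmem : ∀ n, MemLp (fun p : S × ℝ => u p * e n p.1) 2 ρ := fun n => by
    refine MemLp.of_bound (hum.mul (hm n)).aestronglyMeasurable (a * (√B * ‖e n‖)) ?_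
    filter_upwards [hu] with p hp
    rw [Real.norm_eq_abs, abs_mul]
    exact mul_le_mul hp (abs_apply_le (hB _) _) (abs_nonneg _) ha.le
  have hint : ∫⁻ z, ∑' n, ENNReal.ofReal ((t n + lam)⁻¹ * (u (Φ z) * e n (Φ z).1) ^ 2) ∂ν ≤
      ENNReal.ofReal (a ^ 2 * (effDimConst b β * lam ^ (-(1 / b)))) := by
    refine le_of_eq_of_le ?_ (lintegral_tsum_mul_sq_le hF hB hT hb ht htβ hlam hlam1 hu)
    exact hΦ.lintegral_comp (f := fun p => ∑' n, ENNReal.ofReal ((t n + lam)⁻¹ * (u p * e n p.1) ^ 2))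
      (Measurable.tsum fun n => (((hum.mul (hm n)).pow_const 2).const_mul _).ennreal_ofReal)
  have h := measure_tsum_sq_average_sub_le (ν := ν) (f := fun n z => u (Φ z) * e n (Φ z).1)
    (fun n => (hmem n).comp_measurePreserving hΦ) hpos hl (by positivity) hp hint
  have h0 : ∀ n, ∫ z, u (Φ z) * e n (Φ z).1 ∂ν = 0 := fun n => by
    rw [← hmean n]
    exact integral_comp_of_measurePreserving hΦ (hmem n).aestronglyMeasurable
  simpa only [h0, sub_zero] using h

/-- The statistic is the squared Hilbert–Schmidt norm, on the span of (e_n), of the empirical minus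
the true covariance, multiplied by (T + λ)^(-1/2) on both sides. -/
theorem measure_covariance_le (hF : Continuous (feature F : S → F))
    (hB : ∀ s : S, kernelFun F s s ≤ B) (hB0 : 0 < B) (hT : IsSpectralDecomp (covOp F ρ) e t)
    (hb : 1 < b) (ht : ∀ n, 0 ≤ t n) (htβ : ∀ n : ℕ, ((n : ℝ) + 1) ^ b * t n ≤ β) (hβ : 0 ≤ β)
    (hlam : 0 < lam) (hlam1 : lam ≤ 1) (hΦ : MeasurePreserving Φ ν ρ)
    {l : ℕ} (hl : 0 < l) {p : ℝ} (hp : 0 < p) :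
    (Measure.pi fun _ : Fin l => ν) {z | ¬ ∀ s : Finset (ℕ × ℕ), ∑ k ∈ s,
      ((t k.1 + lam)⁻¹ * (t k.2 + lam)⁻¹) * ((l : ℝ)⁻¹ * ∑ i, e k.1 (Φ (z i)).1 * e k.2 (Φ (z i)).1 -
        inner ℝ (covOp F ρ (e k.1)) (e k.2)) ^ 2 ≤
        B / lam * (effDimConst b β * lam ^ (-(1 / b))) / (l * p)} ≤ ENNReal.ofReal p := by
  have hpos : ∀ n, 0 ≤ (t n + lam)⁻¹ := fun n => inv_nonneg.2 (by linarith [ht n])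
  have hc := fun n => continuous_apply_of_feature hF (e n)
  have hm : ∀ n, Measurable fun p : S × ℝ => e n p.1 := fun n =>
    (hc n).measurable.comp measurable_fst
  have hD : 0 < effDimConst b β := by
    rw [effDimConst]
    have : 0 < b - 1 := by linarith
    positivity
  have hmem : ∀ k : ℕ × ℕ, MemLp (fun p : S × ℝ => e k.1 p.1 * e k.2 p.1) 2 ρ := fun k => by
    refine MemLp.of_bound ((hm k.1).mul (hm k.2)).aestronglyMeasurable
      ((√B * ‖e k.1‖) * (√B * ‖e k.2‖)) (ae_of_all _ fun p => ?_)
    rw [Real.norm_eq_abs, abs_mul]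
    exact mul_le_mul (abs_apply_le (hB _) _) (abs_apply_le (hB _) _) (abs_nonneg _) (by positivity)
  have hint : ∫⁻ z, ∑' k : ℕ × ℕ, ENNReal.ofReal (((t k.1 + lam)⁻¹ * (t k.2 + lam)⁻¹) *
      (e k.1 (Φ z).1 * e k.2 (Φ z).1) ^ 2) ∂ν ≤
      ENNReal.ofReal (B / lam * (effDimConst b β * lam ^ (-(1 / b)))) := by
    refine le_of_eq_of_le ?_ (lintegral_tsum_prod_sq_le hF hB hB0.le hT hb ht htβ hlam hlam1)
    exact hΦ.lintegral_comp (f := fun p => ∑' k : ℕ × ℕ, ENNReal.ofReal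
      (((t k.1 + lam)⁻¹ * (t k.2 + lam)⁻¹) * (e k.1 p.1 * e k.2 p.1) ^ 2))
      (Measurable.tsum fun k => by fun_prop)
  have h := measure_tsum_sq_average_sub_le (ν := ν)
    (f := fun (k : ℕ × ℕ) z => e k.1 (Φ z).1 * e k.2 (Φ z).1)
    (fun k => (hmem k).comp_measurePreserving hΦ) (fun k => mul_nonneg (hpos k.1) (hpos k.2)) hl
    (by positivity) hp hint
  have h0 : ∀ k : ℕ × ℕ, ∫ z, e k.1 (Φ z).1 * e k.2 (Φ z).1 ∂ν =
      inner ℝ (covOp F ρ (e k.1)) (e k.2) := fun k => by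
    have h1 := hc k.1
    have h2 := hc k.2
    rw [inner_covOp hF hB, ← integral_fst_eq (u := fun s => e k.1 s * e k.2 s) (by fun_prop)]
    exact integral_comp_of_measurePreserving hΦ (hmem k).aestronglyMeasurable
  simpa only [h0] using h

end Moments

/-! ### The tail bound -/

theorem continuous_feature_of_holder {E F : Type*} [NormedAddCommGroup E] [NormedAddCommGroup F]
    [InnerProductSpace ℝ F] [CompleteSpace F] {D : Set E} [RKHS ℝ F D ℝ] {L h : ℝ} (hh : 0 < h)
    (hK : ∀ m m' : D, ‖feature F m - feature F m'‖ ≤ L * ‖(m : E) - (m' : E)‖ ^ h) :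
    Continuous (feature F : D → F) := by
  refine continuous_iff_continuousAt.2 fun m => ?_
  rw [ContinuousAt, tendsto_iff_norm_sub_tendsto_zero]
  have hc : Continuous fun m' : D => L * ‖(m' : E) - (m : E)‖ ^ h := by
    refine continuous_const.mul (Continuous.rpow_const ?_ fun _ => Or.inr hh.le)
    fun_prop
  have h0 := hc.tendsto m
  rw [sub_self, norm_zero, Real.zero_rpow hh.ne', mul_zero] at h0
  exact squeeze_zero (fun _ => norm_nonneg _) (fun m' => hK m' m) h0

/-- Powers of exponent at most one in terms of squares, at the scale `N ^ (-1/2)`. -/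
theorem rpow_le_mul_one_add {h x N : ℝ} (hh0 : 0 < h) (hh1 : h ≤ 1) (hx : 0 ≤ x) (hN : 0 < N) :
    x ^ h ≤ N ^ (-(h / 2)) * (1 + N * x ^ 2) := by
  have e : x ^ h = N ^ (-(h / 2)) * (N * x ^ 2) ^ (h / 2) := by
    rw [Real.mul_rpow hN.le (sq_nonneg x), ← mul_assoc, ← Real.rpow_add hN, neg_add_cancel,
      Real.rpow_zero, one_mul, ← Real.rpow_natCast, ← Real.rpow_mul hx]
    congr 1
    push_cast
    ring
  rw [e]
  refine mul_le_mul_of_nonneg_left ?_ (by positivity)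
  have h0 : 0 ≤ N * x ^ 2 := by positivity
  calc (N * x ^ 2) ^ (h / 2) ≤ (1 + N * x ^ 2) ^ (h / 2) :=
        Real.rpow_le_rpow h0 (by linarith) (by linarith)
    _ ≤ (1 + N * x ^ 2) ^ (1 : ℝ) := Real.rpow_le_rpow_of_exponent_le (by linarith) (by linarith)
    _ = _ := Real.rpow_one _

theorem add_add_sq_le (x y z : ℝ) : (x + y + z) ^ 2 ≤ 3 * (x ^ 2 + y ^ 2 + z ^ 2) := by
  nlinarith [sq_nonneg (x - y), sq_nonneg (y - z), sq_nonneg (x - z)]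

/-- Union bound for outer measures. The event `a` need not be measurable, so no measurability of the
estimator has to be established. -/
theorem measure_le_three_mul {Ω : Type*} [MeasurableSpace Ω] {μ : Measure Ω}
    {q₁ q₂ q₃ G a : Ω → Prop} {p : ℝ} (hp : 0 ≤ p) (h₁ : μ {z | ¬ q₁ z} ≤ ENNReal.ofReal p)
    (h₂ : μ {z | ¬ q₂ z} ≤ ENNReal.ofReal p) (h₃ : μ {z | ¬ q₃ z} ≤ ENNReal.ofReal p)
    (hG : ∀ᵐ z ∂μ, G z) (h : ∀ z, G z → q₁ z → q₂ z → q₃ z → ¬ a z) :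
    μ {z | a z} ≤ ENNReal.ofReal (3 * p) := by
  have hsub : {z | a z} ⊆ (({z | ¬ q₁ z} ∪ {z | ¬ q₂ z}) ∪ {z | ¬ q₃ z}) ∪ {z | ¬ G z} := by
    intro z hz
    have := h z
    simp only [Set.mem_union, Set.mem_ofPred_eq] at hz ⊢
    tauto
  calc μ {z | a z} ≤ μ {z | ¬ q₁ z} + μ {z | ¬ q₂ z} + μ {z | ¬ q₃ z} + μ {z | ¬ G z} :=
        (measure_mono hsub).trans ((measure_union_le _ _).trans (add_le_add_left
          ((measure_union_le _ _).trans (add_le_add_left (measure_union_le _ _) _)) _))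
    _ ≤ ENNReal.ofReal p + ENNReal.ofReal p + ENNReal.ofReal p + 0 := by
        gcongr
        exact (ae_iff.1 hG).le
    _ = _ := by
        rw [add_zero, ← ENNReal.ofReal_add hp hp, ← ENNReal.ofReal_add (by linarith) hp]
        congr 1
        ring

/-- Bound of the norm of the target function. -/
noncomputable def Params.normBound (P : Params) : ℝ := (max 1 P.β + 1) * √P.R

/-- Bound of the residuals of the target function. -/
noncomputable def Params.residualBound (P : Params) : ℝ := √P.BK * P.normBound + P.C

/-- Constant in the bound of the averaged error of the bags, at confidence `1 - p`. -/
noncomputable def Params.bagConst (P : Params) (p : ℝ) : ℝ := P.L * (1 + P.Bk / p)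

/-- The three contributions to the excess risk: noise, second sampling stage, regularization. -/
noncomputable def Params.excessBound (P : Params) (p l N lam : ℝ) : ℝ :=
  48 * (P.residualBound ^ 2 * (effDimConst P.b P.β * lam ^ (-(1 / P.b))) / (l * p) +
    ((P.C + 2 * √P.BK * P.normBound) * (P.bagConst p * N ^ (-(P.h / 2))) / √lam) ^ 2 +
    4 * P.R * lam ^ P.c)

section

variable {P : Params} {X : Type*} [TopologicalSpace X] [TopologicalSpace.SeparableSpace X]
  [MeasurableSpace X] [BorelSpace X]
  {H : Type*} [NormedAddCommGroup H] [InnerProductSpace ℝ H] [CompleteSpace H]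
  [RKHS ℝ H X ℝ] [MeasurableSpace H] [BorelSpace H]
  {F : Type*} [NormedAddCommGroup F] [InnerProductSpace ℝ F] [CompleteSpace F]
  [RKHS ℝ F (Embedded H) ℝ]
  {Q : Measure (ProbabilityMeasure X × ℝ)} [IsProbabilityMeasure Q] {fH : F}

/-- N times the squared embedding error of a bag has mean at most B_k. Hölder continuity and
`rpow_le_mul_one_add` reduce the feature error to this quantity at scale N^(-h/2), and Markov's
inequality handles the average over the l bags without a union bound over i. -/
theorem Model.measure_bags_le (hP : P.Admissible) (hM : Model P Q fH) {l N : ℕ} [NeZero N]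
    (hl : 0 < l) {p : ℝ} (hp : 0 < p) :
    sampleLaw Q l N {z | ¬ (l : ℝ)⁻¹ * ∑ i, ‖feature F (embed H (empirical (z i).2)) -
      feature F (embed H (z i).1.1)‖ ≤ P.bagConst p * (N : ℝ) ^ (-(P.h / 2))} ≤
      ENNReal.ofReal p := by
  have hk := continuous_feature_of_kernelFun hM.k_cont
  have : TopologicalSpace.SeparableSpace H := separableSpace_of_continuous_feature hk
  have : SecondCountableTopology H := UniformSpace.secondCountable_of_separable H
  have hN : (0 : ℝ) < N := by exact_mod_cast NeZero.pos N
  have hl' : (0 : ℝ) < l := by exact_mod_cast hl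
  have hbag := lintegral_norm_sq_embed_sub_le hk hM.k_bdd Q (N := N)
  set g : (ProbabilityMeasure X × ℝ) × (Fin N → X) → ℝ := fun z =>
    N * ‖(embed H (empirical z.2) : H) - embed H z.1.1‖ ^ 2 with hg
  have hm1 := measurable_subtype_coe.comp (measurable_embed_empirical hk (N := N))
  have hm2 := measurable_subtype_coe.comp (measurable_embed hk)
  have hgm : Measurable g :=
    ((((hm1.comp measurable_snd).sub
      (hm2.comp (measurable_fst.comp measurable_fst))).norm).pow_const 2).const_mul _
  have hgi : ∫⁻ z, ENNReal.ofReal (g z) ∂(Q ⊗ₘ bagKernel N) ≤ ENNReal.ofReal P.Bk := by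
    simp_rw [hg, ENNReal.ofReal_mul hN.le]
    rw [lintegral_const_mul' _ _ ENNReal.ofReal_ne_top]
    refine (mul_le_mul_right hbag _).trans (le_of_eq ?_)
    rw [← ENNReal.ofReal_mul hN.le]
    congr 1
    field_simp
  refine le_trans (measure_mono ?_)
    (measure_average_le hgm (fun z => by positivity) hl hP.Bk_pos hp hgi)
  intro z hz
  rw [Set.mem_ofPred_eq] at hz ⊢
  contrapose! hz
  have hLN : 0 ≤ P.L * (N : ℝ) ^ (-(P.h / 2)) := mul_nonneg hP.L_pos.le (by positivity)
  calc (l : ℝ)⁻¹ * ∑ i, ‖feature F (embed H (empirical (z i).2)) - feature F (embed H (z i).1.1)‖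
      ≤ (l : ℝ)⁻¹ * ∑ i, P.L * (N : ℝ) ^ (-(P.h / 2)) * (1 + g (z i)) := by
        refine mul_le_mul_of_nonneg_left (Finset.sum_le_sum fun i _ => ?_) (by positivity)
        refine (hM.K_holder _ _).trans ?_
        rw [mul_assoc]
        exact mul_le_mul_of_nonneg_left
          (rpow_le_mul_one_add hP.h_pos hP.h_le (norm_nonneg _) hN) hP.L_pos.le
    _ = P.L * (N : ℝ) ^ (-(P.h / 2)) * (1 + (l : ℝ)⁻¹ * ∑ i, g (z i)) := by
        rw [← Finset.mul_sum, Finset.sum_add_distrib]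
        simp only [Finset.sum_const, Finset.card_univ, Fintype.card_fin, nsmul_eq_mul, mul_one]
        field_simp
    _ ≤ P.L * (N : ℝ) ^ (-(P.h / 2)) * (1 + P.Bk / p) := by gcongr
    _ = _ := by rw [Params.bagConst]; ring

/-- Outside three events of probability at most p each, for noise, covariance and bags, the
deterministic bound `energy_le` applies. The hypothesis h₂ makes the covariance deviation at most
q/4, and h₃ bounds the bag error relative to λ. -/
theorem Model.measure_excess_le (hP : P.Admissible) (hM : Model P Q fH) {l N : ℕ} [NeZero N]
    (hl : 0 < l) {lam p : ℝ} (hp : 0 < p) (hlam : 0 < lam) (hlam1 : lam ≤ 1)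
    (h₂ : P.BK / lam * (effDimConst P.b P.β * lam ^ (-(1 / P.b))) / (l * p) ≤ (1 / 4) ^ 2)
    (h₃ : 8 * √P.BK * (P.bagConst p * (N : ℝ) ^ (-(P.h / 2))) ≤ lam) :
    sampleLaw Q l N {z | P.excessBound p l N lam <
      risk (embeddedLaw H Q) (merr F lam z) - risk (embeddedLaw H Q) fH} ≤
      ENNReal.ofReal (3 * p) := by
  have hk := continuous_feature_of_kernelFun hM.k_cont
  have : TopologicalSpace.SeparableSpace H := separableSpace_of_continuous_feature hk
  have : SecondCountableTopology H := UniformSpace.secondCountable_of_separable H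
  have hF := continuous_feature_of_holder hP.h_pos hM.K_holder
  have : TopologicalSpace.SeparableSpace F := separableSpace_of_continuous_feature hF
  have hB := hM.K_bdd
  set ρ := embeddedLaw H Q with hρ
  set ν := Q ⊗ₘ bagKernel N with hν
  have hψ : Measurable fun p : ProbabilityMeasure X × ℝ => (embed H p.1, p.2) :=
    ((measurable_embed hk).comp measurable_fst).prodMk measurable_snd
  have : IsProbabilityMeasure ρ := Measure.isProbabilityMeasure_map hψ.aemeasurable
  have hψρ : MeasurePreserving (fun p : ProbabilityMeasure X × ℝ => (embed H p.1, p.2)) Q ρ :=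
    ⟨hψ, rfl⟩
  have hfst : MeasurePreserving Prod.fst ν Q := ⟨measurable_fst, Measure.fst_compProd _ _⟩
  set Φ : (ProbabilityMeasure X × ℝ) × (Fin N → X) → Embedded H × ℝ :=
    fun z => (embed H z.1.1, z.1.2) with hΦdef
  have hΦ : MeasurePreserving Φ ν ρ := hψρ.comp hfst
  have hC : ∀ᵐ p ∂ρ, |p.2| ≤ P.C := by
    have hs : MeasurableSet {p : Embedded H × ℝ | |p.2| ≤ P.C} :=
      measurableSet_le (by fun_prop) measurable_const
    exact (ae_map_iff hψ.aemeasurable hs).2 hM.label_bdd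
  obtain ⟨e, t, g, hT, ht, hg, hpow⟩ := hM.prior.source
  have hmin := hM.prior.isMin
  have hb := hP.one_lt_b
  have ht0 : ∀ n, 0 ≤ t n := fun n => by
    have h1 := hP.α_pos.trans_le (ht n).1
    exact (pos_of_mul_pos_right h1 (by positivity)).le
  have htβ : ∀ n : ℕ, ((n : ℝ) + 1) ^ P.b * t n ≤ P.β := fun n => (ht n).2
  have htβ' : ∀ n, t n ≤ P.β := fun n => by
    refine le_trans ?_ (htβ n)
    refine le_mul_of_one_le_left (ht0 n) (Real.one_le_rpow ?_ (by linarith))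
    linarith [(Nat.cast_nonneg n : (0 : ℝ) ≤ n)]
  have hgR : ‖g‖ ≤ √P.R := Real.le_sqrt_of_sq_le hg
  have hfH : ‖fH‖ ≤ P.normBound := by
    refine (hpow.norm_le hT.orthonormal ht0 htβ' ?_ ?_).trans ?_
    · linarith [hP.one_le_c]
    · linarith [hP.c_le_two]
    · exact mul_le_mul_of_nonneg_left hgR (by positivity)
  have hK0 : 0 ≤ P.normBound := (norm_nonneg _).trans hfH
  have hres : ∀ᵐ p ∂ρ, |fH p.1 - p.2| ≤ P.residualBound := by
    filter_upwards [ae_abs_sub_label_le hB hC fH] with p hp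
    refine hp.trans ?_
    rw [Params.residualBound]
    gcongr
  have hres0 : 0 < P.residualBound := by
    have := hP.C_pos
    rw [Params.residualBound]
    positivity
  have hum : Measurable fun p : Embedded H × ℝ => fH p.1 - p.2 :=
    ((continuous_apply_of_feature hF fH).measurable.comp measurable_fst).sub measurable_snd
  have hmean : ∀ n, ∫ p, (fH p.1 - p.2) * e n p.1 ∂ρ = 0 := fun n =>
    integral_residual_mul_eq_zero hF hB hC hmin (e n)
  have E1 := measure_noise_le hF hB hT hb ht0 htβ hlam hlam1 hΦ hum hres0 hP.β_pos.le hres hmean hl hp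
  have E2 := measure_covariance_le hF hB hP.BK_pos hT hb ht0 htβ hP.β_pos.le hlam hlam1 hΦ hl hp
  have E3 := hM.measure_bags_le hP (N := N) hl hp
  have hnull : ∀ᵐ z ∂(sampleLaw Q l N), ∀ i, ExpandsAt e (Φ (z i)).1 ∧ |(Φ (z i)).2| ≤ P.C := by
    refine ae_all_iff.2 fun i => ?_
    have h1 : ∀ᵐ p ∂ρ, ExpandsAt e p.1 :=
      measurable_fst.quasiMeasurePreserving ρ |>.ae (ae_expandsAt hF hB hT)
    have h2 := hΦ.quasiMeasurePreserving.ae (h1.and hC)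
    exact (measurePreserving_eval (fun _ : Fin l => ν) i).quasiMeasurePreserving.ae h2
  refine measure_le_three_mul hp.le (by exact E1) (by exact E2) E3 hnull fun z hz q1 q2 q3 => ?_
  have hex : ∀ i, ExpandsAt e (embed H (z i).1.1) := fun i => (hz i).1
  set f := merr F lam z with hf
  have hd := risk_sub_risk_eq hF hB hC hmin f
  have hτ : 0 ≤ inner ℝ (covOp F ρ (f - fH)) (f - fH) :=
    (hT.hasSum_inner _).nonneg fun n => mul_nonneg (ht0 n) (sq_nonneg _)
  have n1 := abs_average_mul_apply_le hT ht0 hlam hex _ q1 (f - fH)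
  have n2 := abs_average_sq_apply_sub_le hT ht0 hlam hex q2 (f - fH)
  have n4 := IsPowApply.mul_abs_inner_le hT hpow ht0 hP.one_le_c hP.c_le_two hlam (f - fH)
  set q := inner ℝ (covOp F ρ (f - fH)) (f - fH) + lam * ‖f - fH‖ ^ 2 with hq
  have hq0 : 0 ≤ q := by positivity
  have n2' : √(P.BK / lam * (effDimConst P.b P.β * lam ^ (-(1 / P.b))) / (l * p)) ≤ 1 / 4 :=
    (Real.sqrt_le_sqrt h₂).trans_eq (Real.sqrt_sq (by norm_num))
  have hen := energy_le (f := f) (f₀ := fH) hlam hP.C_pos.le hB (fun i => (hz i).2)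
    (isMinOn_ridgeEstimator hlam _ _) q3 hτ hq n1
    (n2.trans (mul_le_mul_of_nonneg_right n2' hq0)) h₃
    (ε₂ := 2 * (lam ^ (P.c / 2) * ‖g‖)) (n4.trans_eq (by ring))
  have hD0 : 0 < effDimConst P.b P.β := by
    have h1 : 0 < P.b - 1 := by linarith
    have h2 := hP.β_pos
    rw [effDimConst]
    positivity
  rw [not_lt, hd]
  -- The excess risk is the energy without its nonnegative part λ‖d‖².
  refine (le_add_of_nonneg_right (by positivity)).trans (hen.trans ?_)
  refine (mul_le_mul_of_nonneg_left (add_add_sq_le _ _ _) (by norm_num)).trans ?_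
  rw [Params.excessBound, ← mul_assoc, show (16 : ℝ) * 3 = 48 by norm_num]
  have hL := hP.L_pos
  have hBk := hP.Bk_pos
  have hCp := hP.C_pos
  have hb0 : 0 ≤ P.bagConst p := by rw [Params.bagConst]; positivity
  gcongr
  · rw [Real.sq_sqrt (by positivity)]
  · rw [mul_pow, mul_pow]
    have e3 : (lam ^ (P.c / 2)) ^ 2 = lam ^ P.c := by
      rw [← Real.rpow_natCast, ← Real.rpow_mul hlam.le]
      congr 1
      push_cast
      ring
    rw [e3]
    have := Real.rpow_nonneg hlam.le P.c
    nlinarith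

end


theorem TailBound.mono {P : Params} {l N : ℕ} [NeZero N] {lam ε ε' p p' : ℝ}
    (h : TailBound.{u, v, w} P l N lam ε p) (hε : ε ≤ ε') (hp : p ≤ p') :
    TailBound.{u, v, w} P l N lam ε' p' := by
  intro X _ _ _ _ H _ _ _ _ _ _ F _ _ _ _ Q _ fH hM
  refine le_trans (measure_mono fun z hz => ?_) ((h X H F Q fH hM).trans (ENNReal.ofReal_le_ofReal hp))
  rw [Set.mem_ofPred_eq] at hz ⊢
  exact hε.trans_lt hz

theorem exists_tailBound {P : Params} (hP : P.Admissible) {p : ℝ} (hp : 0 < p) :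
    ∃ A κ : ℝ, 0 < A ∧ 0 < κ ∧ ∀ (l N : ℕ) [NeZero N] (lam : ℝ), 0 < l → 0 < lam → lam ≤ 1 →
      κ * lam ^ (-(1 / P.b) - 1) ≤ l → κ ≤ (N : ℝ) ^ P.h * lam ^ 2 →
      TailBound.{u, v, w} P l N lam
        (A * (1 / ((N : ℝ) ^ P.h * lam) + lam ^ P.c + 1 / (l * lam ^ (1 / P.b)))) p := by
  have hL := hP.L_pos
  have hBk := hP.Bk_pos
  have hBK := hP.BK_pos
  have hC := hP.C_pos
  have hR := hP.R_pos
  have hβ := hP.β_pos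
  have hb := hP.one_lt_b
  have hD : 0 < effDimConst P.b P.β := by
    have h1 : 0 < P.b - 1 := by linarith
    rw [effDimConst]
    positivity
  have hV : 0 < P.bagConst (p / 3) := by rw [Params.bagConst]; positivity
  set D := effDimConst P.b P.β
  set V := P.bagConst (p / 3)
  set G := P.C + 2 * √P.BK * P.normBound
  set A₁ := 3 * P.residualBound ^ 2 * D / p with hA₁
  have hA₁0 : 0 ≤ A₁ := by positivity
  -- Each event gets probability p/3. The two summands of κ are the thresholds for the covariance
  -- condition (48 = 16 · 3) and for the squared bag condition; both are nonnegative, so their sum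
  -- serves for either.
  refine ⟨48 * (A₁ + (G * V) ^ 2 + 4 * P.R), 48 * P.BK * D / p + (8 * √P.BK * V) ^ 2,
    by positivity, by positivity, ?_⟩
  intro l N _ lam hl hlam hlam1 hκl hκN X _ _ _ _ H _ _ _ _ _ _ F _ _ _ _ Q _ fH hM
  have hl' : (0 : ℝ) < l := by exact_mod_cast hl
  have hN : (0 : ℝ) < N := by exact_mod_cast NeZero.pos N
  have hx : 0 < lam ^ (1 / P.b) := Real.rpow_pos_of_pos hlam _
  have ha : 0 ≤ 48 * P.BK * D / p := by positivity
  have hb : 0 ≤ (8 * √P.BK * V) ^ 2 := by positivity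
  have hNh : 0 < (N : ℝ) ^ P.h := Real.rpow_pos_of_pos hN _
  have eneg : lam ^ (-(1 / P.b)) = (lam ^ (1 / P.b))⁻¹ := Real.rpow_neg hlam.le _
  have eN : ((N : ℝ) ^ (-(P.h / 2))) ^ 2 = ((N : ℝ) ^ P.h)⁻¹ := by
    rw [← Real.rpow_natCast, ← Real.rpow_mul hN.le, ← Real.rpow_neg hN.le]
    congr 1
    push_cast
    ring
  have h := hM.measure_excess_le hP (N := N) hl (p := p / 3) (by positivity) hlam hlam1 ?_ ?_
  · rw [show 3 * (p / 3) = p by ring] at h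
    refine le_trans (measure_mono fun z hz => ?_) h
    rw [Set.mem_ofPred_eq] at hz ⊢
    refine lt_of_le_of_lt ?_ hz
    rw [Params.excessBound, mul_assoc 48 (A₁ + _ + _)]
    refine mul_le_mul_of_nonneg_left ?_ (by norm_num)
    have e1 : P.residualBound ^ 2 * (D * lam ^ (-(1 / P.b))) / (l * (p / 3)) =
        A₁ * (1 / (l * lam ^ (1 / P.b))) := by
      rw [eneg, hA₁]
      field_simp
    have e2 : (G * (V * (N : ℝ) ^ (-(P.h / 2))) / √lam) ^ 2 =
        (G * V) ^ 2 * (1 / ((N : ℝ) ^ P.h * lam)) := by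
      rw [div_pow, Real.sq_sqrt hlam.le, ← mul_assoc, mul_pow, eN]
      field_simp
    rw [e1, e2]
    have p1 : 0 ≤ 1 / (l * lam ^ (1 / P.b)) := by positivity
    have p2 : 0 ≤ 1 / ((N : ℝ) ^ P.h * lam) := by positivity
    have p3 : 0 ≤ lam ^ P.c := by positivity
    have p4 : 0 ≤ (G * V) ^ 2 := sq_nonneg _
    nlinarith [mul_nonneg hA₁0 p2, mul_nonneg hA₁0 p3, mul_nonneg p4 p1, mul_nonneg p4 p3,
      mul_nonneg hR.le p1, mul_nonneg hR.le p2]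
  · have h1 : 48 * P.BK * D / p * lam ^ (-(1 / P.b) - 1) ≤ l := by
      refine le_trans (mul_le_mul_of_nonneg_right ?_ (by positivity)) hκl
      linarith
    rw [Real.rpow_sub_one hlam.ne'] at h1
    rw [div_le_iff₀ (by positivity)]
    have e1 : P.BK / lam * (D * lam ^ (-(1 / P.b))) =
        p / 48 * (48 * P.BK * D / p * (lam ^ (-(1 / P.b)) / lam)) := by
      field_simp
    rw [e1]
    nlinarith
  · have h1 : (8 * √P.BK * V) ^ 2 ≤ (N : ℝ) ^ P.h * lam ^ 2 := by linarith
    refine abs_le_of_sq_le_sq' ?_ hlam.le |>.2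
    rw [← mul_assoc, mul_pow, eN, ← div_eq_mul_inv, div_le_iff₀ hNh]
    linarith

/-! ### From the tail bound to rates expressed through `r` -/

theorem rTerm_zero (P : Params) (l N lam : ℝ) :
    rTerm P l N lam 0 = Real.log l ^ P.h / (N ^ P.h * lam ^ 3) := rfl

theorem rTerm_one (P : Params) (l N lam : ℝ) : rTerm P l N lam 1 = lam ^ P.c := rfl

theorem rTerm_three (P : Params) (l N lam : ℝ) :
    rTerm P l N lam 3 = 1 / (l * lam ^ (1 / P.b)) := rfl

theorem rTerm_nonneg (P : Params) {l N lam : ℝ} (hl : 1 ≤ l) (hN : 0 ≤ N) (hlam : 0 ≤ lam)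
    (i : Fin 4) : 0 ≤ rTerm P l N lam i := by
  have := Real.log_nonneg hl
  fin_cases i
  · change 0 ≤ Real.log l ^ P.h / (N ^ P.h * lam ^ 3)
    positivity
  · change 0 ≤ lam ^ P.c
    positivity
  · change 0 ≤ 1 / (l ^ 2 * lam)
    positivity
  · change 0 ≤ 1 / (l * lam ^ (1 / P.b))
    positivity

theorem rTerm_le_r (P : Params) {l N lam : ℝ} (hl : 1 ≤ l) (hN : 0 ≤ N) (hlam : 0 ≤ lam)
    (i : Fin 4) : rTerm P l N lam i ≤ r P l N lam :=
  Finset.single_le_sum (fun j _ => rTerm_nonneg P hl hN hlam j) (Finset.mem_univ i)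

variable {P : Params} {l : ℕ → ℕ} {lam : ℕ → ℝ}

/-- Smallness of r supplies the hypotheses of `exists_tailBound`: λ^c < 1 gives λ ≤ 1, and log l ≥ 1
makes the first term of r at least 1/(N^h λ³). The latter yields κ ≤ N^h λ² and bounds 1/(N^h λ). -/
theorem Converges.hasRate (hP : P.Admissible) (hl : Tendsto (fun N => (l N : ℝ)) atTop atTop)
    (hlam : ∀ᶠ N in atTop, 0 < lam N) (h : Converges P l lam) :
    HasRate.{u, v, w} P l lam (fun N => r P (l N) N (lam N)) := by
  intro η δ hη _ _
  obtain ⟨A, κ, hA, hκ, hT⟩ := exists_tailBound.{u, v, w} hP (p := η + Real.exp (-δ))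
    (by positivity)
  have hev : ∀ᶠ N : ℕ in atTop, 0 < lam N ∧ Real.exp 1 ≤ l N ∧
      κ * lam N ^ (-(1 / P.b) - 1) ≤ (l N : ℝ) ∧ r P (l N) N (lam N) < 1 ∧
      r P (l N) N (lam N) < κ⁻¹ :=
    hlam.and ((hl.eventually_ge_atTop _).and ((h.2 κ hκ).and
      ((h.1.eventually_lt_const zero_lt_one).and (h.1.eventually_lt_const (inv_pos.2 hκ)))))
  obtain ⟨N₀, hN₀⟩ := eventually_atTop.1 hev
  refine ⟨A, hA, N₀, fun N _ hN => ?_⟩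
  obtain ⟨h1, h2, h3, h4, h5⟩ := hN₀ N hN
  have hNpos : (0 : ℝ) < N := by exact_mod_cast NeZero.pos N
  have hl1 : (1 : ℝ) ≤ l N := le_trans (by simp) h2
  have hl0 : 0 < l N := by exact_mod_cast zero_lt_one.trans_le hl1
  have hle := rTerm_le_r P hl1 hNpos.le h1.le
  have hNh : 0 < (N : ℝ) ^ P.h := Real.rpow_pos_of_pos hNpos _
  have hlam1 : lam N ≤ 1 := by
    by_contra hcon
    have := Real.one_le_rpow (not_le.1 hcon).le (zero_le_one.trans hP.one_le_c)
    have h6 := hle 1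
    rw [rTerm_one] at h6
    linarith
  have hlog : 1 ≤ Real.log (l N) ^ P.h :=
    Real.one_le_rpow ((Real.le_log_iff_exp_le (by exact_mod_cast hl0)).2 h2) hP.h_pos.le
  have h0 : 1 / ((N : ℝ) ^ P.h * lam N ^ 3) ≤ rTerm P (l N) N (lam N) 0 := by
    rw [rTerm_zero]
    gcongr
  have hp3 : lam N ^ 3 ≤ lam N ^ 2 := pow_le_pow_of_le_one h1.le hlam1 (by norm_num)
  have hp1 : lam N ^ 3 ≤ lam N := by
    simpa using pow_le_pow_of_le_one h1.le hlam1 (show 1 ≤ 3 by norm_num)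
  refine (hT (l N) N (lam N) hl0 h1 hlam1 h3 ?_).mono ?_ le_rfl
  · have h6 : 1 / ((N : ℝ) ^ P.h * lam N ^ 3) < κ⁻¹ := (h0.trans (hle 0)).trans_lt h5
    rw [one_div, inv_lt_inv₀ (by positivity) hκ] at h6
    exact h6.le.trans (mul_le_mul_of_nonneg_left hp3 hNh.le)
  · refine mul_le_mul_of_nonneg_left ?_ hA.le
    have h6 : 1 / ((N : ℝ) ^ P.h * lam N) ≤ 1 / ((N : ℝ) ^ P.h * lam N ^ 3) := by gcongr
    have h7 := rTerm_nonneg P hl1 hNpos.le h1.le 2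
    change _ ≤ ∑ i, rTerm P (l N) N (lam N) i
    rw [Fin.sum_univ_four, ← rTerm_one P (l N) N, ← rTerm_three P (l N) N]
    linarith

/-- Half of p is allotted to η and half to exp(-δ); the cap 1/2 on η only ensures η < 1. -/
theorem HasRate.consistent {B : ℕ → ℝ} (h : HasRate.{u, v, w} P l lam B)
    (hB : Tendsto B atTop (𝓝 0)) : Consistent.{u, v, w} P l lam := by
  intro ε p hε hp
  set η := min (p / 2) (1 / 2) with hη
  have hη0 : 0 < η := by positivity
  have hη1 : η < 1 := (min_le_right _ _).trans_lt (by norm_num)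
  obtain ⟨δ, hδ0, hδ⟩ : ∃ δ : ℝ, 0 < δ ∧ Real.exp (-δ) ≤ p / 2 := by
    have h1 : Tendsto (fun δ : ℝ => Real.exp (-δ)) atTop (𝓝 0) := Real.tendsto_exp_neg_atTop_nhds_zero
    obtain ⟨δ, h2, h3⟩ := ((eventually_gt_atTop 0).and
      (h1.eventually_lt_const (half_pos hp))).exists
    exact ⟨δ, h2, h3.le⟩
  obtain ⟨A, hA, N₀, hN₀⟩ := h η δ hη0 hη1 hδ0
  have h1 : Tendsto (fun N => A * B N) atTop (𝓝 0) := by simpa using hB.const_mul A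
  obtain ⟨N₁, hN₁⟩ := eventually_atTop.1 (h1.eventually_lt_const hε)
  refine ⟨max N₀ N₁, fun N _ hN => ?_⟩
  refine (hN₀ N ((le_max_left _ _).trans hN)).mono (hN₁ N ((le_max_right _ _).trans hN)).le ?_
  have := min_le_left (p / 2) (1 / 2)
  linarith

theorem HasRate.of_isBigO {B B' : ℕ → ℝ} (h : HasRate.{u, v, w} P l lam B) (hB : B =O[atTop] B')
    (hB' : ∀ᶠ N in atTop, 0 ≤ B' N) : HasRate.{u, v, w} P l lam B' := by
  intro η δ hη hη1 hδ
  obtain ⟨A, hA, N₀, hN₀⟩ := h η δ hη hη1 hδ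
  obtain ⟨c, hc, hO⟩ := hB.exists_pos
  obtain ⟨N₁, hN₁⟩ := eventually_atTop.1 (hO.bound.and hB')
  refine ⟨A * c, by positivity, max N₀ N₁, fun N _ hN => ?_⟩
  refine (hN₀ N ((le_max_left _ _).trans hN)).mono ?_ le_rfl
  obtain ⟨h1, h2⟩ := hN₁ N ((le_max_right _ _).trans hN)
  rw [Real.norm_eq_abs, Real.norm_eq_abs, abs_of_nonneg h2] at h1
  rw [mul_assoc]
  exact mul_le_mul_of_nonneg_left ((le_abs_self _).trans h1) hA.le

/-! ### Orders of growth `N ^ p * (log N) ^ q` -/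

/-- The sequence `N ^ p * (log N) ^ q`. -/
noncomputable def powLog (p q : ℝ) (N : ℕ) : ℝ := (N : ℝ) ^ p * Real.log N ^ q

/-- `f` is eventually positive and of the order `N ^ p * (log N) ^ q`. -/
def HasOrder (f : ℕ → ℝ) (p q : ℝ) : Prop := (∀ᶠ N in atTop, 0 < f N) ∧ f =Θ[atTop] powLog p q

/-- `N ^ p * (log N) ^ q` tends to zero. -/
def OrderNeg (p q : ℝ) : Prop := p < 0 ∨ p = 0 ∧ q < 0

theorem tendsto_log_natCast : Tendsto (fun N : ℕ => Real.log N) atTop atTop :=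
  Real.tendsto_log_atTop.comp tendsto_natCast_atTop_atTop

theorem eventually_pos_and_log_pos : ∀ᶠ N : ℕ in atTop, (0 : ℝ) < N ∧ 0 < Real.log N :=
  (tendsto_natCast_atTop_atTop.eventually_gt_atTop 0).and (tendsto_log_natCast.eventually_gt_atTop 0)

theorem eventually_powLog_pos (p q : ℝ) : ∀ᶠ N in atTop, 0 < powLog p q N := by
  filter_upwards [eventually_pos_and_log_pos] with N hN
  exact mul_pos (Real.rpow_pos_of_pos hN.1 _) (Real.rpow_pos_of_pos hN.2 _)

theorem powLog_mul_eventuallyEq (p q p' q' : ℝ) :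
    (fun N => powLog p q N * powLog p' q' N) =ᶠ[atTop] powLog (p + p') (q + q') := by
  filter_upwards [eventually_pos_and_log_pos] with N hN
  simp only [powLog]
  rw [Real.rpow_add hN.1, Real.rpow_add hN.2]
  ring

theorem powLog_rpow_eventuallyEq (p q s : ℝ) :
    (fun N => powLog p q N ^ s) =ᶠ[atTop] powLog (s * p) (s * q) := by
  filter_upwards [eventually_pos_and_log_pos] with N hN
  simp only [powLog]
  rw [Real.mul_rpow (Real.rpow_nonneg hN.1.le _) (Real.rpow_nonneg hN.2.le _),
    ← Real.rpow_mul hN.1.le, ← Real.rpow_mul hN.2.le, mul_comm p, mul_comm q]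

theorem tendsto_powLog_zero {p q : ℝ} (h : OrderNeg p q) :
    Tendsto (powLog p q) atTop (𝓝 0) := by
  rcases h with h | ⟨rfl, h⟩
  · have h1 := ((isLittleO_log_rpow_rpow_atTop q (neg_pos.2 h)).comp_tendsto
      tendsto_natCast_atTop_atTop).tendsto_div_nhds_zero
    refine h1.congr' ?_
    filter_upwards [eventually_pos_and_log_pos] with N hN
    simp only [Function.comp, powLog]
    rw [Real.rpow_neg hN.1.le, div_inv_eq_mul, mul_comm]
  · have h1 := (tendsto_rpow_neg_atTop (neg_pos.2 h)).comp tendsto_log_natCast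
    have e : powLog 0 q = fun N : ℕ => Real.log N ^ q := funext fun N => by simp [powLog]
    simpa [Function.comp_def, e] using h1

theorem tendsto_powLog_atTop {p q : ℝ} (h : OrderNeg (-p) (-q)) :
    Tendsto (powLog p q) atTop atTop := by
  have h1 : Tendsto (powLog (-p) (-q)) atTop (𝓝[>] 0) :=
    tendsto_nhdsWithin_iff.2 ⟨tendsto_powLog_zero h, eventually_powLog_pos _ _⟩
  refine h1.inv_tendsto_nhdsGT_zero.congr' ?_
  filter_upwards [eventually_pos_and_log_pos] with N hN
  simp only [Pi.inv_apply, powLog]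
  rw [Real.rpow_neg hN.1.le, Real.rpow_neg hN.2.le, mul_inv, inv_inv, inv_inv]

/-- The three cases are decay, constancy and divergence of N^p (log N)^q. Their exclusivity turns
the asymptotic statements into equivalences. -/
theorem orderNeg_trichotomy (p q : ℝ) : OrderNeg p q ∨ (p = 0 ∧ q = 0) ∨ OrderNeg (-p) (-q) := by
  unfold OrderNeg
  rcases lt_trichotomy p 0 with h | h | h
  · exact Or.inl (Or.inl h)
  · rcases lt_trichotomy q 0 with h' | h' | h'
    · exact Or.inl (Or.inr ⟨h, h'⟩)
    · exact Or.inr (Or.inl ⟨h, h'⟩)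
    · exact Or.inr (Or.inr (Or.inr ⟨by linarith, by linarith⟩))
  · exact Or.inr (Or.inr (Or.inl (by linarith)))

theorem powLog_zero_zero (N : ℕ) : powLog 0 0 N = 1 := by simp [powLog]

theorem tendsto_powLog_zero_iff {p q : ℝ} : Tendsto (powLog p q) atTop (𝓝 0) ↔ OrderNeg p q := by
  refine ⟨fun h => ?_, tendsto_powLog_zero⟩
  rcases orderNeg_trichotomy p q with h1 | ⟨rfl, rfl⟩ | h1
  · exact h1
  · simp only [funext powLog_zero_zero] at h
    exact absurd (tendsto_nhds_unique h tendsto_const_nhds) (by norm_num)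
  · exact absurd h (not_tendsto_nhds_of_tendsto_atTop (tendsto_powLog_atTop h1) 0)

theorem powLog_isBigO_one_iff {p q : ℝ} :
    powLog p q =O[atTop] (fun _ => (1 : ℝ)) ↔ ¬ OrderNeg (-p) (-q) := by
  constructor
  · intro h h1
    have h2 := tendsto_powLog_atTop h1
    obtain ⟨c, hc⟩ := h.bound
    obtain ⟨N, h3, h4⟩ := (hc.and (h2.eventually_gt_atTop (c * ‖(1 : ℝ)‖))).exists
    exact absurd (h3.trans_lt h4) (not_lt.2 (le_abs_self _))
  · intro h
    rcases orderNeg_trichotomy p q with h1 | ⟨rfl, rfl⟩ | h1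
    · exact (tendsto_powLog_zero h1).isBigO_one ℝ
    · rw [funext powLog_zero_zero]
    · exact absurd h1 h

namespace HasOrder

variable {f g : ℕ → ℝ} {p q p' q' : ℝ}

theorem congr' (hf : HasOrder f p q) (h : f =ᶠ[atTop] g) : HasOrder g p q := by
  refine ⟨?_, (h.isTheta.symm).trans hf.2⟩
  filter_upwards [hf.1, h] with N h1 h2
  rwa [← h2]

theorem congr_order (hf : HasOrder f p q) (hp : p = p') (hq : q = q') : HasOrder f p' q' := by
  rwa [← hp, ← hq]

theorem mul (hf : HasOrder f p q) (hg : HasOrder g p' q') :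
    HasOrder (fun N => f N * g N) (p + p') (q + q') := by
  refine ⟨?_, (hf.2.mul hg.2).trans_eventuallyEq (powLog_mul_eventuallyEq _ _ _ _)⟩
  filter_upwards [hf.1, hg.1] with N h1 h2
  exact mul_pos h1 h2

theorem inv (hf : HasOrder f p q) : HasOrder (fun N => (f N)⁻¹) (-p) (-q) := by
  refine ⟨?_, hf.2.inv.trans_eventuallyEq ?_⟩
  · filter_upwards [hf.1] with N h1
    exact inv_pos.2 h1
  · filter_upwards [eventually_pos_and_log_pos] with N hN
    simp only [powLog]
    rw [Real.rpow_neg hN.1.le, Real.rpow_neg hN.2.le, mul_inv]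

theorem rpow (hf : HasOrder f p q) (s : ℝ) : HasOrder (fun N => f N ^ s) (s * p) (s * q) := by
  refine ⟨?_, (hf.2.rpow ?_ ?_).trans_eventuallyEq (powLog_rpow_eventuallyEq p q s)⟩
  · filter_upwards [hf.1] with N h1
    exact Real.rpow_pos_of_pos h1 _
  · filter_upwards [hf.1] with N h1
    exact h1.le
  · filter_upwards [eventually_powLog_pos p q] with N h1
    exact h1.le

theorem tendsto_zero_iff (hf : HasOrder f p q) : Tendsto f atTop (𝓝 0) ↔ OrderNeg p q :=
  hf.2.tendsto_zero_iff.trans tendsto_powLog_zero_iff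

theorem tendsto_atTop_iff (hf : HasOrder f p q) : Tendsto f atTop atTop ↔ OrderNeg (-p) (-q) := by
  rw [← hf.inv.tendsto_zero_iff]
  constructor
  · exact fun h => h.inv_tendsto_atTop
  · intro h
    have h1 : Tendsto (fun N => (f N)⁻¹) atTop (𝓝[>] 0) :=
      tendsto_nhdsWithin_iff.2 ⟨h, hf.inv.1⟩
    have h2 := h1.inv_tendsto_nhdsGT_zero
    rwa [show (fun N => (f N)⁻¹)⁻¹ = f from funext fun N => inv_inv _] at h2

theorem isBigO_iff (hf : HasOrder f p q) (hg : HasOrder g p' q') :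
    f =O[atTop] g ↔ ¬ OrderNeg (p' - p) (q' - q) := by
  have h := (hf.mul hg.inv).2
  have h1 : f =O[atTop] g ↔ (fun N => f N * (g N)⁻¹) =O[atTop] (fun _ => (1 : ℝ)) := by
    have := isBigO_iff_div_isBoundedUnder (f := f) (g := g) (l := atTop) (by
      filter_upwards [hg.1] with N h1 h2
      exact absurd h2 h1.ne')
    rw [this, isBigO_one_iff]
    rfl
  rw [h1, h.isBigO_congr_left, powLog_isBigO_one_iff]
  rw [show p' - p = -(p + -p') by ring, show q' - q = -(q + -q') by ring]

end HasOrder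

theorem hasOrder_powLog (p q : ℝ) : HasOrder (powLog p q) p q :=
  ⟨eventually_powLog_pos p q, isTheta_refl _ _⟩

theorem hasOrder_natCast : HasOrder (fun N => (N : ℝ)) 1 0 :=
  (hasOrder_powLog 1 0).congr' (Eventually.of_forall fun N => by simp [powLog])

theorem hasOrder_of_isTheta_rpow {l : ℕ → ℕ} {a : ℝ}
    (hl : (fun N => (l N : ℝ)) =Θ[atTop] (fun N : ℕ => (N : ℝ) ^ a)) :
    HasOrder (fun N => (l N : ℝ)) a 0 := by
  have e : powLog a 0 = fun N : ℕ => (N : ℝ) ^ a := funext fun N => by simp [powLog]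
  refine ⟨?_, e ▸ hl⟩
  filter_upwards [hl.eq_zero_iff, eventually_pos_and_log_pos] with N h1 h2
  refine lt_of_le_of_ne (Nat.cast_nonneg _) fun h => ?_
  exact (Real.rpow_pos_of_pos h2.1 a).ne' (h1.1 h.symm)

theorem hasOrder_log {l : ℕ → ℕ} {a : ℝ} (ha : 0 < a)
    (hl : (fun N => (l N : ℝ)) =Θ[atTop] (fun N : ℕ => (N : ℝ) ^ a)) :
    HasOrder (fun N => Real.log (l N)) 0 1 := by
  have hlo := hasOrder_of_isTheta_rpow hl
  have htop : Tendsto (fun N => (l N : ℝ)) atTop atTop :=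
    hlo.tendsto_atTop_iff.2 (Or.inl (by linarith))
  refine ⟨(Real.tendsto_log_atTop.comp htop).eventually_gt_atTop 0, ?_⟩
  obtain ⟨c, hc, hO⟩ := hl.1.exists_pos
  obtain ⟨c', hc', hO'⟩ := hl.2.exists_pos
  -- Constant factors in l only shift log l by O(1), which is negligible against a log N since a >
  -- 0.
  have hdiff : (fun N => Real.log (l N) - a * Real.log N) =O[atTop] (fun _ => (1 : ℝ)) := by
    refine IsBigO.of_bound (|Real.log c| + |Real.log c'|) ?_
    filter_upwards [hO.bound, hO'.bound, hlo.1, eventually_pos_and_log_pos] with N h1 h2 h3 h4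
    have hN := Real.rpow_pos_of_pos h4.1 a
    rw [Real.norm_of_nonneg h3.le, Real.norm_of_nonneg hN.le] at h1 h2
    have h5 := Real.log_le_log h3 h1
    have h6 := Real.log_le_log hN h2
    rw [Real.log_mul hc.ne' hN.ne', Real.log_rpow h4.1] at h5
    rw [Real.log_mul hc'.ne' h3.ne', Real.log_rpow h4.1] at h6
    rw [norm_one, mul_one, Real.norm_eq_abs, abs_le]
    constructor
    · linarith [le_abs_self (Real.log c'), abs_nonneg (Real.log c)]
    · linarith [le_abs_self (Real.log c), abs_nonneg (Real.log c')]
  have hone : (fun _ : ℕ => (1 : ℝ)) =o[atTop] (fun N : ℕ => Real.log N) :=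
    isLittleO_const_left.2 (Or.inr (tendsto_norm_atTop_atTop.comp tendsto_log_natCast))
  have hmain : (fun N : ℕ => a * Real.log N) =Θ[atTop] (fun N : ℕ => Real.log N) :=
    (isTheta_refl _ _).const_mul_left ha.ne'
  have h := hmain.add_isLittleO (hdiff.trans_isLittleO hone)
  have e : powLog 0 1 = fun N : ℕ => Real.log N := funext fun N => by simp [powLog]
  rw [e]
  refine (EventuallyEq.isTheta (Eventually.of_forall fun N => ?_)).trans h
  simp

/-! ### The orders of the terms of `r` -/

/-- The factor of the terms of `r` which does not depend on `λ`. -/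
noncomputable def rCoef (P : Params) (l N : ℝ) : Fin 4 → ℝ :=
  ![Real.log l ^ P.h * (N ^ P.h)⁻¹, 1, (l ^ (2 : ℝ))⁻¹, l⁻¹]

/-- The exponents of `λ` in the terms of `r`. -/
noncomputable def rExp (P : Params) : Fin 4 → ℝ := ![-3, P.c, -1, -(1 / P.b)]

/-- The exponents of `N` in `rCoef` when `l` is of order `N ^ a`. -/
noncomputable def rPow (P : Params) (a : ℝ) : Fin 4 → ℝ := ![-P.h, 0, -(2 * a), -a]

/-- The exponents of `log N` in `rCoef`. -/
noncomputable def rLog (P : Params) : Fin 4 → ℝ := ![P.h, 0, 0, 0]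

theorem rTerm_eq (P : Params) (l N : ℝ) {lam : ℝ} (hlam : 0 < lam) (i : Fin 4) :
    rTerm P l N lam i = rCoef P l N i * lam ^ rExp P i := by
  fin_cases i
  · change Real.log l ^ P.h / (N ^ P.h * lam ^ 3) =
      Real.log l ^ P.h * (N ^ P.h)⁻¹ * lam ^ (-3 : ℝ)
    rw [Real.rpow_neg hlam.le, div_eq_mul_inv, mul_inv, ← mul_assoc,
      show (3 : ℝ) = ((3 : ℕ) : ℝ) by norm_num, Real.rpow_natCast]
  · change lam ^ P.c = 1 * lam ^ P.c
    rw [one_mul]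
  · change 1 / (l ^ 2 * lam) = (l ^ (2 : ℝ))⁻¹ * lam ^ (-1 : ℝ)
    rw [Real.rpow_neg_one, one_div, mul_inv, show (2 : ℝ) = ((2 : ℕ) : ℝ) by norm_num,
      Real.rpow_natCast]
  · change 1 / (l * lam ^ (1 / P.b)) = l⁻¹ * lam ^ (-(1 / P.b))
    rw [Real.rpow_neg hlam.le, one_div, mul_inv]

section Orders

variable {P : Params} {a : ℝ} {l : ℕ → ℕ} {lam : ℕ → ℝ} {p q : ℝ}

theorem hasOrder_rCoef (ha : 0 < a)
    (hl : (fun N => (l N : ℝ)) =Θ[atTop] (fun N : ℕ => (N : ℝ) ^ a)) (i : Fin 4) :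
    HasOrder (fun N => rCoef P (l N) N i) (rPow P a i) (rLog P i) := by
  have h1 := hasOrder_of_isTheta_rpow hl
  fin_cases i
  · exact (((hasOrder_log ha hl).rpow P.h).mul (hasOrder_natCast.rpow P.h).inv).congr_order
      (by simp [rPow]) (by simp [rLog])
  · exact (hasOrder_powLog 0 0).congr' (Eventually.of_forall powLog_zero_zero)
  · exact (h1.rpow 2).inv.congr_order (by simp [rPow]) (by simp [rLog])
  · exact h1.inv.congr_order (by simp [rPow]) (by simp [rLog])

theorem hasOrder_rTerm (ha : 0 < a)
    (hl : (fun N => (l N : ℝ)) =Θ[atTop] (fun N : ℕ => (N : ℝ) ^ a)) (hlam : HasOrder lam p q)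
    (i : Fin 4) : HasOrder (fun N => rTerm P (l N) N (lam N) i)
      (rPow P a i + rExp P i * p) (rLog P i + rExp P i * q) := by
  refine ((hasOrder_rCoef ha hl i).mul (hlam.rpow (rExp P i))).congr' ?_
  filter_upwards [hlam.1] with N hN
  exact (rTerm_eq P _ _ hN i).symm

/-- Matching says that λ^(x_i - x_j) has the order of the quotient of the coefficients, where x_i,
x_j are the exponents of λ; take the root. Thus every admissible choice of λ has the same order. -/
theorem Matched.hasOrder {i j : Fin 4} (h : Matched P l lam i j) (ha : 0 < a)
    (hl : (fun N => (l N : ℝ)) =Θ[atTop] (fun N : ℕ => (N : ℝ) ^ a))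
    (hij : rExp P i - rExp P j ≠ 0) :
    HasOrder lam ((rPow P a j - rPow P a i) / (rExp P i - rExp P j))
      ((rLog P j - rLog P i) / (rExp P i - rExp P j)) := by
  have hi := hasOrder_rCoef (P := P) ha hl i
  have hj := hasOrder_rCoef (P := P) ha hl j
  have h1 : (fun N => rCoef P (l N) N i * lam N ^ rExp P i) =Θ[atTop]
      (fun N => rCoef P (l N) N j * lam N ^ rExp P j) := by
    refine (EventuallyEq.isTheta ?_).trans (h.2.trans (EventuallyEq.isTheta ?_))
    · filter_upwards [h.1] with N hN
      exact (rTerm_eq P _ _ hN i).symm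
    · filter_upwards [h.1] with N hN
      exact rTerm_eq P _ _ hN j
  have h2 : (fun N => lam N ^ (rExp P i - rExp P j)) =Θ[atTop]
      (fun N => rCoef P (l N) N j * (rCoef P (l N) N i)⁻¹) := by
    have h3 := h1.mul (isTheta_refl (fun N => (rCoef P (l N) N i)⁻¹ * (lam N ^ rExp P j)⁻¹) atTop)
    refine (EventuallyEq.isTheta ?_).trans (h3.trans (EventuallyEq.isTheta ?_))
    · filter_upwards [h.1, hi.1] with N hN h4
      have := h4.ne'
      rw [Real.rpow_sub hN]
      field_simp
    · filter_upwards [h.1, hi.1] with N hN h4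
      have := (Real.rpow_pos_of_pos hN (rExp P j)).ne'
      field_simp
  have h3 : HasOrder (fun N => lam N ^ (rExp P i - rExp P j)) (rPow P a j + -rPow P a i)
      (rLog P j + -rLog P i) := by
    refine ⟨?_, h2.trans (hj.mul hi.inv).2⟩
    filter_upwards [h.1] with N hN
    exact Real.rpow_pos_of_pos hN _
  refine ((h3.rpow (rExp P i - rExp P j)⁻¹).congr' ?_).congr_order (by ring) (by ring)
  filter_upwards [h.1] with N hN
  rw [← Real.rpow_mul hN.le, mul_inv_cancel₀ hij, Real.rpow_one]

theorem exists_match (ha : 0 < a)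
    (hl : (fun N => (l N : ℝ)) =Θ[atTop] (fun N : ℕ => (N : ℝ) ^ a)) {i j : Fin 4}
    (hij : rExp P i - rExp P j ≠ 0) : ∃ lam : ℕ → ℝ, ∀ᶠ N in atTop, 0 < lam N ∧
      rTerm P (l N) N (lam N) i = rTerm P (l N) N (lam N) j := by
  have hi := hasOrder_rCoef (P := P) ha hl i
  have hj := hasOrder_rCoef (P := P) ha hl j
  refine ⟨fun N => (rCoef P (l N) N j * (rCoef P (l N) N i)⁻¹) ^ (rExp P i - rExp P j)⁻¹, ?_⟩
  filter_upwards [hi.1, hj.1] with N h1 h2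
  have h3 : 0 < rCoef P (l N) N j * (rCoef P (l N) N i)⁻¹ := mul_pos h2 (inv_pos.2 h1)
  have h4 := Real.rpow_pos_of_pos h3 (rExp P i - rExp P j)⁻¹
  refine ⟨h4, ?_⟩
  rw [rTerm_eq P _ _ h4, rTerm_eq P _ _ h4]
  set x := (rCoef P (l N) N j * (rCoef P (l N) N i)⁻¹) ^ (rExp P i - rExp P j)⁻¹ with hx
  have h5 : x ^ rExp P i = x ^ rExp P j * (rCoef P (l N) N j * (rCoef P (l N) N i)⁻¹) := by
    have h6 : x ^ (rExp P i - rExp P j) = rCoef P (l N) N j * (rCoef P (l N) N i)⁻¹ := by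
      rw [hx, ← Real.rpow_mul h3.le, inv_mul_cancel₀ hij, Real.rpow_one]
    rw [← h6, ← Real.rpow_add h4, add_sub_cancel]
  rw [h5]
  have := h1.ne'
  field_simp

theorem tendsto_r_zero_iff (ha : 0 < a)
    (hl : (fun N => (l N : ℝ)) =Θ[atTop] (fun N : ℕ => (N : ℝ) ^ a)) (hlam : HasOrder lam p q) :
    Tendsto (fun N : ℕ => r P (l N) N (lam N)) atTop (𝓝 0) ↔
      ∀ i, OrderNeg (rPow P a i + rExp P i * p) (rLog P i + rExp P i * q) := by
  simp_rw [← fun i => (hasOrder_rTerm (P := P) ha hl hlam i).tendsto_zero_iff]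
  have hpos : ∀ᶠ N in atTop, ∀ i, 0 < rTerm P (l N) N (lam N) i :=
    eventually_all.2 fun i => (hasOrder_rTerm ha hl hlam i).1
  constructor
  · intro h i
    refine squeeze_zero' ?_ ?_ h
    · filter_upwards [hpos] with N hN
      exact (hN i).le
    · filter_upwards [hpos] with N hN
      exact Finset.single_le_sum (f := rTerm P (l N) N (lam N)) (fun j _ => (hN j).le)
        (Finset.mem_univ i)
  · intro h
    have := tendsto_finsetSum (Finset.univ : Finset (Fin 4)) fun i _ => h i
    simpa [r] using this

theorem constraint_iff
    (hl : (fun N => (l N : ℝ)) =Θ[atTop] (fun N : ℕ => (N : ℝ) ^ a)) (hlam : HasOrder lam p q) :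
    (∀ κ : ℝ, 0 < κ → ∀ᶠ N in atTop, κ * lam N ^ (-(1 / P.b) - 1) ≤ (l N : ℝ)) ↔
      OrderNeg (-(a + (1 / P.b + 1) * p)) (-((1 / P.b + 1) * q)) := by
  have h := (hasOrder_of_isTheta_rpow hl).mul (hlam.rpow (1 / P.b + 1))
  rw [zero_add] at h
  rw [← h.tendsto_atTop_iff]
  have hiff : ∀ᶠ N in atTop, ∀ κ : ℝ, κ * lam N ^ (-(1 / P.b) - 1) ≤ (l N : ℝ) ↔
      κ ≤ (l N : ℝ) * lam N ^ (1 / P.b + 1) := by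
    filter_upwards [hlam.1] with N hN κ
    rw [show -(1 / P.b) - 1 = -(1 / P.b + 1) by ring, Real.rpow_neg hN.le, ← div_eq_mul_inv,
      div_le_iff₀ (Real.rpow_pos_of_pos hN _)]
  constructor
  · intro h1
    refine tendsto_atTop.2 fun κ => ?_
    filter_upwards [h1 (max κ 1) (by positivity), hiff] with N h2 h3
    -- The constraint is available only for positive factors, hence max κ 1.
    exact (le_max_left _ _).trans ((h3 _).1 h2)
  · intro h1 κ _
    filter_upwards [h1.eventually_ge_atTop κ, hiff] with N h2 h3
    exact (h3 _).2 h2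

theorem converges_iff (ha : 0 < a)
    (hl : (fun N => (l N : ℝ)) =Θ[atTop] (fun N : ℕ => (N : ℝ) ^ a)) (hlam : HasOrder lam p q) :
    Converges P l lam ↔
      (∀ i, OrderNeg (rPow P a i + rExp P i * p) (rLog P i + rExp P i * q)) ∧
      OrderNeg (-(a + (1 / P.b + 1) * p)) (-((1 / P.b + 1) * q)) :=
  and_congr (tendsto_r_zero_iff ha hl hlam) (constraint_iff hl hlam)

end Orders

/-! ### The matchings of two terms of `r` -/

theorem orderNeg_iff_nonpos {p q : ℝ} (hq : q < 0) : OrderNeg p q ↔ p ≤ 0 := by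
  rw [OrderNeg, le_iff_lt_or_eq]
  simp [hq]

theorem orderNeg_iff_neg {p q : ℝ} (hq : 0 ≤ q) : OrderNeg p q ↔ p < 0 := by
  simp [OrderNeg, hq.not_gt]

section Scaled

variable {x q k y z : ℝ}

/-- This and the next three lemmas produce the entries of the table: the sign of the logarithmic
exponent decides between ≤ and <, and the positive factor k is what must be divided out of the power
exponent. -/
theorem orderNeg_iff_le (hq : q < 0) (hk : 0 < k) (hx : x = k * (y - z)) :
    OrderNeg x q ↔ y ≤ z := by
  rw [orderNeg_iff_nonpos hq, hx, ← not_lt, mul_pos_iff_of_pos_left hk, sub_pos, not_lt]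

theorem orderNeg_iff_lt (hq : 0 ≤ q) (hk : 0 < k) (hx : x = k * (y - z)) :
    OrderNeg x q ↔ y < z := by
  rw [orderNeg_iff_neg hq, hx, ← not_le, mul_nonneg_iff_of_pos_left hk, sub_nonneg, not_le]

theorem not_orderNeg_iff_lt (hq : q < 0) (hk : 0 < k) (hx : x = k * (z - y)) :
    ¬ OrderNeg x q ↔ y < z := by
  rw [orderNeg_iff_le hq hk hx, not_le]

theorem not_orderNeg_iff_le (hq : 0 ≤ q) (hk : 0 < k) (hx : x = k * (z - y)) :
    ¬ OrderNeg x q ↔ y ≤ z := by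
  rw [orderNeg_iff_lt hq hk hx, not_lt]

end Scaled

theorem forall_fin_four {p : Fin 4 → Prop} : (∀ i, p i) ↔ p 0 ∧ p 1 ∧ p 2 ∧ p 3 := by
  simp [Fin.forall_fin_succ]

/-- The exponents of λ are strictly ordered: -3 < -1 < -1/b < c. -/
theorem Params.Admissible.rExp_sub_ne_zero {P : Params} (hP : P.Admissible) {i j : Fin 4}
    (hij : i ≠ j) : rExp P i - rExp P j ≠ 0 := by
  have hc := hP.one_le_c
  have h0 : 0 < 1 / P.b := one_div_pos.2 (one_pos.trans hP.one_lt_b)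
  have h1 : 1 / P.b < 1 := (div_lt_one (one_pos.trans hP.one_lt_b)).2 hP.one_lt_b
  have h02 : rExp P 0 < rExp P 2 := by change (-3 : ℝ) < -1; norm_num
  have h23 : rExp P 2 < rExp P 3 := by change -1 < -(1 / P.b); linarith
  have h31 : rExp P 3 < rExp P 1 := by change -(1 / P.b) < P.c; linarith
  refine sub_ne_zero.2 fun h => ?_
  fin_cases i <;> fin_cases j <;> first
    | exact hij rfl
    | exact h02.ne h
    | exact h02.ne' h
    | exact h23.ne h
    | exact h23.ne' h
    | exact h31.ne h
    | exact h31.ne' h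
    | exact (h02.trans h23).ne h
    | exact (h02.trans h23).ne' h
    | exact (h23.trans h31).ne h
    | exact (h23.trans h31).ne' h
    | exact ((h02.trans h23).trans h31).ne h
    | exact ((h02.trans h23).trans h31).ne' h

section Pairs

variable {P : Params} {a : ℝ} {l : ℕ → ℕ} {lam : ℕ → ℝ} {p q : ℝ}

theorem converges_iff_forall_term (ha : 0 < a)
    (hl : (fun N => (l N : ℝ)) =Θ[atTop] (fun N : ℕ => (N : ℝ) ^ a)) (hlam : HasOrder lam p q) :
    Converges P l lam ↔
      (OrderNeg (-P.h + -3 * p) (P.h + -3 * q) ∧ OrderNeg (0 + P.c * p) (0 + P.c * q) ∧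
        OrderNeg (-(2 * a) + -1 * p) (0 + -1 * q) ∧
        OrderNeg (-a + -(1 / P.b) * p) (0 + -(1 / P.b) * q)) ∧
      OrderNeg (-(a + (1 / P.b + 1) * p)) (-((1 / P.b + 1) * q)) :=
  (converges_iff ha hl hlam).trans (and_congr_left fun _ => forall_fin_four)

theorem Converges.consistent_and_hasRate (hP : P.Admissible) (ha : 0 < a)
    (hl : (fun N => (l N : ℝ)) =Θ[atTop] (fun N : ℕ => (N : ℝ) ^ a))
    (hlam : ∀ᶠ N in atTop, 0 < lam N) (h : Converges P l lam) :
    Consistent.{u, v, w} P l lam ∧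
      HasRate.{u, v, w} P l lam (fun N => r P (l N) N (lam N)) := by
  have htop := (hasOrder_of_isTheta_rpow hl).tendsto_atTop_iff.2 (Or.inl (by linarith))
  have hr : HasRate.{u, v, w} P l lam (fun N => r P (l N) N (lam N)) := h.hasRate hP htop hlam
  exact ⟨hr.consistent h.1, hr⟩

theorem Converges.hasRate_of_dominates (hP : P.Admissible) (ha : 0 < a)
    (hl : (fun N => (l N : ℝ)) =Θ[atTop] (fun N : ℕ => (N : ℝ) ^ a)) (hlam : HasOrder lam p q)
    {i : Fin 4} {B : ℕ → ℝ}
    (hB : HasOrder B (rPow P a i + rExp P i * p) (rLog P i + rExp P i * q))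
    (h : Converges P l lam ∧ Dominates P l lam i) : HasRate.{u, v, w} P l lam B := by
  refine (h.1.consistent_and_hasRate hP ha hl hlam.1).2.of_isBigO ?_
    (hB.1.mono fun _ hN => hN.le)
  have h1 : (fun N : ℕ => r P (l N) N (lam N)) =O[atTop]
      (fun N : ℕ => rTerm P (l N) N (lam N) i) := by
    simpa only [r] using IsBigO.fun_sum fun m (_ : m ∈ Finset.univ) => h.2 m
  exact h1.trans ((hasOrder_rTerm ha hl hlam i).2.trans hB.2.symm).1

theorem hasOrder_log_div_rpow (s : ℝ) :
    HasOrder (fun N : ℕ => (Real.log N / N) ^ s) (-s) s := by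
  refine (hasOrder_powLog (-s) s).congr' ?_
  filter_upwards [eventually_pos_and_log_pos] with N hN
  rw [powLog, Real.div_rpow hN.2.le hN.1.le, Real.rpow_neg hN.1.le, div_eq_mul_inv, mul_comm]

theorem hasOrder_one_div_powLog (p q : ℝ) :
    HasOrder (fun N : ℕ => 1 / ((N : ℝ) ^ p * Real.log N ^ q)) (-p) (-q) :=
  (hasOrder_powLog p q).inv.congr' (Eventually.of_forall fun _ => (one_div _).symm)

/-- The matched terms have equal order, so only the other two have to be compared with them. -/
theorem Matched.dominates_iff {i j m n : Fin 4} (h : Matched P l lam i j) (ha : 0 < a)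
    (hl : (fun N => (l N : ℝ)) =Θ[atTop] (fun N : ℕ => (N : ℝ) ^ a)) (hlam : HasOrder lam p q)
    (hmn : ∀ k, k = i ∨ k = j ∨ k = m ∨ k = n) : Dominates P l lam i ↔
      ¬ OrderNeg (rPow P a i + rExp P i * p - (rPow P a m + rExp P m * p))
        (rLog P i + rExp P i * q - (rLog P m + rExp P m * q)) ∧
      ¬ OrderNeg (rPow P a i + rExp P i * p - (rPow P a n + rExp P n * p))
        (rLog P i + rExp P i * q - (rLog P n + rExp P n * q)) := by
  have key := fun k => (hasOrder_rTerm (P := P) ha hl hlam k).isBigO_iff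
    (hasOrder_rTerm (P := P) ha hl hlam i)
  rw [← key m, ← key n]
  refine ⟨fun hd => ⟨hd m, hd n⟩, fun hd k => ?_⟩
  rcases hmn k with rfl | rfl | rfl | rfl
  · exact isBigO_refl _ _
  · exact h.2.2
  · exact hd.1
  · exact hd.2

theorem Matched.hasOrder_of_mul_eq {i j : Fin 4} (h : Matched P l lam i j) (hP : P.Admissible)
    (hij : i ≠ j) (ha : 0 < a) (hl : (fun N => (l N : ℝ)) =Θ[atTop] (fun N : ℕ => (N : ℝ) ^ a))
    (hp : p * (rExp P i - rExp P j) = rPow P a j - rPow P a i)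
    (hq : q * (rExp P i - rExp P j) = rLog P j - rLog P i) : HasOrder lam p q :=
  have hne := hP.rExp_sub_ne_zero hij
  (h.hasOrder ha hl hne).congr_order ((eq_div_iff hne).2 hp).symm ((eq_div_iff hne).2 hq).symm

theorem Matched.hasOrder_zero_one (hP : P.Admissible) (ha : 0 < a)
    (hl : (fun N => (l N : ℝ)) =Θ[atTop] (fun N : ℕ => (N : ℝ) ^ a)) (h : Matched P l lam 0 1) :
    HasOrder lam (-(P.h / (P.c + 3))) (P.h / (P.c + 3)) := by
  have hb := hP.one_lt_b
  have hc := hP.one_le_c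
  refine h.hasOrder_of_mul_eq hP (by decide) ha hl ?_ ?_
  · change (-(P.h / (P.c + 3))) * (-3 - P.c) = 0 - -P.h
    field_simp
    ring
  · change (P.h / (P.c + 3)) * (-3 - P.c) = 0 - P.h
    field_simp
    ring

theorem Matched.hasOrder_zero_two (hP : P.Admissible) (ha : 0 < a)
    (hl : (fun N => (l N : ℝ)) =Θ[atTop] (fun N : ℕ => (N : ℝ) ^ a)) (h : Matched P l lam 0 2) :
    HasOrder lam (a - P.h / 2) (P.h / 2) := by
  have hb := hP.one_lt_b
  have hc := hP.one_le_c
  refine h.hasOrder_of_mul_eq hP (by decide) ha hl ?_ ?_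
  · change (a - P.h / 2) * (-3 - -1) = -(2 * a) - -P.h
    field_simp
    ring
  · change (P.h / 2) * (-3 - -1) = 0 - P.h
    field_simp
    ring

theorem Matched.hasOrder_zero_three (hP : P.Admissible) (ha : 0 < a)
    (hl : (fun N => (l N : ℝ)) =Θ[atTop] (fun N : ℕ => (N : ℝ) ^ a)) (h : Matched P l lam 0 3) :
    HasOrder lam ((a - P.h) * P.b / (3 * P.b - 1)) (P.h * P.b / (3 * P.b - 1)) := by
  have hb := hP.one_lt_b
  have hc := hP.one_le_c
  have hd : 3 * P.b - 1 ≠ 0 := by linarith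
  refine h.hasOrder_of_mul_eq hP (by decide) ha hl ?_ ?_
  · change ((a - P.h) * P.b / (3 * P.b - 1)) * (-3 - -(1 / P.b)) = -a - -P.h
    rw [div_mul_eq_mul_div, div_eq_iff hd]
    field_simp
    ring
  · change (P.h * P.b / (3 * P.b - 1)) * (-3 - -(1 / P.b)) = 0 - P.h
    rw [div_mul_eq_mul_div, div_eq_iff hd]
    field_simp
    ring

theorem Matched.hasOrder_one_two (hP : P.Admissible) (ha : 0 < a)
    (hl : (fun N => (l N : ℝ)) =Θ[atTop] (fun N : ℕ => (N : ℝ) ^ a)) (h : Matched P l lam 1 2) :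
    HasOrder lam (-(2 * a / (P.c + 1))) (0) := by
  have hb := hP.one_lt_b
  have hc := hP.one_le_c
  refine h.hasOrder_of_mul_eq hP (by decide) ha hl ?_ ?_
  · change (-(2 * a / (P.c + 1))) * (P.c - -1) = -(2 * a) - 0
    field_simp
    ring
  · change (0) * (P.c - -1) = 0 - 0
    field_simp
    ring

theorem Matched.hasOrder_one_three (hP : P.Admissible) (ha : 0 < a)
    (hl : (fun N => (l N : ℝ)) =Θ[atTop] (fun N : ℕ => (N : ℝ) ^ a)) (h : Matched P l lam 1 3) :
    HasOrder lam (-(a * P.b / (P.b * P.c + 1))) (0) := by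
  have hb := hP.one_lt_b
  have hc := hP.one_le_c
  refine h.hasOrder_of_mul_eq hP (by decide) ha hl ?_ ?_
  · change (-(a * P.b / (P.b * P.c + 1))) * (P.c - -(1 / P.b)) = -a - 0
    field_simp
    ring
  · change (0) * (P.c - -(1 / P.b)) = 0 - 0
    field_simp
    ring

theorem Matched.hasOrder_two_three (hP : P.Admissible) (ha : 0 < a)
    (hl : (fun N => (l N : ℝ)) =Θ[atTop] (fun N : ℕ => (N : ℝ) ^ a)) (h : Matched P l lam 2 3) :
    HasOrder lam (-(a * P.b / (P.b - 1))) (0) := by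
  have hb := hP.one_lt_b
  have hc := hP.one_le_c
  have hd : P.b - 1 ≠ 0 := by linarith
  refine h.hasOrder_of_mul_eq hP (by decide) ha hl ?_ ?_
  · change (-(a * P.b / (P.b - 1))) * (-1 - -(1 / P.b)) = -a - -(2 * a)
    field_simp
    ring
  · change (0) * (-1 - -(1 / P.b)) = 0 - 0
    field_simp
    ring

end Pairs

/-! ### Convergence and domination for each pair of terms -/

section Table

variable {P : Params} {a : ℝ} {l : ℕ → ℕ} {lam : ℕ → ℝ}

/-- The matched terms tend to 0 for every a, and the constraint on l implies that the other two do
as well. It is not strict because l λ^(1/b+1) carries a positive power of log N. -/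
theorem converges_iff_of_matched_zero_one (hP : P.Admissible) (ha : 0 < a)
    (hl : (fun N => (l N : ℝ)) =Θ[atTop] (fun N : ℕ => (N : ℝ) ^ a)) (h : Matched P l lam 0 1) :
    Converges P l lam ↔ P.h * (P.b + 1) / ((P.c + 3) * P.b) ≤ a := by
  have hb : 0 < P.b := one_pos.trans hP.one_lt_b
  have hc : 0 < P.c := one_pos.trans_le hP.one_le_c
  have hh := hP.h_pos
  have hlam := h.hasOrder_zero_one hP ha hl
  -- In terms of w, with h = w(c + 3), all conditions are linear in a, w, cw and w/b.
  obtain ⟨w, hw⟩ : ∃ w, w = P.h / (P.c + 3) := ⟨_, rfl⟩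
  have hw0 : 0 < w := by rw [hw]; positivity
  have hhw : P.h = w * (P.c + 3) := by rw [hw]; field_simp
  rw [← hw] at hlam
  have e : P.h * (P.b + 1) / ((P.c + 3) * P.b) = w * (1 / P.b + 1) := by
    rw [hhw]; field_simp; ring
  have hu : 0 < 1 / P.b := by positivity
  rw [converges_iff_forall_term ha hl hlam, e, hhw]
  generalize 1 / P.b = u at hu
  have hcw := mul_pos hc hw0
  have huw := mul_pos hu hw0
  rw [orderNeg_iff_le (z := a) (y := w * (u + 1)) (k := 1) (x := -(a + (u + 1) * -w))
    (by linarith) one_pos (by ring)]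
  refine ⟨fun H => H.2, fun H => ⟨⟨Or.inl (by linarith), Or.inl (by linarith), ?_, ?_⟩, H⟩⟩
  · exact (orderNeg_iff_nonpos (by linarith)).2 (by linarith)
  · exact (orderNeg_iff_nonpos (by linarith)).2 (by linarith)

theorem dominates_iff_of_matched_zero_one (hP : P.Admissible) (ha : 0 < a)
    (hl : (fun N => (l N : ℝ)) =Θ[atTop] (fun N : ℕ => (N : ℝ) ^ a)) (h : Matched P l lam 0 1) :
    Dominates P l lam 0 ↔
      P.h * (P.c + 1) / (2 * (P.c + 3)) ≤ a ∧ P.h * (1 / P.b + P.c) / (P.c + 3) ≤ a := by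
  have hb : 0 < P.b := one_pos.trans hP.one_lt_b
  have hc : 0 < P.c := one_pos.trans_le hP.one_le_c
  have hh := hP.h_pos
  rw [h.dominates_iff (m := 2) (n := 3) ha hl (h.hasOrder_zero_one hP ha hl) (by decide)]
  refine and_congr (not_orderNeg_iff_le (k := 2) ?_ two_pos ?_)
    (not_orderNeg_iff_le (k := 1) ?_ one_pos ?_)
  · change 0 ≤ P.h + -3 * (P.h / (P.c + 3)) - (0 + -1 * (P.h / (P.c + 3)))
    have : P.h + -3 * (P.h / (P.c + 3)) - (0 + -1 * (P.h / (P.c + 3))) =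
      P.h * (P.c + 1) / (P.c + 3) := by field_simp; ring
    rw [this]; positivity
  · change -P.h + -3 * -(P.h / (P.c + 3)) - (-(2 * a) + -1 * -(P.h / (P.c + 3))) = _
    field_simp; ring
  · change 0 ≤ P.h + -3 * (P.h / (P.c + 3)) - (0 + -(1 / P.b) * (P.h / (P.c + 3)))
    have : P.h + -3 * (P.h / (P.c + 3)) - (0 + -(1 / P.b) * (P.h / (P.c + 3))) =
      P.h * (1 / P.b + P.c) / (P.c + 3) := by field_simp; ring
    rw [this]; positivity
  · change -P.h + -3 * -(P.h / (P.c + 3)) - (-a + -(1 / P.b) * -(P.h / (P.c + 3))) = _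
    field_simp; ring

/-- One condition per term of r, followed by the constraint; h/6 occurs twice because the matched
terms impose the same condition. -/
theorem converges_iff_of_matched_zero_two (hP : P.Admissible) (ha : 0 < a)
    (hl : (fun N => (l N : ℝ)) =Θ[atTop] (fun N : ℕ => (N : ℝ) ^ a)) (h : Matched P l lam 0 2) :
    Converges P l lam ↔
      (P.h / 6 ≤ a ∧ a < P.h / 2 ∧ P.h / 6 ≤ a ∧ P.h / (2 * (P.b + 1)) ≤ a) ∧
      P.h * (P.b + 1) / (2 * (2 * P.b + 1)) ≤ a := by
  have hb : 0 < P.b := one_pos.trans hP.one_lt_b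
  have hc : 0 < P.c := one_pos.trans_le hP.one_le_c
  have hh := hP.h_pos
  have hu : 0 < 1 / P.b := by positivity
  refine (converges_iff_forall_term ha hl (h.hasOrder_zero_two hP ha hl)).trans
    (and_congr (and_congr (orderNeg_iff_le (k := 3) ?_ three_pos ?_)
      (and_congr (orderNeg_iff_lt (k := P.c) ?_ hc ?_)
      (and_congr (orderNeg_iff_le (k := 3) ?_ three_pos ?_)
        (orderNeg_iff_le (k := 1 + 1 / P.b) ?_ (by positivity) ?_))))
      (orderNeg_iff_le (k := 2 + 1 / P.b) ?_ (by positivity) ?_))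
  · linarith
  · ring
  · rw [zero_add]; positivity
  · ring
  · linarith
  · ring
  · rw [zero_add, neg_mul, neg_lt_zero]; positivity
  · field_simp; ring
  · rw [neg_lt_zero]; positivity
  · field_simp; ring

theorem dominates_iff_of_matched_zero_two (hP : P.Admissible) (ha : 0 < a)
    (hl : (fun N => (l N : ℝ)) =Θ[atTop] (fun N : ℕ => (N : ℝ) ^ a)) (h : Matched P l lam 0 2) :
    Dominates P l lam 0 ↔
      a < P.h / 2 - P.h / (P.c + 3) ∧ a < P.h / 2 * (1 / P.b - 1) / (1 / P.b - 2) := by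
  have hb : 0 < P.b := one_pos.trans hP.one_lt_b
  have hc : 0 < P.c := one_pos.trans_le hP.one_le_c
  have hh := hP.h_pos
  have hu : 0 < 1 / P.b := by positivity
  have hu1 : 1 / P.b < 1 := (div_lt_one hb).2 hP.one_lt_b
  rw [h.dominates_iff (m := 1) (n := 3) ha hl (h.hasOrder_zero_two hP ha hl) (by decide)]
  refine and_congr (not_orderNeg_iff_lt (k := P.c + 3) ?_ (by positivity) ?_)
    (not_orderNeg_iff_lt (k := 2 - 1 / P.b) ?_ (by linarith) ?_)
  · change P.h + -3 * (P.h / 2) - (0 + P.c * (P.h / 2)) < 0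
    nlinarith [mul_pos hc hh]
  · change -P.h + -3 * (a - P.h / 2) - (0 + P.c * (a - P.h / 2)) = _
    field_simp; ring
  · change P.h + -3 * (P.h / 2) - (0 + -(1 / P.b) * (P.h / 2)) < 0
    nlinarith [mul_pos (sub_pos.2 hu1) hh]
  · change -P.h + -3 * (a - P.h / 2) - (-a + -(1 / P.b) * (a - P.h / 2)) = _
    -- The bound is a quotient of two negative numbers, since 1/b < 1.
    generalize 1 / P.b = u at *
    have : u - 2 ≠ 0 := by linarith
    linear_combination div_mul_cancel₀ (P.h / 2 * (u - 1)) this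

theorem converges_iff_of_matched_zero_three (hP : P.Admissible) (ha : 0 < a)
    (hl : (fun N => (l N : ℝ)) =Θ[atTop] (fun N : ℕ => (N : ℝ) ^ a)) (h : Matched P l lam 0 3) :
    Converges P l lam ↔
      (P.h / (3 * P.b) ≤ a ∧ a < P.h ∧ P.h * P.b / (7 * P.b - 2) ≤ a ∧ P.h / (3 * P.b) ≤ a) ∧
      P.h * (P.b + 1) / (4 * P.b) ≤ a := by
  have hb1 := hP.one_lt_b
  have hb : 0 < P.b := one_pos.trans hb1
  have hc : 0 < P.c := one_pos.trans_le hP.one_le_c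
  have hh := hP.h_pos
  have hlam := h.hasOrder_zero_three hP ha hl
  obtain ⟨D, hD⟩ : ∃ D, D = 3 * P.b - 1 := ⟨_, rfl⟩
  have hD0 : 0 < D := by linarith
  have hE : 0 < 7 * P.b - 2 := by linarith
  rw [← hD] at hlam
  refine (converges_iff_forall_term ha hl hlam).trans
    (and_congr (and_congr (orderNeg_iff_le (k := 3 * P.b / D) ?_ (by positivity) ?_)
      (and_congr (orderNeg_iff_lt (k := P.c * P.b / D) ?_ (by positivity) ?_)
      (and_congr (orderNeg_iff_le (k := (7 * P.b - 2) / D) ?_ (by positivity) ?_)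
        (orderNeg_iff_le (k := 3 * P.b / D) ?_ (by positivity) ?_))))
      (orderNeg_iff_le (k := 4 * P.b / D) ?_ (by positivity) ?_))
  · have : P.h + -3 * (P.h * P.b / D) = -(P.h / D) := by field_simp; rw [hD]; ring
    rw [this, neg_lt_zero]; positivity
  · field_simp; rw [hD]; ring
  · rw [zero_add]; positivity
  · field_simp; ring
  · rw [zero_add, neg_mul, neg_lt_zero]; positivity
  · rw [div_mul_eq_mul_div, mul_sub, mul_div_cancel₀ _ hE.ne']
    field_simp; rw [hD]; ring
  · rw [zero_add, neg_mul, neg_lt_zero]; positivity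
  · field_simp; rw [hD]; ring
  · rw [neg_lt_zero]; positivity
  · field_simp; rw [hD]; ring

theorem dominates_iff_of_matched_zero_three (hP : P.Admissible) (ha : 0 < a)
    (hl : (fun N => (l N : ℝ)) =Θ[atTop] (fun N : ℕ => (N : ℝ) ^ a)) (h : Matched P l lam 0 3) :
    Dominates P l lam 0 ↔
      a < P.h * (P.b * P.c + 1) / (3 * P.b + P.b * P.c) ∧
      P.h * (P.b - 1) / (4 * P.b - 2) ≤ a := by
  have hb1 := hP.one_lt_b
  have hb : 0 < P.b := one_pos.trans hb1
  have hc : 0 < P.c := one_pos.trans_le hP.one_le_c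
  have hh := hP.h_pos
  have hlam := h.hasOrder_zero_three hP ha hl
  obtain ⟨D, hD⟩ : ∃ D, D = 3 * P.b - 1 := ⟨_, rfl⟩
  have hD0 : 0 < D := by linarith
  have hE : 0 < 4 * P.b - 2 := by linarith
  rw [← hD] at hlam
  have e : P.h + -3 * (P.h * P.b / D) = -(P.h / D) := by field_simp; rw [hD]; ring
  rw [h.dominates_iff (m := 1) (n := 2) ha hl hlam (by decide)]
  refine and_congr (not_orderNeg_iff_lt (k := (3 * P.b + P.b * P.c) / D) ?_ (by positivity) ?_)
    (not_orderNeg_iff_le (k := (4 * P.b - 2) / D) ?_ (by positivity) ?_)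
  · change P.h + -3 * (P.h * P.b / D) - (0 + P.c * (P.h * P.b / D)) < 0
    have h1 : 0 < P.h / D := by positivity
    have h2 : 0 < P.c * (P.h * P.b / D) := by positivity
    rw [e]; linarith
  · change -P.h + -3 * ((a - P.h) * P.b / D) - (0 + P.c * ((a - P.h) * P.b / D)) = _
    field_simp; rw [hD]; ring
  · change 0 ≤ P.h + -3 * (P.h * P.b / D) - (0 + -1 * (P.h * P.b / D))
    have h1 : 0 < P.h / D := by positivity
    rw [e, mul_div_right_comm]
    nlinarith
  · change -P.h + -3 * ((a - P.h) * P.b / D) - (-(2 * a) + -1 * ((a - P.h) * P.b / D)) = _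
    rw [div_mul_eq_mul_div, mul_sub, mul_div_cancel₀ _ hE.ne']
    field_simp; rw [hD]; ring

/-- Here λ is a pure power of N, so the constraint is strict and a cancels from it; only the first
term of r restricts a. -/
theorem converges_iff_of_matched_one_two (hP : P.Admissible) (ha : 0 < a)
    (hl : (fun N => (l N : ℝ)) =Θ[atTop] (fun N : ℕ => (N : ℝ) ^ a)) (h : Matched P l lam 1 2) :
    Converges P l lam ↔
      a < P.h * (P.c + 1) / 6 ∧ 2 * (P.b + 1) / ((P.c + 1) * P.b) < 1 := by
  have hb1 := hP.one_lt_b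
  have hc1 := hP.one_le_c
  have hb : 0 < P.b := one_pos.trans hb1
  have hc : 0 < P.c := one_pos.trans_le hc1
  have hh := hP.h_pos
  rw [converges_iff_forall_term ha hl (h.hasOrder_one_two hP ha hl),
    orderNeg_iff_lt (x := -P.h + -3 * -(2 * a / (P.c + 1))) (k := 6 / (P.c + 1)) (y := a)
      (z := P.h * (P.c + 1) / 6) (by linarith) (by positivity) (by field_simp; ring),
    orderNeg_iff_lt (x := -(a + (1 / P.b + 1) * -(2 * a / (P.c + 1)))) (k := a)
      (y := 2 * (P.b + 1) / ((P.c + 1) * P.b)) (z := 1) (by simp) ha (by field_simp; ring)]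
  refine ⟨fun H => ⟨H.1.1, H.2⟩, fun H => ⟨⟨H.1, Or.inl ?_, Or.inl ?_, Or.inl ?_⟩, H.2⟩⟩
  · rw [zero_add, mul_neg, neg_lt_zero]; positivity
  · have : -(2 * a) + -1 * -(2 * a / (P.c + 1)) = -(2 * a * P.c / (P.c + 1)) := by
      field_simp; ring
    rw [this, neg_lt_zero]; positivity
  · have : -a + -(1 / P.b) * -(2 * a / (P.c + 1)) =
        -(a * (P.b * (P.c + 1) - 2) / (P.b * (P.c + 1))) := by
      field_simp; ring
    have h2 : 0 < P.b * (P.c + 1) - 2 := by nlinarith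
    rw [this, neg_lt_zero]; positivity

/-- The fourth term is always larger, by the power a((c - 1) + 2/b)/(c + 1) > 0 of N. -/
theorem not_dominates_of_matched_one_two (hP : P.Admissible) (ha : 0 < a)
    (hl : (fun N => (l N : ℝ)) =Θ[atTop] (fun N : ℕ => (N : ℝ) ^ a)) (h : Matched P l lam 1 2) :
    ¬ Dominates P l lam 1 := by
  have hb : 0 < P.b := one_pos.trans hP.one_lt_b
  have hc1 := hP.one_le_c
  have hc : 0 < P.c := one_pos.trans_le hc1
  rw [h.dominates_iff (m := 3) (n := 0) ha hl (h.hasOrder_one_two hP ha hl) (by decide)]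
  refine fun H => H.1 (Or.inl ?_)
  change 0 + P.c * -(2 * a / (P.c + 1)) - (-a + -(1 / P.b) * -(2 * a / (P.c + 1))) < 0
  have : 0 + P.c * -(2 * a / (P.c + 1)) - (-a + -(1 / P.b) * -(2 * a / (P.c + 1))) =
      -(a * ((P.c - 1) + 2 / P.b) / (P.c + 1)) := by
    field_simp; ring
  have h1 : 0 ≤ P.c - 1 := by linarith
  rw [this, neg_lt_zero]
  positivity

theorem converges_iff_of_matched_one_three (hP : P.Admissible) (ha : 0 < a)
    (hl : (fun N => (l N : ℝ)) =Θ[atTop] (fun N : ℕ => (N : ℝ) ^ a)) (h : Matched P l lam 1 3) :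
    Converges P l lam ↔
      a < P.h * (P.b * P.c + 1) / (3 * P.b) ∧ (P.b + 1) / (P.b * P.c + 1) < 1 := by
  have hb : 0 < P.b := one_pos.trans hP.one_lt_b
  have hc1 := hP.one_le_c
  have hc : 0 < P.c := one_pos.trans_le hc1
  have hh := hP.h_pos
  rw [converges_iff_forall_term ha hl (h.hasOrder_one_three hP ha hl),
    orderNeg_iff_lt (x := -P.h + -3 * -(a * P.b / (P.b * P.c + 1)))
      (k := 3 * P.b / (P.b * P.c + 1)) (y := a)
      (z := P.h * (P.b * P.c + 1) / (3 * P.b)) (by linarith) (by positivity) (by field_simp; ring),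
    orderNeg_iff_lt (x := -(a + (1 / P.b + 1) * -(a * P.b / (P.b * P.c + 1)))) (k := a)
      (y := (P.b + 1) / (P.b * P.c + 1)) (z := 1) (by simp) ha (by field_simp; ring)]
  refine ⟨fun H => ⟨H.1.1, H.2⟩, fun H => ⟨⟨H.1, Or.inl ?_, Or.inl ?_, Or.inl ?_⟩, H.2⟩⟩
  · rw [zero_add, mul_neg, neg_lt_zero]; positivity
  · have : -(2 * a) + -1 * -(a * P.b / (P.b * P.c + 1)) =
        -(a * (P.b * (P.c - 1) + P.b * P.c + 2) / (P.b * P.c + 1)) := by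
      field_simp; ring
    have h1 : 0 ≤ P.c - 1 := by linarith
    rw [this, neg_lt_zero]; positivity
  · have : -a + -(1 / P.b) * -(a * P.b / (P.b * P.c + 1)) =
        -(a * (P.b * P.c) / (P.b * P.c + 1)) := by
      field_simp; ring
    rw [this, neg_lt_zero]; positivity

/-- The third term is always dominated, so only the first one gives a condition. -/
theorem dominates_iff_of_matched_one_three (hP : P.Admissible) (ha : 0 < a)
    (hl : (fun N => (l N : ℝ)) =Θ[atTop] (fun N : ℕ => (N : ℝ) ^ a)) (h : Matched P l lam 1 3) :
    Dominates P l lam 1 ↔ a < P.h * (P.b * P.c + 1) / (3 * P.b + P.b * P.c) := by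
  have hb : 0 < P.b := one_pos.trans hP.one_lt_b
  have hc1 := hP.one_le_c
  have hc : 0 < P.c := one_pos.trans_le hc1
  have hh := hP.h_pos
  rw [h.dominates_iff (m := 0) (n := 2) ha hl (h.hasOrder_one_three hP ha hl) (by decide)]
  have h2 : ¬ OrderNeg (rPow P a 1 + rExp P 1 * -(a * P.b / (P.b * P.c + 1)) -
      (rPow P a 2 + rExp P 2 * -(a * P.b / (P.b * P.c + 1))))
      (rLog P 1 + rExp P 1 * 0 - (rLog P 2 + rExp P 2 * 0)) := by
    refine (not_orderNeg_iff_le (k := 1) (y := 0)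
      (z := a * (P.b * (P.c - 1) + 2) / (P.b * P.c + 1)) ?_ one_pos ?_).2 ?_
    · change 0 ≤ 0 + P.c * 0 - (0 + -1 * 0)
      simp
    · change 0 + P.c * -(a * P.b / (P.b * P.c + 1)) -
        (-(2 * a) + -1 * -(a * P.b / (P.b * P.c + 1))) = _
      field_simp; ring
    · have h1 : 0 ≤ P.c - 1 := by linarith
      positivity
  rw [and_iff_left h2]
  refine not_orderNeg_iff_lt (k := (3 * P.b + P.b * P.c) / (P.b * P.c + 1)) ?_ (by positivity) ?_
  · change 0 + P.c * 0 - (P.h + -3 * 0) < 0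
    linarith
  · change 0 + P.c * -(a * P.b / (P.b * P.c + 1)) -
      (-P.h + -3 * -(a * P.b / (P.b * P.c + 1))) = _
    field_simp; ring

/-- The constraint fails for every a: l λ^(1/b+1) has order N^(-2a/(b-1)). -/
theorem not_converges_of_matched_two_three (hP : P.Admissible) (ha : 0 < a)
    (hl : (fun N => (l N : ℝ)) =Θ[atTop] (fun N : ℕ => (N : ℝ) ^ a)) (h : Matched P l lam 2 3) :
    ¬ Converges P l lam := by
  have hb : 0 < P.b := one_pos.trans hP.one_lt_b
  have hd : 0 < P.b - 1 := sub_pos.2 hP.one_lt_b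
  rw [converges_iff_forall_term ha hl (h.hasOrder_two_three hP ha hl)]
  refine fun H => absurd H.2 ((not_orderNeg_iff_le (k := 2 * a / (P.b - 1)) (y := 0) (z := 1)
    (by simp) (by positivity) ?_).2 zero_le_one)
  field_simp; ring

end Table

end DistReg

/-! ### Assembly of the table -/

theorem mainTheorem3 (P : DistReg.Params) (hP : P.Admissible) (a : ℝ) (ha : 0 < a)
    (l : ℕ → ℕ) (hl : (fun N => (l N : ℝ)) =Θ[atTop] (fun N : ℕ => (N : ℝ) ^ a)) :
    -- any two terms can be matched exactly
    (∀ i j : Fin 4, i ≠ j → ∃ lam : ℕ → ℝ, ∀ᶠ N in atTop, 0 < lam N ∧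
      rTerm P (l N) N (lam N) i = rTerm P (l N) N (lam N) j) ∧
    -- first and second terms matched
    (∀ lam : ℕ → ℝ, Matched P l lam 0 1 →
      (Converges P l lam ↔
        max (P.h / ((P.c + 3) * min 2 P.b)) (P.h * (P.b + 1) / ((P.c + 3) * P.b)) ≤ a) ∧
      (Converges P l lam ∧ Dominates P l lam 0 ↔
        max (P.h * (1 / P.b + P.c) / (P.c + 3)) (P.h * (P.b + 1) / ((P.c + 3) * P.b)) ≤ a) ∧
      (Converges P l lam → Consistent.{u, v, w} P l lam ∧
        HasRate.{u, v, w} P l lam (fun N => r P (l N) N (lam N))) ∧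
      (Converges P l lam ∧ Dominates P l lam 0 → HasRate.{u, v, w} P l lam
        (fun N => (Real.log N / N) ^ (P.h * P.c / (P.c + 3))))) ∧
    -- first and third terms matched
    (∀ lam : ℕ → ℝ, Matched P l lam 0 2 →
      (Converges P l lam ↔
        max (P.h / 6) (max (P.h / (2 * (P.b + 1))) (P.h * (P.b + 1) / (2 * (2 * P.b + 1)))) ≤ a ∧
        a < P.h / 2) ∧
      (Converges P l lam ∧ Dominates P l lam 0 ↔
        max (P.h / 6) (P.h * (P.b + 1) / (2 * (2 * P.b + 1))) ≤ a ∧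
        a < min (P.h / 2 - P.h / (P.c + 3)) (P.h / 2 * (1 / P.b - 1) / (1 / P.b - 2))) ∧
      (Converges P l lam → Consistent.{u, v, w} P l lam ∧
        HasRate.{u, v, w} P l lam (fun N => r P (l N) N (lam N))) ∧
      (Converges P l lam ∧ Dominates P l lam 0 → HasRate.{u, v, w} P l lam
        (fun N => 1 / ((N : ℝ) ^ (3 * a - P.h / 2) * Real.log N ^ (P.h / 2))))) ∧
    -- first and fourth terms matched
    (∀ lam : ℕ → ℝ, Matched P l lam 0 3 →
      (Converges P l lam ↔
        max (P.h * P.b / (7 * P.b - 2))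
          (max (P.h / (3 * P.b)) (P.h * (P.b + 1) / (4 * P.b))) ≤ a ∧ a < P.h) ∧
      (Converges P l lam ∧ Dominates P l lam 0 ↔
        max (P.h * (P.b - 1) / (4 * P.b - 2))
          (max (P.h / (3 * P.b)) (P.h * (P.b + 1) / (4 * P.b))) ≤ a ∧
        a < P.h * (P.b * P.c + 1) / (3 * P.b + P.b * P.c)) ∧
      (Converges P l lam → Consistent.{u, v, w} P l lam ∧
        HasRate.{u, v, w} P l lam (fun N => r P (l N) N (lam N))) ∧
      (Converges P l lam ∧ Dominates P l lam 0 → HasRate.{u, v, w} P l lam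
        (fun N => 1 / ((N : ℝ) ^ (a + (a - P.h) / (3 * P.b - 1)) *
          Real.log N ^ (P.h / (3 * P.b - 1)))))) ∧
    -- second and third terms matched: the matched terms never dominate
    (∀ lam : ℕ → ℝ, Matched P l lam 1 2 →
      (Converges P l lam ↔
        a < P.h * (P.c + 1) / 6 ∧ 2 * (P.b + 1) / ((P.c + 1) * P.b) < 1) ∧
      ¬ Dominates P l lam 1 ∧
      (Converges P l lam → Consistent.{u, v, w} P l lam ∧
        HasRate.{u, v, w} P l lam (fun N => r P (l N) N (lam N)))) ∧
    -- second and fourth terms matched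
    (∀ lam : ℕ → ℝ, Matched P l lam 1 3 →
      (Converges P l lam ↔
        a < P.h * (P.b * P.c + 1) / (3 * P.b) ∧ (P.b + 1) / (P.b * P.c + 1) < 1) ∧
      (Converges P l lam ∧ Dominates P l lam 1 ↔
        a < P.h * (P.b * P.c + 1) / (3 * P.b + P.b * P.c) ∧ (P.b + 1) / (P.b * P.c + 1) < 1) ∧
      (Converges P l lam → Consistent.{u, v, w} P l lam ∧
        HasRate.{u, v, w} P l lam (fun N => r P (l N) N (lam N))) ∧
      (Converges P l lam ∧ Dominates P l lam 1 → HasRate.{u, v, w} P l lam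
        (fun N => 1 / (N : ℝ) ^ (a * P.b * P.c / (P.b * P.c + 1))))) ∧
    -- third and fourth terms matched: never convergent
    (∀ lam : ℕ → ℝ, Matched P l lam 2 3 → ¬ Converges P l lam) := by
  have hb1 := hP.one_lt_b
  have hc1 := hP.one_le_c
  have hb : 0 < P.b := one_pos.trans hb1
  have hc : 0 < P.c := one_pos.trans_le hc1
  have hh := hP.h_pos
  refine ⟨fun i j hij => exists_match ha hl (hP.rExp_sub_ne_zero hij), fun lam h => ?_,
    fun lam h => ?_, fun lam h => ?_, fun lam h => ?_, fun lam h => ?_,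
    fun lam h => not_converges_of_matched_two_three hP ha hl h⟩
  · have hlam := h.hasOrder_zero_one hP ha hl
    have hu : 0 < 1 / P.b := by positivity
    have hw : 0 < P.h / (P.c + 3) := by positivity
    have e : P.h * (P.b + 1) / ((P.c + 3) * P.b) = P.h / (P.c + 3) * (1 / P.b + 1) := by
      field_simp; ring
    have e' : P.h * (1 / P.b + P.c) / (P.c + 3) = P.h / (P.c + 3) * (1 / P.b + P.c) := by ring
    refine ⟨?_, ?_, fun h' => h'.consistent_and_hasRate hP ha hl h.1,
      Converges.hasRate_of_dominates hP ha hl hlam ((hasOrder_log_div_rpow _).congr_order ?_ ?_)⟩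
    · rw [converges_iff_of_matched_zero_one hP ha hl h, max_eq_right]
      -- The first entry of the maximum is redundant: min(2, b) ≥ 1, so it is at most h/(c+3), hence
      -- at most h/(c+3) · (1/b + 1).
      rw [e, div_mul_eq_div_div]
      have h1 : 1 ≤ min 2 P.b := le_min one_le_two hb1.le
      exact (div_le_self hw.le h1).trans (le_mul_of_one_le_right hw.le (by linarith))
    · rw [converges_iff_of_matched_zero_one hP ha hl h,
        dominates_iff_of_matched_zero_one hP ha hl h, max_le_iff]
      -- The condition from the third term follows by averaging the other two: (c + 1)/2 ≤ ((1/b +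
      -- c) + (1/b + 1))/2.
      refine ⟨fun H => ⟨H.2.2, H.1⟩, fun H => ⟨H.2, ?_, H.1⟩⟩
      rw [e, e'] at H
      have : P.h * (P.c + 1) / (2 * (P.c + 3)) = P.h / (P.c + 3) * ((P.c + 1) / 2) := by
        field_simp
      rw [this]
      nlinarith [mul_pos hw hu]
    · change -(P.h * P.c / (P.c + 3)) = -P.h + -3 * -(P.h / (P.c + 3))
      field_simp; ring
    · change P.h * P.c / (P.c + 3) = P.h + -3 * (P.h / (P.c + 3))
      field_simp; ring
  · have hlam := h.hasOrder_zero_two hP ha hl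
    refine ⟨?_, ?_, fun h' => h'.consistent_and_hasRate hP ha hl h.1,
      Converges.hasRate_of_dominates hP ha hl hlam
        ((hasOrder_one_div_powLog _ _).congr_order ?_ ?_)⟩
    · rw [converges_iff_of_matched_zero_two hP ha hl h, max_le_iff, max_le_iff]
      tauto
    · rw [converges_iff_of_matched_zero_two hP ha hl h,
        dominates_iff_of_matched_zero_two hP ha hl h, max_le_iff, lt_min_iff]
      -- The convergence conditions absent from the right side follow: a < h/2 from the upper bound,
      -- and h/(2(b+1)) ≤ a from 2b + 1 ≤ (b + 1)².
      refine ⟨fun H => ⟨⟨H.1.1.1, H.1.2⟩, H.2⟩,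
        fun H => ⟨⟨⟨H.1.1, ?_, H.1.1, le_trans ?_ H.1.2⟩, H.1.2⟩, H.2⟩⟩
      · have : 0 < P.h / (P.c + 3) := by positivity
        linarith [H.2.1]
      · rw [div_le_div_iff₀ (by positivity) (by positivity)]
        nlinarith [mul_pos hh (mul_pos hb hb)]
    · change -(3 * a - P.h / 2) = -P.h + -3 * (a - P.h / 2)
      ring
    · change -(P.h / 2) = P.h + -3 * (P.h / 2)
      ring
  · have hlam := h.hasOrder_zero_three hP ha hl
    have hd : 3 * P.b - 1 ≠ 0 := by linarith
    refine ⟨?_, ?_, fun h' => h'.consistent_and_hasRate hP ha hl h.1,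
      Converges.hasRate_of_dominates hP ha hl hlam
        ((hasOrder_one_div_powLog _ _).congr_order ?_ ?_)⟩
    · rw [converges_iff_of_matched_zero_three hP ha hl h, max_le_iff, max_le_iff]
      tauto
    · rw [converges_iff_of_matched_zero_three hP ha hl h,
        dominates_iff_of_matched_zero_three hP ha hl h, max_le_iff, max_le_iff]
      -- Again two conditions are implied: a < h because 1 ≤ 3b, and hb ≤ a(7b - 2) as the sum of
      -- h(b - 1) ≤ a(4b - 2) and h ≤ 3ab.
      refine ⟨fun H => ⟨⟨H.2.2, H.1.1.1, H.1.2⟩, H.2.1⟩,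
        fun H => ⟨⟨⟨H.1.2.1, H.2.trans_le ?_, ?_, H.1.2.1⟩, H.1.2.2⟩, H.2, H.1.1⟩⟩
      · rw [div_le_iff₀ (by positivity)]
        nlinarith [mul_pos hh hb]
      · obtain ⟨⟨h1, h2, -⟩, -⟩ := H
        rw [div_le_iff₀ (by linarith)] at h1
        rw [div_le_iff₀ (by positivity)] at h2
        rw [div_le_iff₀ (by linarith)]
        linarith
    · change -(a + (a - P.h) / (3 * P.b - 1)) = -P.h + -3 * ((a - P.h) * P.b / (3 * P.b - 1))
      rw [mul_div_assoc', ← sub_eq_zero]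
      field_simp; ring
    · change -(P.h / (3 * P.b - 1)) = P.h + -3 * (P.h * P.b / (3 * P.b - 1))
      rw [mul_div_assoc', neg_eq_iff_add_eq_zero]
      field_simp; ring
  · exact ⟨converges_iff_of_matched_one_two hP ha hl h,
      not_dominates_of_matched_one_two hP ha hl h,
      fun h' => h'.consistent_and_hasRate hP ha hl h.1⟩
  · have hlam := h.hasOrder_one_three hP ha hl
    refine ⟨converges_iff_of_matched_one_three hP ha hl h, ?_,
      fun h' => h'.consistent_and_hasRate hP ha hl h.1,
      Converges.hasRate_of_dominates hP ha hl hlam ?_⟩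
    · rw [converges_iff_of_matched_one_three hP ha hl h,
        dominates_iff_of_matched_one_three hP ha hl h]
      refine ⟨fun H => ⟨H.2, H.1.2⟩, fun H => ⟨⟨H.1.trans ?_, H.2⟩, H.1⟩⟩
      exact div_lt_div_of_pos_left (by positivity) (by positivity)
        (lt_add_of_pos_right _ (by positivity))
    · refine ((hasOrder_one_div_powLog (a * P.b * P.c / (P.b * P.c + 1)) 0).congr'
        (Eventually.of_forall fun N => by simp)).congr_order ?_ ?_
      · change -(a * P.b * P.c / (P.b * P.c + 1)) = 0 + P.c * -(a * P.b / (P.b * P.c + 1))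
        ring
      · change -(0 : ℝ) = 0 + P.c * 0
        ring
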